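/- A finite game (in explicit form, with rational payoffs) $\Gamma=(\mathcal N,(A^i)_{i\in\mathcal N},(u^i)_{i\in\mathcal N})$ consists of a finite set $\mathcal N$ of players, a finite nonempty action set $A^i$ for each player $i$, and payoffs $u^i:\prod_j A^j\to\mathbb Q$; it is encoded by listing its action sets and its full payoff table, with payoffs written in binary. A symmetry of $\Gamma$ is a bijection $\phi$ of the disjoint union $\bigsqcup_i A^i$ onto itself, together with the permutation $\pi$ of $\mathcal N$ that it induces, such that $\phi(A^i)\subseteq A^{\pi(i)}$ for every $i$ and $u^i(\mathbf a)=u^{\pi(i)}(\phi(\mathbf a))$ for every player $i$ and every action profile $\mathbf a$, where $\phi(\mathbf a)_j=\phi(\mathbf a_{\pi^{-1}(j)})$. The symmetry is player-separable if $\pi$ is the identity. A decision problem is GI-hard if the graph isomorphism problem (given two finite simple graphs, are they isomorphic?) reduces to it by a polynomial-time many-one reduction, and GI-complete if in addition it reduces to the graph isomorphism problem by a polynomial-time many-one reduction. Theorem. The problem of deciding whether a given game has a symmetry that is not player-separable is GI-complete. It is GI-hard already when restricted to two-player zero-sum games: there is a polynomial-time computable map that sends every pair of finite simple graphs $(G_1,G_2)$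 to a two-player zero-sum game that has a symmetry which is not player-separable if and only if $G_1\cong G_2$. -/

import Mathlib

namespace GameSym

open Computability

/-! ### Prefix codes -/

/-- A code whose codewords can be split off the front of a string without ambiguity. -/
def IsPrefixCode {α Γ : Type} (c : α → List Γ) : Prop :=
  ∀ x y s t, c x ++ s = c y ++ t → x = y ∧ s = t

theorem IsPrefixCode.injective {α Γ : Type} {c : α → List Γ} (h : IsPrefixCode c) :
    Function.Injective c := fun x y hxy => (h x y [] [] (by rw [hxy])).1

open Classical in
/-- An injective encoding function, as an `Encoding`. -/
noncomputable def encodingOfInjective {α Γ : Type} (c : α → List Γ)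
    (h : Function.Injective c) : Encoding α Γ where
  encode := c
  decode l := if hl : ∃ x, c x = l then some hl.choose else none
  decode_encode x := by
    have hx : ∃ y, c y = c x := ⟨x, rfl⟩
    rw [dif_pos hx]
    exact congrArg some (h hx.choose_spec)

/-- The bits of a word, followed by a comma. -/
def encodeBits (l : List Bool) : List Γ' := l.map Γ'.bit ++ [Γ'.comma]

theorem encodeBits_prefix : IsPrefixCode encodeBits := by
  intro x
  induction x with
  | nil =>
    intro y s t h
    cases y with
    | nil => simpa [encodeBits] using h
    | cons b y => simp [encodeBits] at h
  | cons a x ih =>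
    intro y s t h
    cases y with
    | nil => simp [encodeBits] at h
    | cons b y =>
      simp only [encodeBits, List.map_cons, List.cons_append, List.cons.injEq,
        Γ'.bit.injEq] at h
      obtain ⟨h1, h2⟩ := ih y s t (by simpa [encodeBits] using h.2)
      exact ⟨by rw [h.1, h1], h2⟩

/-- A natural number in unary, followed by a comma. -/
def encodeUnary (n : ℕ) : List Γ' := encodeBits (List.replicate n true)

theorem encodeUnary_prefix : IsPrefixCode encodeUnary := by
  intro x y s t h
  obtain ⟨h1, h2⟩ := encodeBits_prefix _ _ _ _ h
  exact ⟨by simpa using congrArg List.length h1, h2⟩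

/-- A rational number: a sign bit, then the absolute value of the numerator and the denominator
(in lowest terms), both in binary. -/
def encodeRat (q : ℚ) : List Γ' :=
  Γ'.bit (decide (q.num < 0)) :: (encodeBits (encodeNat q.num.natAbs) ++ encodeBits (encodeNat q.den))

theorem encodeRat_prefix : IsPrefixCode encodeRat := by
  intro x y s t h
  simp only [encodeRat, List.cons_append, List.append_assoc, List.cons.injEq, Γ'.bit.injEq] at h
  obtain ⟨hs, h⟩ := h
  obtain ⟨hn, h⟩ := encodeBits_prefix _ _ _ _ h
  obtain ⟨hd, h⟩ := encodeBits_prefix _ _ _ _ h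
  have hn' := encodingNatBool.encode_injective hn
  have hd' := encodingNatBool.encode_injective hd
  refine ⟨Rat.ext ?_ hd', h⟩
  have hs' : x.num < 0 ↔ y.num < 0 := by simpa using hs
  omega

theorem flatMap_cancel {ι Γ : Type} {c d : ι → List Γ} {P : ι → Prop}
    (h : ∀ i s t, c i ++ s = d i ++ t → P i ∧ s = t) (l : List ι) (s t : List Γ)
    (hl : l.flatMap c ++ s = l.flatMap d ++ t) : (∀ i ∈ l, P i) ∧ s = t := by
  induction l with
  | nil => simpa using hl
  | cons a l ih =>
    simp only [List.flatMap_cons, List.append_assoc] at hl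
    obtain ⟨h1, h2⟩ := h a _ _ hl
    obtain ⟨h3, h4⟩ := ih h2
    exact ⟨by simpa using ⟨h1, h3⟩, h4⟩

/-! ### Graphs -/

/-- A finite simple graph with vertex set `{0, …, n-1}`. -/
structure FinGraph where
  n : ℕ
  graph : SimpleGraph (Fin n)

open Classical in
/-- The adjacency matrix of a graph, row by row, each row followed by a comma. -/
noncomputable def FinGraph.encode (G : FinGraph) : List Γ' :=
  (List.finRange G.n).flatMap fun v =>
    encodeBits ((List.finRange G.n).map fun w => decide (G.graph.Adj v w))

theorem FinGraph.encode_injective : Function.Injective FinGraph.encode := by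
  have hc : ∀ G : FinGraph, G.encode.count Γ'.comma = G.n := by
    intro G
    have : ∀ l : List Bool, (encodeBits l).count Γ'.comma = 1 := by
      intro l; simp [encodeBits, List.count_eq_zero]
    simp [FinGraph.encode, List.count_flatMap, Function.comp_def, this]
  intro G H h
  have hn : G.n = H.n := by rw [← hc G, ← hc H, h]
  obtain ⟨n, G⟩ := G
  obtain ⟨n', H⟩ := H
  obtain rfl : n = n' := hn
  congr 1
  have := (flatMap_cancel (P := fun v => ∀ w, G.Adj v w ↔ H.Adj v w) (fun v s t hst => by
    obtain ⟨h1, h2⟩ := encodeBits_prefix _ _ _ _ hst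
    refine ⟨fun w => ?_, h2⟩
    simpa using (List.map_inj_left.1 h1) w (List.mem_finRange w)) _ [] []
    (congrArg (· ++ []) h)).1
  ext v w
  exact this v (List.mem_finRange v) w

/-! ### Games and their symmetries -/

/-- A finite game in explicit form with rational payoffs: the players are `0, …, N-1`, player `i`
has the nonempty action set `{0, …, m i - 1}`, and `u i a` is the payoff of player `i` at the action
profile `a`. -/
structure Game where
  N : ℕ
  m : Fin N → ℕ
  m_pos : ∀ i, 0 < m i
  u : Fin N → (∀ i, Fin (m i)) → ℚ

/-- Action profiles. -/
abbrev Game.Profile (Γ : Game) : Type := ∀ i, Fin (Γ.m i)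

/-- The disjoint union of the action sets of all players. -/
abbrev Game.Action (Γ : Game) : Type := Σ i, Fin (Γ.m i)

/-- A game symmetry: a bijection `φ` of the disjoint union of the action sets that maps the actions
of player `i` to actions of player `π i`, and that leaves payoffs invariant:
`u i a = u (π i) (φ a)`, where `φ a` is the profile whose `j`-th entry is `φ (a (π⁻¹ j))`. -/
structure Game.Symmetry (Γ : Game) where
  φ : Equiv.Perm Γ.Action
  π : Equiv.Perm (Fin Γ.N)
  map_player : ∀ a : Γ.Action, (φ a).1 = π a.1
  map_payoff : ∀ (i : Fin Γ.N) (a : Γ.Profile),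
    Γ.u i a = Γ.u (π i) fun j =>
      Fin.cast (congrArg Γ.m ((map_player _).trans (π.apply_symm_apply j)))
        (φ ⟨π.symm j, a (π.symm j)⟩).2

/-- A symmetry is player-separable if it maps every player to itself. -/
def Game.Symmetry.PlayerSeparable {Γ : Game} (S : Γ.Symmetry) : Prop := S.π = 1

/-- Two players, whose payoffs always sum to zero. -/
def Game.IsTwoPlayerZeroSum (Γ : Game) : Prop :=
  Γ.N = 2 ∧ ∀ a : Γ.Profile, ∑ i, Γ.u i a = 0

/-- All action profiles, in lexicographic order. -/
def profiles : (N : ℕ) → (m : Fin N → ℕ) → List (∀ i, Fin (m i))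
  | 0, _ => [fun i => i.elim0]
  | N + 1, m => (List.finRange (m 0)).flatMap fun a =>
      (profiles N fun i => m i.succ).map fun b =>
        Fin.cons (α := fun i => Fin (m i)) a b

theorem mem_profiles : ∀ (N : ℕ) (m : Fin N → ℕ) (a : ∀ i, Fin (m i)), a ∈ profiles N m
  | 0, _, a => by
    simp only [profiles, List.mem_singleton]
    exact funext fun i => i.elim0
  | N + 1, m, a => by
    simp only [profiles, List.mem_flatMap, List.mem_map]
    exact ⟨a 0, List.mem_finRange _, fun i => a i.succ, mem_profiles N _ _,
      Fin.cons_self_tail a⟩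

/-- The row of the payoff table for the profile `a`: the actions in `a`, then the payoffs of all
players at `a`, then an end marker. -/
def Game.encodeRow (Γ : Game) (a : Γ.Profile) : List Γ' :=
  (List.finRange Γ.N).flatMap (fun i => encodeUnary (a i)) ++
    ((List.finRange Γ.N).flatMap (fun i => encodeRat (Γ.u i a)) ++ [Γ'.ket])

/-- The explicit form of a game: the sizes of the action sets and an end marker, followed by
the payoff table. -/
def Game.encode (Γ : Game) : List Γ' :=
  (List.ofFn Γ.m).flatMap encodeUnary ++
    ([Γ'.ket] ++ (profiles Γ.N Γ.m).flatMap Γ.encodeRow)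

theorem sizes_prefix :
    IsPrefixCode fun l : List ℕ => l.flatMap encodeUnary ++ [Γ'.ket] := by
  have key : ∀ (n : ℕ) (s t : List Γ'), encodeUnary n ++ s ≠ Γ'.ket :: t := by
    intro n s t h
    cases n <;> simp [encodeUnary, encodeBits, List.replicate_succ] at h
  intro x
  induction x with
  | nil =>
    intro y s t h
    cases y with
    | nil => simpa using h
    | cons b y =>
      simp only [List.flatMap_nil, List.nil_append, List.flatMap_cons, List.append_assoc,
        List.singleton_append] at h
      exact absurd h.symm (key _ _ _)
  | cons a x ih =>
    intro y s t h
    cases y with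
    | nil =>
      simp only [List.flatMap_nil, List.nil_append, List.flatMap_cons, List.append_assoc,
        List.singleton_append] at h
      exact absurd h (key _ _ _)
    | cons b y =>
      simp only [List.flatMap_cons, List.append_assoc] at h
      obtain ⟨h1, h2⟩ := encodeUnary_prefix _ _ _ _ h
      obtain ⟨h3, h4⟩ := ih y s t (by simpa using h2)
      exact ⟨by rw [h1, h3], h4⟩

theorem Game.encode_injective : Function.Injective Game.encode := by
  intro A B h
  obtain ⟨h1, h2⟩ := sizes_prefix (List.ofFn A.m) (List.ofFn B.m) _ _
    (by simpa only [Game.encode, List.append_assoc] using h)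
  obtain ⟨N, m, p, u⟩ := A
  obtain ⟨N', m', p', u'⟩ := B
  obtain rfl : N = N' := by simpa using congrArg List.length h1
  obtain rfl : m = m' := List.ofFn_injective h1
  congr 1
  have := (flatMap_cancel (P := fun a => ∀ i, u i a = u' i a) (fun a s t hst => by
    simp only [Game.encodeRow, List.append_assoc] at hst
    have hst := List.append_cancel_left hst
    obtain ⟨h3, h4⟩ := flatMap_cancel (P := fun i => u i a = u' i a)
      (fun i s t hi => encodeRat_prefix _ _ _ _ hi) _ _ _ hst
    exact ⟨fun i => h3 i (List.mem_finRange i), List.append_cancel_left h4⟩) _ [] []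
    (congrArg (· ++ []) h2)).1
  funext i a
  exact this a (mem_profiles _ _ a) i

/-! ### Decision problems and polynomial-time reductions -/

/-- A decision problem: a type of instances encoded as strings over a finite alphabet, and the
yes-instances. -/
structure DecisionProblem where
  Inst : Type
  Alphabet : Type
  alphabetFintype : Fintype Alphabet
  encoding : Encoding Inst Alphabet
  Yes : Inst → Prop

open Classical in
/-- The same problem for the instances in `S` only. -/
noncomputable def DecisionProblem.restrict (P : DecisionProblem) (S : P.Inst → Prop) :
    DecisionProblem where
  Inst := {x : P.Inst // S x}
  Alphabet := P.Alphabet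
  alphabetFintype := P.alphabetFintype
  encoding :=
    { encode := fun x => P.encoding.encode x.1
      decode := fun l => (P.encoding.decode l).bind fun x => if h : S x then some ⟨x, h⟩ else none
      decode_encode := fun x => by simp [x.2] }
  Yes x := P.Yes x.1

/-- Polynomial-time many-one reducibility: some map on instances, computed by a Turing machine
in polynomial time, preserves the answer. -/
def DecisionProblem.PolyReduces (P Q : DecisionProblem) : Prop :=
  ∃ f : P.Inst → Q.Inst,
    Nonempty (Turing.TM2ComputableInPolyTime P.encoding.encode Q.encoding.encode f) ∧
      ∀ x, P.Yes x ↔ Q.Yes (f x)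

/-- The graph isomorphism problem. -/
noncomputable def graphIsomorphism : DecisionProblem where
  Inst := FinGraph × FinGraph
  Alphabet := Γ' ⊕ Γ'
  alphabetFintype := inferInstance
  encoding := encodingProd (encodingOfInjective FinGraph.encode FinGraph.encode_injective)
    (encodingOfInjective FinGraph.encode FinGraph.encode_injective)
  Yes x := Nonempty (x.1.graph ≃g x.2.graph)

/-- Membership in the class GI. -/
def DecisionProblem.InGI (P : DecisionProblem) : Prop := P.PolyReduces graphIsomorphism

/-- GI-hardness. -/
def DecisionProblem.GIHard (P : DecisionProblem) : Prop := graphIsomorphism.PolyReduces P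

/-- GI-completeness. -/
def DecisionProblem.GIComplete (P : DecisionProblem) : Prop := P.InGI ∧ P.GIHard

/-- Given a game, decide whether it has a symmetry that is not player-separable. -/
noncomputable def nonPlayerSeparableSymmetry : DecisionProblem where
  Inst := Game
  Alphabet := Γ'
  alphabetFintype := inferInstance
  encoding := encodingOfInjective Game.encode Game.encode_injective
  Yes Γ := ∃ S : Γ.Symmetry, ¬ S.PlayerSeparable

end GameSym

/-! Membership. A symmetry with `π i = j` is an isomorphism between two labelled graphs, the graph
of the game with the actions of player `i` marked and the same graph with those of player `j`
marked. The disjunction over all pairs `i ≠ j` becomes one isomorphism question through a ladder,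
whose levels have two nodes each, and where any two nodes on consecutive levels are joined through a
copy of the graph of the game. At the `k`-th step of the ladder, `k = i * N + j`, player `i` is
marked in the straight copies and player `j` in the crossing ones. An automorphism of the ladder
that fixes the first level and exchanges the two nodes of the last level has to change sides at some
step, and so it maps a straight copy onto a crossing copy. Labels are finally replaced by hubs,
which are recognised by their numbers of leaves.

Hardness. Both players choose a vertex of `G₁`, a vertex of `G₂`, or nothing. The payoff is nonzero
only if the two vertices belong to the same graph, and it then tells whether they are equal or
adjacent; it is positive on `G₁` and negative on `G₂`. Exchanging the players negates the payoff, so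
that a symmetry which does this carries `G₁` onto `G₂`.

Both maps are computable in polynomial time because their values are described by arithmetic
expressions with bounded sums and by words composed over bounded ranges of indices, and such
descriptions compile to Turing machines whose counters stay polynomially bounded. -/

namespace GameSym

open Computability Turing

/-! ### Stack machines -/

section Machine

open StateTransition

/-- The stacks of our machines: the unread part of the input, the part already read
(last symbol on top), the word emitted so far (last symbol on top), the output, and unary
counters. -/
inductive Stack (B : ℕ)
  | unread | read | emitted | output
  | counter (i : Fin (B + 1))
  deriving DecidableEq, Fintype

/-- The stack alphabets. -/
abbrev Stack.Symbol (α β : Type) {B : ℕ} : Stack B → Type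
  | .unread => α
  | .read => α
  | .emitted => β
  | .output => β
  | .counter _ => Unit

/-- The finite memory: the last input symbol popped, the last output symbol popped, and the result
of the last test. -/
abbrev Memory (α β : Type) : Type := Option α × Option β × Bool

/-- Statements of machines with these stacks and this memory. -/
abbrev MachineStmt (α β : Type) (B : ℕ) (Λ : Type) : Type :=
  TM2.Stmt (Stack.Symbol α β (B := B)) Λ (Memory α β)

/-- Configurations of machines with these stacks and this memory. -/
abbrev MachineCfg (α β : Type) (B : ℕ) (Λ : Type) : Type :=
  TM2.Cfg (Stack.Symbol α β (B := B)) Λ (Memory α β)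

/-- The contents of all stacks. There are infinitely many counters, so that a store does not depend
on the bound `B`; a machine sees only the counters `0, …, B`. -/
structure Store (α β : Type) where
  counter : ℕ → ℕ
  read : List α
  unread : List α
  emitted : List β
  output : List β

variable {α β : Type} {B : ℕ}

namespace Store

/-- The stacks of a machine, filled from a store. -/
def contents (s : Store α β) : ∀ k : Stack B, List (k.Symbol α β)
  | .unread => s.unread
  | .read => s.read
  | .emitted => s.emitted
  | .output => s.output
  | .counter i => List.replicate (s.counter i) ()

/-- The store after setting counter `i` to `n`. -/
def setCounter (s : Store α β) (i n : ℕ) : Store α β :=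
  { s with counter := Function.update s.counter i n }

/-- The store after reading one input symbol, if there is one. -/
def advance (s : Store α β) : Store α β :=
  match s.unread with
  | [] => s
  | a :: l => { s with read := a :: s.read, unread := l }

variable (s : Store α β)

theorem contents_unread : s.contents (B := B) .unread = s.unread := rfl

theorem contents_read : s.contents (B := B) .read = s.read := rfl

theorem contents_emitted : s.contents (B := B) .emitted = s.emitted := rfl

theorem contents_output : s.contents (B := B) .output = s.output := rfl

theorem update_contents_unread (l : List α) :
    Function.update (s.contents (B := B)) .unread l = { s with unread := l }.contents := by
  funext k
  cases k <;> rfl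

theorem update_contents_read (l : List α) :
    Function.update (s.contents (B := B)) .read l = { s with read := l }.contents := by
  funext k
  cases k <;> rfl

theorem update_contents_emitted (l : List β) :
    Function.update (s.contents (B := B)) .emitted l = { s with emitted := l }.contents := by
  funext k
  cases k <;> rfl

theorem update_contents_output (l : List β) :
    Function.update (s.contents (B := B)) .output l = { s with output := l }.contents := by
  funext k
  cases k <;> rfl

end Store

/-- The stack of counter `i`, for `i ≤ B`; larger indices wrap around. -/
abbrev Stack.ofIndex (B i : ℕ) : Stack B := .counter (Fin.ofNat (B + 1) i)

theorem val_ofNat_of_le {i : ℕ} (hi : i ≤ B) : (Fin.ofNat (B + 1) i : ℕ) = i :=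
  Nat.mod_eq_of_lt (by lia)

namespace Store

theorem contents_ofIndex (s : Store α β) {i : ℕ} (hi : i ≤ B) :
    s.contents (.ofIndex B i) = List.replicate (s.counter i) () := by
  simp only [contents, val_ofNat_of_le hi]

theorem update_contents_ofIndex (s : Store α β) {i : ℕ} (hi : i ≤ B) (n : ℕ) :
    Function.update (s.contents (B := B)) (.ofIndex B i) (List.replicate n ()) =
      (s.setCounter i n).contents := by
  funext k
  cases k with
  | counter j =>
    by_cases hj : j = Fin.ofNat (B + 1) i
    · subst hj
      simp only [contents, setCounter, val_ofNat_of_le hi, Function.update_self]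
    · have hne : (j : ℕ) ≠ i := fun e => hj (Fin.ext (by rw [val_ofNat_of_le hi, e]))
      rw [Function.update_of_ne (by simpa [-Fin.ofNat_eq_cast] using hj)]
      simp only [contents, setCounter, Function.update_of_ne hne]
  | _ => rw [Function.update_of_ne (by simp)]; rfl

end Store

/-- Reachability in at most `t` steps. -/
def ReachesWithin {Λ : Type} (M : Λ → MachineStmt α β B Λ) (t : ℕ) (c c' : MachineCfg α β B Λ) :
    Prop :=
  Nonempty (EvalsToInTime (TM2.step M) c (some c') t)

namespace ReachesWithin

variable {Λ : Type} {M : Λ → MachineStmt α β B Λ} {c c' c'' : MachineCfg α β B Λ} {t t' : ℕ}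

theorem mono (h : ReachesWithin M t c c') (ht : t ≤ t') : ReachesWithin M t' c c' :=
  h.map fun e => ⟨e.toEvalsTo, e.steps_le_m.trans ht⟩

theorem trans (h : ReachesWithin M t c c') (h' : ReachesWithin M t' c' c'') :
    ReachesWithin M (t + t') c c'' :=
  h.elim fun e => h'.map fun e' => t.add_comm t' ▸ e.trans _ _ _ _ _ _ e'

theorem step {l : Λ} {v : Memory α β} {S : ∀ k : Stack B, List (k.Symbol α β)}
    (h : TM2.stepAux (M l) v S = c) : ReachesWithin M 1 ⟨some l, v, S⟩ c :=
  ⟨⟨⟨1, by simp [flip, h]⟩, le_rfl⟩⟩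

end ReachesWithin

/-- A piece of a program. Its code is given relative to an embedding of its labels into those of
the whole program and to the label at which to continue. -/
structure Fragment (α β : Type) (B : ℕ) where
  Label : Type
  [labelFintype : Fintype Label]
  entry : Label
  code : ∀ {Λ : Type}, (Label → Λ) → Λ → Label → MachineStmt α β B Λ

namespace Fragment

attribute [instance] labelFintype

/-- Started in the store `s`, the fragment terminates in the store `s'` in at most `t` steps. -/
def Runs (F : Fragment α β B) (s s' : Store α β) (t : ℕ) : Prop :=
  ∀ (Λ : Type) (M : Λ → MachineStmt α β B Λ) (emb : F.Label → Λ) (exit : Λ),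
    (∀ l, M (emb l) = F.code emb exit l) → ∀ v, ∃ v',
      ReachesWithin M t ⟨some (emb F.entry), v, s.contents⟩ ⟨some exit, v', s'.contents⟩

theorem Runs.mono {F : Fragment α β B} {s s' : Store α β} {t t' : ℕ} (h : F.Runs s s' t)
    (ht : t ≤ t') : F.Runs s s' t' := fun Λ M emb exit hM v =>
  (h Λ M emb exit hM v).imp fun _ h => h.mono ht

/-- Sequential composition. -/
def seq (F G : Fragment α β B) : Fragment α β B where
  Label := F.Label ⊕ G.Label
  entry := .inl F.entry
  code emb exit
    | .inl l => F.code (emb ∘ .inl) (emb (.inr G.entry)) l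
    | .inr l => G.code (emb ∘ .inr) exit l

theorem Runs.seq {F G : Fragment α β B} {s s' s'' : Store α β} {t t' : ℕ} (h : F.Runs s s' t)
    (h' : G.Runs s' s'' t') : (F.seq G).Runs s s'' (t + t') := by
  intro Λ M emb exit hM v
  obtain ⟨v', hF⟩ := h Λ M (emb ∘ .inl) (emb (.inr G.entry)) (fun l => hM (.inl l)) v
  obtain ⟨v'', hG⟩ := h' Λ M (emb ∘ .inr) exit (fun l => hM (.inr l)) v'
  exact ⟨v'', hF.trans hG⟩

/-- A fragment with a single label; `c` is given this label and the label at which to continue. -/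
def single (c : ∀ {Λ : Type}, Λ → Λ → MachineStmt α β B Λ) : Fragment α β B where
  Label := Unit
  entry := ()
  code emb exit _ := c (emb ()) exit

theorem Runs.single {c : ∀ {Λ : Type}, Λ → Λ → MachineStmt α β B Λ} {s s' : Store α β}
    (h : ∀ (Λ : Type) (self exit : Λ) (v : Memory α β), ∃ v',
      TM2.stepAux (c self exit) v s.contents = ⟨some exit, v', s'.contents⟩) :
    (Fragment.single c).Runs s s' 1 := by
  intro Λ M emb exit hM v
  obtain ⟨v', h⟩ := h Λ (emb ()) exit v
  exact ⟨v', .step ((congrArg (fun q => TM2.stepAux q v s.contents) (hM ())).trans h)⟩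

theorem Runs.single_again {c : ∀ {Λ : Type}, Λ → Λ → MachineStmt α β B Λ} {s s' s'' : Store α β}
    {t : ℕ} (h : ∀ (Λ : Type) (self exit : Λ) (v : Memory α β), ∃ v',
      TM2.stepAux (c self exit) v s.contents = ⟨some self, v', s'.contents⟩)
    (h' : (Fragment.single c).Runs s' s'' t) : (Fragment.single c).Runs s s'' (t + 1) := by
  intro Λ M emb exit hM v
  obtain ⟨v', h⟩ := h Λ (emb ()) exit v
  obtain ⟨v'', h'⟩ := h' Λ M emb exit hM v'
  exact ⟨v'', ((ReachesWithin.step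
    ((congrArg (fun q => TM2.stepAux q v s.contents) (hM ())).trans h)).trans h').mono (by lia)⟩

/-- Increment counter `i`. -/
def inc (i : ℕ) : Fragment α β B :=
  .single fun _ exit => .push (.ofIndex B i) (fun _ => ()) (.goto fun _ => exit)

theorem runs_inc {i : ℕ} (hi : i ≤ B) (s : Store α β) :
    (inc i : Fragment α β B).Runs s (s.setCounter i (s.counter i + 1)) 1 := by
  refine .single fun _ _ _ v => ⟨v, ?_⟩
  simp only [TM2.stepAux, ← s.update_contents_ofIndex hi, s.contents_ofIndex hi,
    List.replicate_succ]

/-- Decrement counter `i`. -/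
def dec (i : ℕ) : Fragment α β B :=
  .single fun _ exit => .pop (.ofIndex B i) (fun v _ => v) (.goto fun _ => exit)

theorem runs_dec {i : ℕ} (hi : i ≤ B) (s : Store α β) :
    (dec i : Fragment α β B).Runs s (s.setCounter i (s.counter i - 1)) 1 := by
  refine .single fun _ _ _ v => ⟨v, ?_⟩
  simp only [TM2.stepAux, ← s.update_contents_ofIndex hi, s.contents_ofIndex hi,
    List.tail_replicate]

/-- Append the symbol `b` to the emitted word. -/
def emit (b : β) : Fragment α β B :=
  .single fun _ exit => .push .emitted (fun _ => b) (.goto fun _ => exit)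

theorem runs_emit (b : β) (s : Store α β) :
    (emit b : Fragment α β B).Runs s { s with emitted := b :: s.emitted } 1 :=
  .single fun _ _ _ v => ⟨v, by
    simp only [TM2.stepAux, Store.contents_emitted, Store.update_contents_emitted]⟩

/-- Do nothing. -/
def skip : Fragment α β B := .single fun _ exit => .goto fun _ => exit

theorem runs_skip (s : Store α β) : (skip : Fragment α β B).Runs s s 1 :=
  .single fun _ _ _ v => ⟨v, rfl⟩

/-- Read one input symbol, if there is one. -/
def advance [Inhabited α] : Fragment α β B :=
  .single fun _ exit => .pop .unread (fun _ o => (o, none, false))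
    (.branch (fun v => v.1.isSome) (.push .read (fun v => v.1.getD default) (.goto fun _ => exit))
      (.goto fun _ => exit))

theorem runs_advance [Inhabited α] (s : Store α β) :
    (advance : Fragment α β B).Runs s s.advance 1 := by
  refine .single fun _ _ _ _ => ⟨(s.unread.head?, none, false), ?_⟩
  obtain ⟨counter, read, unread, emitted, output⟩ := s
  cases unread <;>
    simp [TM2.stepAux, Store.advance, Store.contents_unread, Store.contents_read,
      Store.update_contents_unread, Store.update_contents_read]

/-- Return to the beginning of the input. -/
def rewind [Inhabited α] : Fragment α β B :=
  .single fun self exit => .pop .read (fun _ o => (o, none, false))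
    (.branch (fun v => v.1.isSome) (.push .unread (fun v => v.1.getD default)
      (.goto fun _ => self)) (.goto fun _ => exit))

theorem runs_rewind [Inhabited α] (s : Store α β) :
    (rewind : Fragment α β B).Runs s { s with read := [], unread := s.read.reverse ++ s.unread }
      (s.read.length + 1) := by
  obtain ⟨counter, read, unread, emitted, output⟩ := s
  induction read generalizing unread with
  | nil =>
    refine .single fun _ _ _ _ => ⟨(none, none, false), ?_⟩
    simp [TM2.stepAux, Store.contents_read, Store.update_contents_read]
  | cons a l ih =>
    simp only [List.reverse_cons, List.append_assoc, List.singleton_append]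
    refine .single_again (fun _ _ _ _ => ⟨(some a, none, false), ?_⟩) (ih (a :: unread))
    simp [TM2.stepAux, Store.contents_unread, Store.contents_read, Store.update_contents_unread,
      Store.update_contents_read]

/-- Read the rest of the input, and add the number of symbols read to counter `i`. -/
def countUnread [Inhabited α] (i : ℕ) : Fragment α β B :=
  .single fun self exit => .pop .unread (fun _ o => (o, none, false))
    (.branch (fun v => v.1.isSome) (.push .read (fun v => v.1.getD default)
      (.push (.ofIndex B i) (fun _ => ()) (.goto fun _ => self))) (.goto fun _ => exit))

theorem runs_countUnread [Inhabited α] {i : ℕ} (hi : i ≤ B) (s : Store α β) :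
    (countUnread i : Fragment α β B).Runs s
      (({ s with read := s.unread.reverse ++ s.read, unread := [] } : Store α β).setCounter i
        (s.counter i + s.unread.length)) (s.unread.length + 1) := by
  obtain ⟨counter, read, unread, emitted, output⟩ := s
  induction unread generalizing read counter with
  | nil =>
    refine .single fun _ _ _ _ => ⟨(none, none, false), ?_⟩
    simp [TM2.stepAux, Store.contents_unread, Store.update_contents_unread, Store.setCounter]
  | cons a l ih =>
    have ih := ih (Function.update counter i (counter i + 1)) (a :: read)
    simp only [Function.update_self, Store.setCounter, Function.update_idem, add_assoc,
      add_comm 1] at ih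
    simp only [Store.setCounter, List.reverse_cons, List.append_assoc, List.singleton_append,
      List.length_cons]
    refine .single_again (fun _ _ _ _ => ⟨(some a, none, false), ?_⟩) ih
    simp only [TM2.stepAux, Store.contents_unread, Store.contents_read,
      Store.update_contents_unread, Store.update_contents_read, Store.contents_ofIndex _ hi,
      ← List.replicate_succ, Store.update_contents_ofIndex _ hi, List.head?_cons, List.tail_cons,
      Option.isSome_some, Option.getD_some, cond_true, Store.setCounter]

/-- Erase the unread part of the input. -/
def eraseUnread : Fragment α β B :=
  .single fun self exit => .pop .unread (fun _ o => (none, none, o.isSome))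
    (.branch (fun v => v.2.2) (.goto fun _ => self) (.goto fun _ => exit))

theorem runs_eraseUnread (s : Store α β) :
    (eraseUnread : Fragment α β B).Runs s { s with unread := [] } (s.unread.length + 1) := by
  obtain ⟨counter, read, unread, emitted, output⟩ := s
  induction unread with
  | nil =>
    refine .single fun _ _ _ _ => ⟨(none, none, false), ?_⟩
    simp [TM2.stepAux, Store.contents_unread, Store.update_contents_unread]
  | cons a l ih =>
    refine .single_again (fun _ _ _ _ => ⟨(none, none, true), ?_⟩) ih
    simp [TM2.stepAux, Store.contents_unread, Store.update_contents_unread]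

/-- Move the emitted word to the output. -/
def flush [Inhabited β] : Fragment α β B :=
  .single fun self exit => .pop .emitted (fun _ o => (none, o, false))
    (.branch (fun v => v.2.1.isSome) (.push .output (fun v => v.2.1.getD default)
      (.goto fun _ => self)) (.goto fun _ => exit))

theorem runs_flush [Inhabited β] (s : Store α β) :
    (flush : Fragment α β B).Runs s
      { s with emitted := [], output := s.emitted.reverse ++ s.output }
      (s.emitted.length + 1) := by
  obtain ⟨counter, read, unread, emitted, output⟩ := s
  induction emitted generalizing output with
  | nil =>
    refine .single fun _ _ _ _ => ⟨(none, none, false), ?_⟩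
    simp [TM2.stepAux, Store.contents_emitted, Store.update_contents_emitted]
  | cons a l ih =>
    simp only [List.reverse_cons, List.append_assoc, List.singleton_append]
    refine .single_again (fun _ _ _ _ => ⟨(none, some a, false), ?_⟩) (ih (a :: output))
    simp [TM2.stepAux, Store.contents_emitted, Store.contents_output, Store.update_contents_emitted,
      Store.update_contents_output]

/-- Repeat a fragment as long as counter `i` is positive. -/
def loop (i : ℕ) (F : Fragment α β B) : Fragment α β B where
  Label := Option F.Label
  entry := none
  code emb exit
    | none => .peek (.ofIndex B i) (fun _ o => (none, none, o.isSome))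
        (.branch (fun v => v.2.2) (.goto fun _ => emb (some F.entry)) (.goto fun _ => exit))
    | some l => F.code (emb ∘ some) (emb none) l

theorem Runs.loop_of_eq_zero {i : ℕ} (hi : i ≤ B) (F : Fragment α β B) {s : Store α β}
    (hs : s.counter i = 0) : (F.loop i).Runs s s 1 := by
  intro Λ M emb exit hM v
  refine ⟨(none, none, false), .step ?_⟩
  rw [hM]
  simp [Fragment.loop, TM2.stepAux, s.contents_ofIndex hi, hs, -Fin.ofNat_eq_cast]

theorem Runs.loop_of_ne_zero {i : ℕ} (hi : i ≤ B) {F : Fragment α β B} {s s' s'' : Store α β}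
    {t t' : ℕ} (hs : s.counter i ≠ 0) (hF : F.Runs s s' t) (hloop : (F.loop i).Runs s' s'' t') :
    (F.loop i).Runs s s'' (1 + t + t') := by
  intro Λ M emb exit hM v
  obtain ⟨v', hF⟩ := hF Λ M (emb ∘ some) (emb none) (fun l => hM (some l)) (none, none, true)
  obtain ⟨v'', hloop⟩ := hloop Λ M emb exit hM v'
  have htest : ReachesWithin M 1 ⟨some (emb (F.loop i).entry), v, s.contents⟩
      ⟨some (emb (some F.entry)), (none, none, true), s.contents⟩ := by
    obtain ⟨n, hn⟩ := Nat.exists_eq_succ_of_ne_zero hs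
    refine .step ?_
    rw [hM]
    simp [Fragment.loop, TM2.stepAux, s.contents_ofIndex hi, hn, List.replicate_succ,
      -Fin.ofNat_eq_cast]
  exact ⟨v'', (htest.trans hF).trans hloop⟩

theorem Runs.loop {i : ℕ} (hi : i ≤ B) {F : Fragment α β B} (n : ℕ) (s : ℕ → Store α β) (t : ℕ)
    (hn : (s n).counter i = 0) (hs : ∀ j < n, (s j).counter i ≠ 0)
    (hF : ∀ j < n, F.Runs (s j) (s (j + 1)) t) :
    (F.loop i).Runs (s 0) (s n) (n * (t + 1) + 1) := by
  induction n generalizing s with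
  | zero => simpa using loop_of_eq_zero hi F hn
  | succ n ih =>
    have ih := ih (fun j => s (j + 1)) hn (fun j hj => hs _ (by lia)) fun j hj => hF _ (by lia)
    exact (loop_of_ne_zero hi (hs 0 (by lia)) (hF 0 (by lia)) ih).mono (by ring_nf; lia)

/-- Run a fragment if the next input symbol is `a`. -/
def ifNext [DecidableEq α] (a : α) (F : Fragment α β B) : Fragment α β B where
  Label := Option F.Label
  entry := none
  code emb exit
    | none => .peek .unread (fun _ o => (none, none, decide (o = some a)))
        (.branch (fun v => v.2.2) (.goto fun _ => emb (some F.entry)) (.goto fun _ => exit))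
    | some l => F.code (emb ∘ some) exit l

theorem Runs.ifNext_of_eq [DecidableEq α] {a : α} {F : Fragment α β B} {s s' : Store α β} {t : ℕ}
    (hs : s.unread.head? = some a) (h : F.Runs s s' t) : (F.ifNext a).Runs s s' (1 + t) := by
  intro Λ M emb exit hM v
  obtain ⟨v', h⟩ := h Λ M (emb ∘ some) exit (fun l => hM (some l)) (none, none, true)
  have htest : ReachesWithin M 1 ⟨some (emb (F.ifNext a).entry), v, s.contents⟩
      ⟨some (emb (some F.entry)), (none, none, true), s.contents⟩ := by
    refine .step ?_
    rw [hM]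
    simp [Fragment.ifNext, TM2.stepAux, Store.contents_unread, hs]
  exact ⟨v', htest.trans h⟩

theorem Runs.ifNext_of_ne [DecidableEq α] {a : α} (F : Fragment α β B) {s : Store α β}
    (hs : s.unread.head? ≠ some a) : (F.ifNext a).Runs s s 1 := by
  intro Λ M emb exit hM v
  refine ⟨(none, none, false), .step ?_⟩
  rw [hM]
  simp [Fragment.ifNext, TM2.stepAux, Store.contents_unread, hs]

/-- The machine that runs a fragment and halts. -/
def machine [Fintype α] [Fintype β] (F : Fragment α β B) : FinTM2 where
  K := Stack B
  k₀ := .unread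
  k₁ := .output
  Γ := Stack.Symbol α β
  Λ := Option F.Label
  main := some F.entry
  ΛFin := inferInstance
  σ := Memory α β
  initialState := (none, none, false)
  Γk₀Fin := inferInstanceAs (Fintype α)
  m
    | some l => F.code some none l
    | none => .load (fun _ => (none, none, false)) .halt

end Fragment

/-- The store with input `w` whose other stacks are empty. -/
def Store.initial (w : List α) : Store α β := ⟨fun _ => 0, [], w, [], []⟩

/-- The store with output `w` whose other stacks are empty. -/
def Store.final (w : List β) : Store α β := ⟨fun _ => 0, [], [], [], w⟩

theorem Fragment.machine_outputs [Fintype α] [Fintype β] (F : Fragment α β B) {w : List α}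
    {w' : List β} {t : ℕ} (h : F.Runs (Store.initial w) (Store.final w') t) :
    Nonempty (TM2OutputsInTime F.machine w (some w') (t + 1)) := by
  obtain ⟨v, h⟩ := h _ F.machine.m some none (fun _ => rfl) (none, none, false)
  have hinit : initList F.machine w =
      ⟨some (some F.entry), (none, none, false), (Store.initial w : Store α β).contents⟩ := by
    unfold initList
    congr 1
    funext k
    cases k <;> rfl
  have hhalt : haltList F.machine w' =
      ⟨none, (none, none, false), (Store.final w' : Store α β).contents⟩ := by
    unfold haltList
    congr 1
    funext k
    cases k <;> rfl
  have hreach := h.trans (ReachesWithin.step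
    (c := ⟨none, (none, none, false), (Store.final w' : Store α β).contents⟩) rfl)
  change Nonempty (EvalsToInTime F.machine.step (initList F.machine w)
    (some (haltList F.machine w')) (t + 1))
  rw [hinit, hhalt]
  exact hreach

end Machine

/-! ### Expressions -/

section Expressions

variable {α β : Type} {B : ℕ}

/-- Expressions for natural numbers that depend on a word and on variables, which are numbered from
the innermost binder. Subtraction is truncated, `sum e e'` binds a variable in `e'` that runs over
`0, …, e - 1`, and `symbolAt a e` is `1` if the word has the symbol `a` at position `e` and `0`
otherwise. -/
inductive Expr (α : Type) : Type
  | one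
  | length
  | var (i : ℕ)
  | add (e e' : Expr α)
  | sub (e e' : Expr α)
  | sum (e e' : Expr α)
  | symbolAt (a : α) (e : Expr α)
  | rename (σ : ℕ → ℕ) (e : Expr α)

/-- Extend an environment by the value of a new innermost variable. -/
def consEnv {X : Type} (x : X) (ρ : ℕ → X) : ℕ → X
  | 0 => x
  | i + 1 => ρ i

/-- The value of an expression. -/
def Expr.eval [DecidableEq α] (w : List α) : Expr α → (ℕ → ℕ) → ℕ
  | one, _ => 1
  | length, _ => w.length
  | var i, ρ => ρ i
  | add e e', ρ => e.eval w ρ + e'.eval w ρ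
  | sub e e', ρ => e.eval w ρ - e'.eval w ρ
  | sum e e', ρ => ∑ i ∈ Finset.range (e.eval w ρ), e'.eval w (consEnv i ρ)
  | symbolAt a e, ρ => if w[e.eval w ρ]? = some a then 1 else 0
  | rename σ e, ρ => e.eval w fun i => ρ (σ i)

namespace Store

/-- The store with counters replaced by `c`. -/
def withCounters (s : Store α β) (c : ℕ → ℕ) : Store α β := { s with counter := c }

theorem setCounter_eq_self (s : Store α β) {i n : ℕ} (h : s.counter i = n) :
    s.setCounter i n = s := by
  rw [setCounter, ← h, Function.update_eq_self]

theorem advance_withCounters (s : Store α β) (c : ℕ → ℕ) :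
    (s.withCounters c).advance = s.advance.withCounters c := by
  obtain ⟨counter, read, unread, emitted, output⟩ := s
  cases unread <;> rfl

theorem advance_iterate (s : Store α β) (n : ℕ) (hs : s.read = []) :
    advance^[n] s =
      { s with read := (s.unread.take n).reverse, unread := s.unread.drop n } := by
  obtain ⟨counter, read, unread, emitted, output⟩ := s
  obtain rfl : read = [] := hs
  induction n with
  | zero => simp
  | succ n ih =>
    rw [Function.iterate_succ_apply', ih]
    by_cases h : n < unread.length
    · simp only [advance]
      rw [List.drop_eq_getElem_cons h, List.take_succ_eq_append_getElem h, List.reverse_append]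
      rfl
    · have hlen : unread.length ≤ n := by lia
      simp [advance, List.drop_eq_nil_of_le hlen, List.drop_eq_nil_of_le (hlen.trans n.le_succ),
        List.take_of_length_le hlen, List.take_of_length_le (hlen.trans n.le_succ)]

end Store

namespace Fragment

theorem Runs.countdown {i : ℕ} (hi : i ≤ B) {F : Fragment α β B} (n : ℕ) (s : ℕ → Store α β)
    (t : ℕ) (hs : ∀ j ≤ n, (s j).counter i = n - j) (hF : ∀ j < n, F.Runs (s j) (s (j + 1)) t) :
    (F.loop i).Runs (s 0) (s n) (n * (t + 1) + 1) :=
  .loop hi n s t (by simp [hs]) (fun j hj => by rw [hs j hj.le]; lia) hF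

section Counters

variable {i j k : ℕ} (s : Store α β) {c c' : ℕ → ℕ}

theorem runs_inc_withCounters (hi : i ≤ B) (hc : c' = Function.update c i (c i + 1)) :
    (inc i : Fragment α β B).Runs (s.withCounters c) (s.withCounters c') 1 :=
  hc ▸ runs_inc hi (s.withCounters c)

theorem runs_dec_withCounters (hi : i ≤ B) (hc : c' = Function.update c i (c i - 1)) :
    (dec i : Fragment α β B).Runs (s.withCounters c) (s.withCounters c') 1 :=
  hc ▸ runs_dec hi (s.withCounters c)

/-- Set counter `i` to zero. -/
def clear (i : ℕ) : Fragment α β B := (dec i).loop i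

theorem runs_clear (hi : i ≤ B) (hc : c' = Function.update c i 0) :
    (clear i : Fragment α β B).Runs (s.withCounters c) (s.withCounters c') (c i * 2 + 1) := by
  have h := Runs.countdown hi (F := (dec i : Fragment α β B)) (c i)
    (fun n => s.withCounters (Function.update c i (c i - n))) 1
    (fun n _ => by simp [Store.withCounters])
    fun n _ => runs_dec_withCounters s hi (by funext; grind)
  simpa [clear, hc] using h

/-- Add counter `i` to counter `j`, and clear counter `i`. -/
def move (i j : ℕ) : Fragment α β B := ((dec i).seq (inc j)).loop i

theorem runs_move (hi : i ≤ B) (hj : j ≤ B) (hij : i ≠ j)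
    (hc : c' = Function.update (Function.update c j (c j + c i)) i 0) :
    (move i j : Fragment α β B).Runs (s.withCounters c) (s.withCounters c') (c i * 3 + 1) := by
  have h := Runs.countdown hi (F := ((dec i).seq (inc j) : Fragment α β B)) (c i)
    (fun n => s.withCounters (Function.update (Function.update c j (c j + n)) i (c i - n))) 2
    (fun n _ => by simp [Store.withCounters])
    fun n _ => (runs_dec_withCounters s hi rfl).seq
      (runs_inc_withCounters s hj (by funext; grind))
  simpa [move, hc] using h

/-- Subtract counter `i` from counter `j`, and clear counter `i`. -/
def subtract (i j : ℕ) : Fragment α β B := ((dec i).seq (dec j)).loop i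

theorem runs_subtract (hi : i ≤ B) (hj : j ≤ B) (hij : i ≠ j)
    (hc : c' = Function.update (Function.update c j (c j - c i)) i 0) :
    (subtract i j : Fragment α β B).Runs (s.withCounters c) (s.withCounters c')
      (c i * 3 + 1) := by
  have h := Runs.countdown hi (F := ((dec i).seq (dec j) : Fragment α β B)) (c i)
    (fun n => s.withCounters (Function.update (Function.update c j (c j - n)) i (c i - n))) 2
    (fun n _ => by simp [Store.withCounters])
    fun n _ => (runs_dec_withCounters s hi rfl).seq
      (runs_dec_withCounters s hj (by funext; grind))
  simpa [subtract, hc] using h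

/-- Add counter `i` to counter `j`, using counter `k` to restore counter `i`. -/
def copy (i j k : ℕ) : Fragment α β B :=
  (((dec i).seq ((inc k).seq (inc j))).loop i).seq (move k i)

theorem runs_copy (hi : i ≤ B) (hj : j ≤ B) (hk : k ≤ B) (hij : i ≠ j) (hik : i ≠ k) (hjk : j ≠ k)
    (hc : c' = Function.update c j (c j + c i)) (hck : c k = 0) :
    (copy i j k : Fragment α β B).Runs (s.withCounters c) (s.withCounters c') (c i * 7 + 2) := by
  let state (n : ℕ) := Function.update (Function.update (Function.update c j (c j + n)) k n) i
    (c i - n)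
  have hloop := Runs.countdown hi (F := ((dec i).seq ((inc k).seq (inc j)) : Fragment α β B)) (c i)
    (fun n => s.withCounters (state n)) 3 (fun n _ => by simp [state, Store.withCounters])
    fun n _ => (runs_dec_withCounters s hi rfl).seq ((runs_inc_withCounters s hk rfl).seq
      (runs_inc_withCounters s hj (by funext; grind)))
  have hstate : state 0 = c := by funext; grind
  have hmove := runs_move s (B := B) (c := state (c i)) (c' := c') hk hi hik.symm
    (by ext; simp only [hc, state, Function.update_apply]; grind)
  exact hstate ▸ (hloop.seq hmove).mono (by grind)

/-- Run `F` as often as counter `i` says, with the number of the round in counter `i + 1`, and clear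
both counters. -/
def forLoop (i : ℕ) (F : Fragment α β B) : Fragment α β B :=
  (((dec i).seq (F.seq (inc (i + 1)))).loop i).seq (clear (i + 1))

theorem runs_forLoop {F : Fragment α β B} (hi : i < B) (n : ℕ) (s : ℕ → Store α β) {t : ℕ}
    (hs : ∀ k ≤ n, (s k).counter i = 0) (hs' : ∀ k ≤ n, (s k).counter (i + 1) = 0)
    (hF : ∀ k < n, F.Runs (((s k).setCounter i (n - (k + 1))).setCounter (i + 1) k)
      (((s (k + 1)).setCounter i (n - (k + 1))).setCounter (i + 1) k) t) :
    (F.forLoop i).Runs ((s 0).setCounter i n) (s n) (n * (t + 5) + 2) := by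
  let state (k : ℕ) := ((s k).setCounter i (n - k)).setCounter (i + 1) k
  have hstep (k : ℕ) (hk : k < n) :
      ((dec i).seq (F.seq (inc (i + 1)))).Runs (state k) (state (k + 1)) (1 + (t + 1)) := by
    refine (runs_dec_withCounters (s k) (by lia) ?_).seq ((hF k hk).seq
      (runs_inc_withCounters (s (k + 1)) (by lia) ?_)) <;>
    · ext
      simp only [Store.setCounter, Function.update_apply]
      grind
  have hloop := Runs.countdown hi.le n state _ (fun k _ => by simp [state, Store.setCounter]) hstep
  have hclear := runs_clear (s n) (B := B) (i := i + 1) (c := (state n).counter)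
    (c' := (s n).counter) (by lia) (by
      ext
      simp only [state, Store.setCounter, Function.update_apply]
      grind)
  have hstate : state 0 = (s 0).setCounter i n := by
    have hzero : ((s 0).setCounter i n).counter (i + 1) = 0 := by
      simp [Store.setCounter, hs' 0 n.zero_le]
    simp only [state, Nat.sub_zero]
    exact (s 0).setCounter i n |>.setCounter_eq_self hzero
  have htime : (state n).counter (i + 1) = n := Function.update_self ..
  rw [htime] at hclear
  exact hstate ▸ (hloop.seq hclear).mono (by ring_nf; rfl)

theorem runs_ifNext_inc [DecidableEq α] (a : α) (hi : i ≤ B)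
    (hc : c' = Function.update c i (c i + if s.unread.head? = some a then 1 else 0)) :
    ((inc i).ifNext a : Fragment α β B).Runs (s.withCounters c) (s.withCounters c') 2 := by
  by_cases ha : s.unread.head? = some a
  · exact .ifNext_of_eq (s := s.withCounters c) ha
      (runs_inc_withCounters s hi (by rw [hc, if_pos ha]))
  · obtain rfl : c = c' := by rw [hc, if_neg ha, add_zero, Function.update_eq_self]
    exact (Runs.ifNext_of_ne (inc i) (s := s.withCounters c) ha).mono one_le_two

variable [Inhabited α]

/-- Read as many symbols as counter `i` says, and clear counter `i`. -/
def advanceBy (i : ℕ) : Fragment α β B := ((dec i).seq advance).loop i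

theorem runs_advanceBy (hi : i ≤ B) (hc : c' = Function.update c i 0) :
    (advanceBy i : Fragment α β B).Runs (s.withCounters c)
      ((Store.advance^[c i] s).withCounters c') (c i * 3 + 1) := by
  have h := Runs.countdown hi (F := ((dec i).seq advance : Fragment α β B)) (c i)
    (fun n => (Store.advance^[n] s).withCounters (Function.update c i (c i - n))) 2
    (fun n _ => by simp [Store.withCounters]) fun n _ => by
      refine (runs_dec_withCounters _ hi (c' := Function.update c i (c i - (n + 1)))
        (by funext; grind)).seq (t' := 1) ?_
      rw [Function.iterate_succ_apply', ← Store.advance_withCounters]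
      exact runs_advance _
  simpa [advanceBy, hc] using h

theorem runs_rewind_advance_iterate (hs : s.read = []) (n : ℕ) :
    (rewind : Fragment α β B).Runs ((Store.advance^[n] s).withCounters c) (s.withCounters c)
      (s.unread.length + 1) := by
  rw [Store.advance_iterate s n hs]
  refine (show s.withCounters c = _ from ?_) ▸ (runs_rewind _).mono ?_ <;>
    simp [Store.withCounters, hs]

end Counters

end Fragment

/-- The conditions on the counters under which compiled code works: the value `ρ i` of variable `i`
is in counter `r i`, and the free counters, those from `f` on, are zero. -/
structure Layout (ρ c r : ℕ → ℕ) (f : ℕ) : Prop where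
  var_lt : ∀ i, r i < f
  var_eq : ∀ i, c (r i) = ρ i
  free_eq : ∀ j, f ≤ j → c j = 0

namespace Layout

variable {ρ c r : ℕ → ℕ} {f o : ℕ}

theorem mono (h : Layout ρ c r f) {f' : ℕ} (hf : f ≤ f') : Layout ρ c r f' where
  var_lt i := (h.var_lt i).trans_le hf
  var_eq := h.var_eq
  free_eq j hj := h.free_eq j (hf.trans hj)

theorem comp (h : Layout ρ c r f) (σ : ℕ → ℕ) :
    Layout (fun i => ρ (σ i)) c (fun i => r (σ i)) f where
  var_lt i := h.var_lt (σ i)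
  var_eq i := h.var_eq (σ i)
  free_eq := h.free_eq

theorem update_output (h : Layout ρ c r f) (ho : o < f) (hr : ∀ i, r i ≠ o) (x : ℕ) :
    Layout ρ (Function.update c o x) r f where
  var_lt := h.var_lt
  var_eq i := by rw [Function.update_of_ne (hr i), h.var_eq]
  free_eq j hj := by rw [Function.update_of_ne (ho.trans_le hj).ne', h.free_eq j hj]

theorem update_free (h : Layout ρ c r f) (x : ℕ) :
    Layout ρ (Function.update c f x) r (f + 1) where
  var_lt i := (h.var_lt i).trans f.lt_succ_self
  var_eq i := by rw [Function.update_of_ne (h.var_lt i).ne, h.var_eq]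
  free_eq j hj := by rw [Function.update_of_ne (by lia), h.free_eq j (by lia)]

theorem bind (h : Layout ρ c r f) (i : ℕ) :
    Layout (consEnv i ρ) (Function.update c f i) (consEnv f r) (f + 1) where
  var_lt
    | 0 => f.lt_succ_self
    | j + 1 => (h.update_free i).var_lt j
  var_eq
    | 0 => Function.update_self ..
    | j + 1 => (h.update_free i).var_eq j
  free_eq := (h.update_free i).free_eq

end Layout

namespace Expr

/-- The number of auxiliary counters used by the compiled expression. -/
def height : Expr α → ℕ
  | one => 0
  | length => 0
  | var _ => 1
  | add e e' => max e.height e'.height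
  | sub e e' => max e.height e'.height + 2
  | sum e e' => max e.height e'.height + 2
  | symbolAt _ e => e.height + 1
  | rename _ e => e.height

open Fragment

/-- The program that adds the value of an expression to counter `o`. Variable `i` is in counter
`r i`, and the counters from `f` on are free. -/
def compile [DecidableEq α] [Inhabited α] :
    Expr α → (r : ℕ → ℕ) → (f o : ℕ) → Fragment α β B
  | one, _, _, o => inc o
  | length, _, _, o => (countUnread o).seq rewind
  | var i, r, f, o => copy (r i) o f
  | add e e', r, f, o => (e.compile r f o).seq (e'.compile r f o)
  | sub e e', r, f, o => (e.compile r (f + 2) f).seq ((e'.compile r (f + 2) (f + 1)).seq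
      ((subtract (f + 1) f).seq (move f o)))
  | sum e e', r, f, o => (e.compile r (f + 2) f).seq
      (forLoop f (e'.compile (consEnv (f + 1) r) (f + 2) o))
  | symbolAt a e, r, f, o => (e.compile r (f + 1) f).seq ((advanceBy f).seq
      (((inc o).ifNext a).seq rewind))
  | rename σ e, r, f, o => e.compile (fun i => r (σ i)) f o

/-- The program for an expression adds its value to the output counter, in at most `t` steps, and
changes nothing else. -/
def CompilesIn [DecidableEq α] [Inhabited α] (β : Type) (w : List α) (e : Expr α) (ρ : ℕ → ℕ)
    (t : ℕ) : Prop :=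
  ∀ (B : ℕ) (s : Store α β) (c r : ℕ → ℕ) (f o : ℕ), s.read = [] → s.unread = w →
    Layout ρ c r f → o < f → (∀ i, r i ≠ o) → f + e.height ≤ B →
    (e.compile r f o : Fragment α β B).Runs (s.withCounters c)
      (s.withCounters (Function.update c o (c o + e.eval w ρ))) t

namespace CompilesIn

variable [DecidableEq α] [Inhabited α] {w : List α} {ρ : ℕ → ℕ} {e e' : Expr α} {t t' : ℕ}

theorem mono (h : e.CompilesIn β w ρ t) (ht : t ≤ t') : e.CompilesIn β w ρ t' :=
  fun B s c r f o hread hunread hlayout ho hr hB =>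
    (h B s c r f o hread hunread hlayout ho hr hB).mono ht

theorem one : (one : Expr α).CompilesIn β w ρ 1 := by
  intro B s c r f o _ _ _ ho _ hB
  exact runs_inc_withCounters s (by lia) rfl

theorem length : (length : Expr α).CompilesIn β w ρ (w.length + 1 + (w.length + 1)) := by
  intro B s c r f o hread hunread _ ho _ hB
  have h := (runs_countUnread (B := B) (i := o) (by lia)
    (s.withCounters c)).seq (runs_rewind _)
  simpa [Store.setCounter, Store.withCounters, hread, hunread, eval, compile] using h

theorem var (i : ℕ) : (var i : Expr α).CompilesIn β w ρ (ρ i * 7 + 2) := by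
  intro B s c r f o _ _ hlayout ho hr hB
  have hri := hlayout.var_lt i
  simp only [height] at hB
  rw [← hlayout.var_eq i]
  exact runs_copy s (by lia) (by lia) (by lia) (hr i) (by lia) (by lia)
    (by simp only [eval, hlayout.var_eq]) (hlayout.free_eq f le_rfl)

theorem add (h : e.CompilesIn β w ρ t) (h' : e'.CompilesIn β w ρ t') :
    (add e e').CompilesIn β w ρ (t + t') := by
  intro B s c r f o hread hunread hlayout ho hr hB
  simp only [height] at hB
  have he := h B s c r f o hread hunread hlayout ho hr (by lia)
  have he' := h' B s (Function.update c o (c o + e.eval w ρ)) r f o hread hunread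
    (hlayout.update_output ho hr _) ho hr (by lia)
  simpa [eval, compile, add_assoc] using he.seq he'

theorem sub (h : e.CompilesIn β w ρ t) (h' : e'.CompilesIn β w ρ t') :
    (sub e e').CompilesIn β w ρ
      (t + (t' + ((e'.eval w ρ * 3 + 1) + (e.eval w ρ * 3 + 1)))) := by
  intro B s c r f o hread hunread hlayout ho _ hB
  simp only [height] at hB
  have hf := hlayout.free_eq f le_rfl
  have hf' := hlayout.free_eq (f + 1) (by lia)
  set x := e.eval w ρ with hx
  set y := e'.eval w ρ with hy
  have he := h B s c r (f + 2) f hread hunread (hlayout.mono (by lia)) (by lia)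
    (fun i => (hlayout.var_lt i).ne) (by lia)
  have he' := h' B s (Function.update c f x) r (f + 2) (f + 1) hread hunread
    ((hlayout.update_free x).mono (by lia)) (by lia)
    (fun i => by have := hlayout.var_lt i; lia) (by lia)
  have hsubtract := runs_subtract (B := B) s (i := f + 1) (j := f)
    (c := Function.update (Function.update c f x) (f + 1) y)
    (c' := Function.update c f (x - y)) (by lia) (by lia) (by lia)
    (by ext; simp only [Function.update_apply]; grind)
  have hmove := runs_move (B := B) s (c := Function.update c f (x - y))
    (c' := Function.update c o (c o + (x - y))) (by lia) (by lia) (by lia : f ≠ o)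
    (by ext; simp only [Function.update_apply]; grind)
  simp only [hf, ← hx, zero_add] at he
  simp only [Function.update_of_ne (show f + 1 ≠ f by lia), hf', ← hy, zero_add] at he'
  refine (he.seq (he'.seq (hsubtract.seq hmove))).mono ?_
  simp

theorem sum (h : e.CompilesIn β w ρ t)
    (h' : ∀ i < e.eval w ρ, e'.CompilesIn β w (consEnv i ρ) t') :
    (sum e e').CompilesIn β w ρ (t + (e.eval w ρ * (t' + 5) + 2)) := by
  intro B s c r f o hread hunread hlayout ho hr hB
  simp only [height] at hB
  have hf := hlayout.free_eq f le_rfl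
  let partialSum (k : ℕ) := c o + ∑ i ∈ Finset.range k, e'.eval w (consEnv i ρ)
  have hstart : Function.update c o (partialSum 0) = c := by simp [partialSum]
  have he := h B s c r (f + 2) f hread hunread (hlayout.mono (by lia)) (by lia)
    (fun i => (hlayout.var_lt i).ne) (by lia)
  rw [hf, zero_add] at he
  have hlayout' (k : ℕ) := hlayout.update_output ho hr (partialSum k)
  have hbody (k : ℕ) (hk : k < e.eval w ρ) := h' k hk B s _ _ (f + 2) o hread hunread
    (((hlayout' k).update_free (e.eval w ρ - (k + 1))).bind k) (by lia)
    (by rintro (_ | i); exacts [by simp only [consEnv]; lia, hr i]) (by lia)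
  have hloop := runs_forLoop (B := B) (i := f)
    (F := e'.compile (consEnv (f + 1) r) (f + 2) o) (t := t') (by lia) (e.eval w ρ)
    (fun k => s.withCounters (Function.update c o (partialSum k)))
    (fun k _ => (hlayout' k).free_eq f le_rfl) (fun k _ => (hlayout' k).free_eq (f + 1) (by lia))
    fun k hk => by
      simpa [partialSum, Finset.sum_range_succ, Store.setCounter, Store.withCounters, add_assoc,
        Function.update_of_ne (show o ≠ f + 1 by lia), Function.update_of_ne ho.ne,
        Function.update_comm (show f + 1 ≠ o by lia), Function.update_comm ho.ne'] using hbody k hk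
  simp only [hstart] at hloop
  exact he.seq hloop

theorem symbolAt (a : α) (h : e.CompilesIn β w ρ t) :
    (symbolAt a e).CompilesIn β w ρ
      (t + ((e.eval w ρ * 3 + 1) + (2 + (w.length + 1)))) := by
  intro B s c r f o hread hunread hlayout ho _ hB
  simp only [height] at hB
  have hf := hlayout.free_eq f le_rfl
  set x := e.eval w ρ with hx
  have he := h B s c r (f + 1) f hread hunread (hlayout.mono (by lia)) (by lia)
    (fun i => (hlayout.var_lt i).ne) (by lia)
  have hadvance := runs_advanceBy (B := B) s (i := f) (c := Function.update c f x) (c' := c)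
    (by lia) (by ext; simp only [Function.update_apply]; grind)
  rw [Function.update_self] at hadvance
  have hnext : (Store.advance^[x] s).unread.head? = w[x]? := by
    simp [Store.advance_iterate s x hread, hunread]
  have htest := runs_ifNext_inc (B := B) (Store.advance^[x] s) (i := o) (c := c)
    (c' := Function.update c o (c o + (Expr.symbolAt a e).eval w ρ)) a (by lia)
    (by rw [hnext]; rfl)
  have hrewind := runs_rewind_advance_iterate (B := B) s
    (c := Function.update c o (c o + (Expr.symbolAt a e).eval w ρ)) hread x
  rw [hunread] at hrewind
  simp only [hf, ← hx, zero_add] at he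
  exact he.seq (hadvance.seq (htest.seq hrewind))

theorem rename (σ : ℕ → ℕ) (h : e.CompilesIn β w (fun i => ρ (σ i)) t) :
    (rename σ e).CompilesIn β w ρ t := fun B s c r f o hread hunread hlayout ho hr hB =>
  h B s c (fun i => r (σ i)) f o hread hunread (hlayout.comp σ) ho (fun i => hr (σ i)) hB

end CompilesIn

end Expr

end Expressions

section PolynomialTime

open Polynomial

variable {α β : Type} {B : ℕ}

theorem consEnv_le {n m i : ℕ} {ρ : ℕ → ℕ} (h : ∀ j, ρ j ≤ n) (hn : n ≤ m) (hi : i ≤ m) :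
    ∀ j, consEnv i ρ j ≤ m
  | 0 => hi
  | j + 1 => (h j).trans hn

namespace Expr

variable [DecidableEq α] [Inhabited α] {e e' : Expr α} {p q : ℕ[X]}

/-- The polynomial `p` bounds both the value of an expression and the time of its evaluation, in
terms of a common bound for the length of the word and the values of the variables. -/
def PolyBounded (β : Type) (e : Expr α) (p : ℕ[X]) : Prop :=
  ∀ (w : List α) (ρ : ℕ → ℕ) (n : ℕ), w.length ≤ n → (∀ i, ρ i ≤ n) →
    e.eval w ρ ≤ p.eval n ∧ e.CompilesIn β w ρ (p.eval n)

theorem PolyBounded.sub (he : e.PolyBounded β p) (he' : e'.PolyBounded β q) :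
    (sub e e').PolyBounded β (4 * p + 4 * q + 2) := by
  intro w ρ n hw hρ
  obtain ⟨hle, hrun⟩ := he w ρ n hw hρ
  obtain ⟨hle', hrun'⟩ := he' w ρ n hw hρ
  simp only [eval_add, eval_mul, eval_ofNat]
  exact ⟨by simp only [Expr.eval]; lia, (hrun.sub hrun').mono (by lia)⟩

theorem PolyBounded.sum (he : e.PolyBounded β p) (he' : e'.PolyBounded β q) :
    (sum e e').PolyBounded β (p * q.comp (X + p) + 6 * p + 2) := by
  intro w ρ n hw hρ
  obtain ⟨hle, hrun⟩ := he w ρ n hw hρ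
  have hterm (i : ℕ) (hi : i < e.eval w ρ) := he' w (consEnv i ρ) (n + p.eval n) (by lia)
    (consEnv_le hρ (by lia) (by lia))
  have hmul := Nat.mul_le_mul_right (q.eval (n + p.eval n)) hle
  have hsum : (Expr.sum e e').eval w ρ ≤ e.eval w ρ * q.eval (n + p.eval n) := by
    simpa [Expr.eval] using Finset.sum_le_card_nsmul (Finset.range (e.eval w ρ)) _ _
      fun i hi => (hterm i (Finset.mem_range.1 hi)).1
  simp only [eval_add, eval_mul, eval_comp, eval_X, eval_ofNat]
  exact ⟨by lia, (hrun.sum fun i hi => (hterm i hi).2).mono (by lia)⟩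

theorem PolyBounded.symbolAt (a : α) (he : e.PolyBounded β p) :
    (symbolAt a e).PolyBounded β (4 * p + X + 4) := by
  intro w ρ n hw hρ
  obtain ⟨hle, hrun⟩ := he w ρ n hw hρ
  simp only [eval_add, eval_mul, eval_X, eval_ofNat]
  exact ⟨by simp only [Expr.eval]; split <;> lia, (hrun.symbolAt a).mono (by lia)⟩

theorem exists_polyBounded (β : Type) (e : Expr α) : ∃ p, e.PolyBounded β p := by
  induction e with
  | one => exact ⟨1, fun w ρ n _ _ => by simpa [eval] using CompilesIn.one⟩
  | length =>
    refine ⟨2 * X + 2, fun w ρ n hw _ => ?_⟩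
    simp only [eval_add, eval_mul, eval_X, eval_ofNat]
    exact ⟨by simp only [Expr.eval]; lia, CompilesIn.length.mono (by lia)⟩
  | var i =>
    refine ⟨7 * X + 2, fun w ρ n _ hρ => ?_⟩
    have := hρ i
    simp only [eval_add, eval_mul, eval_X, eval_ofNat]
    exact ⟨by simp only [Expr.eval]; lia, (CompilesIn.var i).mono (by lia)⟩
  | add e e' ih ih' =>
    obtain ⟨p, hp⟩ := ih
    obtain ⟨q, hq⟩ := ih'
    refine ⟨p + q, fun w ρ n hw hρ => ?_⟩
    rw [eval_add]
    exact ⟨add_le_add (hp w ρ n hw hρ).1 (hq w ρ n hw hρ).1,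
      (hp w ρ n hw hρ).2.add (hq w ρ n hw hρ).2⟩
  | sub e e' ih ih' => exact ⟨_, ih.choose_spec.sub ih'.choose_spec⟩
  | sum e e' ih ih' => exact ⟨_, ih.choose_spec.sum ih'.choose_spec⟩
  | symbolAt a e ih => exact ⟨_, ih.choose_spec.symbolAt a⟩
  | rename σ e ih =>
    obtain ⟨p, hp⟩ := ih
    exact ⟨p, fun w ρ n hw hρ => (hp w _ n hw fun i => hρ (σ i)).imp_right (.rename σ)⟩

end Expr

/-- Programs that generate a word from a given word and the values of variables; `loop e g` binds a
variable in `g` that runs over `0, …, e - 1`. -/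
inductive WordProgram (α β : Type) : Type
  | nil
  | emit (b : β)
  | append (g g' : WordProgram α β)
  | loop (e : Expr α) (g : WordProgram α β)
  | rename (σ : ℕ → ℕ) (g : WordProgram α β)

/-- Emit the word `l`. -/
def Store.emit (s : Store α β) (l : List β) : Store α β :=
  { s with emitted := l.reverse ++ s.emitted }

theorem Store.emit_append (s : Store α β) (l l' : List β) :
    s.emit (l ++ l') = (s.emit l).emit l' := by
  simp [emit]

namespace WordProgram

/-- The word generated by a program. -/
def eval [DecidableEq α] (w : List α) : WordProgram α β → (ℕ → ℕ) → List β
  | nil, _ => []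
  | emit b, _ => [b]
  | append g g', ρ => g.eval w ρ ++ g'.eval w ρ
  | loop e g, ρ => (List.range (e.eval w ρ)).flatMap fun i => g.eval w (consEnv i ρ)
  | rename σ g, ρ => g.eval w fun i => ρ (σ i)

/-- The number of auxiliary counters used by the compiled program. -/
def height : WordProgram α β → ℕ
  | nil => 0
  | emit _ => 0
  | append g g' => max g.height g'.height
  | loop e g => max e.height g.height + 2
  | rename _ g => g.height

variable [DecidableEq α] [Inhabited α]

/-- The machine program that emits the generated word. Variable `i` is in counter `r i`, and the
counters from `f` on are free. -/
def compile : WordProgram α β → (r : ℕ → ℕ) → (f : ℕ) → Fragment α β B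
  | nil, _, _ => .skip
  | emit b, _, _ => .emit b
  | append g g', r, f => (g.compile r f).seq (g'.compile r f)
  | loop e g, r, f => (e.compile r (f + 2) f).seq
      (.forLoop f (g.compile (consEnv (f + 1) r) (f + 2)))
  | rename σ g, r, f => g.compile (fun i => r (σ i)) f

/-- The compiled program emits the generated word, in at most `t` steps, and changes nothing
else. -/
def CompilesIn (w : List α) (g : WordProgram α β) (ρ : ℕ → ℕ) (t : ℕ) : Prop :=
  ∀ (B : ℕ) (s : Store α β) (c r : ℕ → ℕ) (f : ℕ), s.read = [] → s.unread = w →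
    Layout ρ c r f → f + g.height ≤ B →
    (g.compile r f : Fragment α β B).Runs (s.withCounters c)
      ((s.emit (g.eval w ρ)).withCounters c) t

namespace CompilesIn

variable {w : List α} {e : Expr α} {g g' : WordProgram α β} {ρ : ℕ → ℕ} {t t' : ℕ}

theorem mono (h : g.CompilesIn w ρ t) (ht : t ≤ t') : g.CompilesIn w ρ t' :=
  fun B s c r f hread hunread hlayout hB => (h B s c r f hread hunread hlayout hB).mono ht

theorem append (h : g.CompilesIn w ρ t) (h' : g'.CompilesIn w ρ t') :
    (append g g').CompilesIn w ρ (t + t') := by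
  intro B s c r f hread hunread hlayout hB
  simp only [height] at hB
  rw [eval, s.emit_append]
  exact (h B s c r f hread hunread hlayout (by lia)).seq
    (h' B (s.emit _) c r f hread hunread hlayout (by lia))

theorem loop (h : e.CompilesIn β w ρ t)
    (h' : ∀ i < e.eval w ρ, g.CompilesIn w (consEnv i ρ) t') :
    (loop e g).CompilesIn w ρ (t + (e.eval w ρ * (t' + 5) + 2)) := by
  intro B s c r f hread hunread hlayout hB
  simp only [height] at hB
  have hf := hlayout.free_eq f le_rfl
  let partialWord (k : ℕ) := (List.range k).flatMap fun i => g.eval w (consEnv i ρ)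
  have he := h B s c r (f + 2) f hread hunread (hlayout.mono (by lia)) (by lia)
    (fun i => (hlayout.var_lt i).ne) (by lia)
  have hbody (k : ℕ) (hk : k < e.eval w ρ) := h' k hk B (s.emit (partialWord k)) _ _ (f + 2)
    hread hunread (((hlayout.update_free (e.eval w ρ - (k + 1))).mono (by lia)).bind k) (by lia)
  have hloop := Fragment.runs_forLoop (B := B) (i := f)
    (F := g.compile (consEnv (f + 1) r) (f + 2)) (t := t') (by lia) (e.eval w ρ)
    (fun k => (s.emit (partialWord k)).withCounters c)
    (fun _ _ => hf) (fun _ _ => hlayout.free_eq (f + 1) (by lia))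
    fun k hk => by
      simpa [partialWord, List.range_succ, Store.emit_append, Store.setCounter,
        Store.withCounters] using hbody k hk
  rw [hf, zero_add] at he
  exact he.seq hloop

theorem rename (σ : ℕ → ℕ) (h : g.CompilesIn w (fun i => ρ (σ i)) t) :
    (rename σ g).CompilesIn w ρ t := fun B s c r f hread hunread hlayout hB =>
  h B s c (fun i => r (σ i)) f hread hunread (hlayout.comp σ) hB

end CompilesIn

/-- The polynomial `p` bounds both the length of the generated word and the time of its generation,
in terms of a common bound for the length of the given word and the values of the variables. -/
def PolyBounded (g : WordProgram α β) (p : ℕ[X]) : Prop :=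
  ∀ (w : List α) (ρ : ℕ → ℕ) (n : ℕ), w.length ≤ n → (∀ i, ρ i ≤ n) →
    (g.eval w ρ).length ≤ p.eval n ∧ g.CompilesIn w ρ (p.eval n)

theorem PolyBounded.loop {e : Expr α} {g : WordProgram α β} {p q : ℕ[X]} (he : e.PolyBounded β p)
    (hg : g.PolyBounded q) : (loop e g).PolyBounded (p * q.comp (X + p) + 6 * p + 2) := by
  intro w ρ n hw hρ
  obtain ⟨hle, hrun⟩ := he w ρ n hw hρ
  have hterm (i : ℕ) (hi : i < e.eval w ρ) := hg w (consEnv i ρ) (n + p.eval n) (by lia)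
    (consEnv_le hρ (by lia) (by lia))
  have hmul := Nat.mul_le_mul_right (q.eval (n + p.eval n)) hle
  have hlength : ((WordProgram.loop e g).eval w ρ).length ≤
      e.eval w ρ * q.eval (n + p.eval n) := by
    simp only [WordProgram.eval, List.length_flatMap]
    simpa using List.sum_le_card_nsmul
      ((List.range (e.eval w ρ)).map fun i => (g.eval w (consEnv i ρ)).length)
      (q.eval (n + p.eval n)) (by simpa using fun i hi => (hterm i hi).1)
  simp only [eval_add, eval_mul, eval_comp, eval_X, eval_ofNat]
  exact ⟨by lia, (CompilesIn.loop hrun fun i hi => (hterm i hi).2).mono (by lia)⟩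

theorem exists_polyBounded (g : WordProgram α β) : ∃ p, g.PolyBounded p := by
  induction g with
  | nil =>
    exact ⟨1, fun _ _ _ _ _ => ⟨by simp [WordProgram.eval],
      eval_one (R := ℕ) ▸ fun _ _ _ _ _ _ _ _ _ => Fragment.runs_skip _⟩⟩
  | emit b =>
    exact ⟨1, fun _ _ _ _ _ => ⟨by simp [WordProgram.eval],
      eval_one (R := ℕ) ▸ fun _ _ _ _ _ _ _ _ _ => Fragment.runs_emit b _⟩⟩
  | append g g' ih ih' =>
    obtain ⟨p, hp⟩ := ih
    obtain ⟨q, hq⟩ := ih'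
    refine ⟨p + q, fun w ρ n hw hρ => ?_⟩
    rw [eval_add, WordProgram.eval, List.length_append]
    exact ⟨add_le_add (hp w ρ n hw hρ).1 (hq w ρ n hw hρ).1,
      (hp w ρ n hw hρ).2.append (hq w ρ n hw hρ).2⟩
  | loop e g ih =>
    obtain ⟨p, hp⟩ := e.exists_polyBounded β
    obtain ⟨q, hq⟩ := ih
    exact ⟨_, PolyBounded.loop hp hq⟩
  | rename σ g ih =>
    obtain ⟨p, hp⟩ := ih
    exact ⟨p, fun w ρ n hw hρ => (hp w _ n hw fun i => hρ (σ i)).imp_right (.rename σ)⟩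

theorem exists_fragment_runs [Inhabited β] (g : WordProgram α β) :
    ∃ (B : ℕ) (F : Fragment α β B) (p : ℕ[X]), ∀ w,
      F.Runs (.initial w) (.final (g.eval w fun _ => 0)) (p.eval w.length) := by
  obtain ⟨p, hp⟩ := g.exists_polyBounded
  refine ⟨1 + g.height, (g.compile (fun _ => 0) 1).seq (Fragment.eraseUnread.seq .flush),
    p + (X + 1 + (p + 1)), fun w => ?_⟩
  obtain ⟨hlength, hrun⟩ := hp w (fun _ => 0) _ le_rfl fun _ => Nat.zero_le _
  have hlayout : Layout (fun _ => 0) (fun _ => 0) (fun _ => 0) 1 :=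
    ⟨fun _ => one_pos, fun _ => rfl, fun _ _ => rfl⟩
  have h := (hrun (1 + g.height) (.initial w) _ _ 1 rfl rfl hlayout le_rfl).seq
    ((Fragment.runs_eraseUnread _).seq (Fragment.runs_flush _))
  simp only [eval_add, eval_X, eval_one]
  refine Fragment.Runs.mono (t := p.eval w.length +
    (w.length + 1 + ((g.eval w fun _ => 0).length + 1))) ?_ (by lia)
  simpa [Store.withCounters, Store.emit, Store.initial, Store.final] using h

theorem computable [Inhabited β] [Finite α] [Finite β] (g : WordProgram α β) {X Y : Type}
    (encX : X → List α) (encY : Y → List β) (f : X → Y)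
    (h : ∀ x, g.eval (encX x) (fun _ => 0) = encY (f x)) :
    Nonempty (TM2ComputableInPolyTime encX encY f) := by
  obtain ⟨B, F, p, hp⟩ := g.exists_fragment_runs
  have := Fintype.ofFinite α
  have := Fintype.ofFinite β
  refine ⟨⟨⟨F.machine, Equiv.refl _, Equiv.refl _⟩, p + 1, fun x => Nonempty.some ?_⟩⟩
  have hrun := F.machine_outputs (hp (encX x))
  rw [h] at hrun
  have hX : (encX x).map (Equiv.refl α).invFun = encX x := List.map_id _
  have hY : (encY (f x)).map (Equiv.refl β).invFun = encY (f x) := List.map_id _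
  rw [eval_add, eval_one]
  exact (congrArg₂ (fun l l' => Nonempty (TM2OutputsInTime F.machine l (some l')
    (p.eval (encX x).length + 1))) hX hY).mpr hrun

end WordProgram

end PolynomialTime

/-! ### Functions definable by programs -/

section Definable

/-- A context: a word together with finitely many natural numbers. -/
class Context (α : outParam Type) (X : Type) where
  word : X → List α
  vars : X → ℕ → ℕ

instance (α : Type) : Context α (List α) := ⟨id, fun _ _ => 0⟩

instance (α X : Type) [Context α X] : Context α (X × ℕ) :=
  ⟨fun p => Context.word p.1, fun p => consEnv p.2 (Context.vars p.1)⟩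

variable {α β X Y : Type} [DecidableEq α] [Context α X]

/-- Number-valued functions definable by expressions. -/
def Definable (f : X → ℕ) : Prop := ∃ e : Expr α, ∀ x, e.eval (Context.word x)
    (Context.vars x) = f x

/-- Definable predicates. -/
def DefinablePred (p : X → Prop) : Prop := ∃ f : X → ℕ, Definable f ∧ ∀ x, p x ↔ f x ≠ 0

/-- Word-valued functions definable by programs. -/
def DefinableWord (g : X → List β) : Prop := ∃ e : WordProgram α β, ∀ x, e.eval (Context.word x)
    (Context.vars x) = g x

theorem Definable.congr {f g : X → ℕ} (hf : Definable f) (h : ∀ x, g x = f x) : Definable g := by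
  obtain rfl : g = f := funext h
  exact hf

theorem DefinablePred.congr {p q : X → Prop} (hp : DefinablePred p) (h : ∀ x, q x ↔ p x) :
    DefinablePred q := by
  obtain rfl : q = p := funext fun x => propext (h x)
  exact hp

theorem DefinableWord.congr {f g : X → List β} (hf : DefinableWord f) (h : ∀ x, g x = f x) :
    DefinableWord g := by
  obtain rfl : g = f := funext h
  exact hf

theorem Definable.add {f g : X → ℕ} (hf : Definable f) (hg : Definable g) :
    Definable fun x => f x + g x := by
  obtain ⟨e, he⟩ := hf
  obtain ⟨e', he'⟩ := hg
  exact ⟨.add e e', fun x => by simp only [Expr.eval, he, he']⟩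

theorem Definable.sub {f g : X → ℕ} (hf : Definable f) (hg : Definable g) :
    Definable fun x => f x - g x := by
  obtain ⟨e, he⟩ := hf
  obtain ⟨e', he'⟩ := hg
  exact ⟨.sub e e', fun x => by simp only [Expr.eval, he, he']⟩

theorem Definable.sum {b : X → ℕ} {f : X → ℕ → ℕ} (hb : Definable b)
    (hf : Definable fun y : X × ℕ => f y.1 y.2) :
    Definable fun x => ∑ i ∈ Finset.range (b x), f x i := by
  obtain ⟨e, he⟩ := hb
  obtain ⟨e', he'⟩ := hf
  exact ⟨.sum e e', fun x => by
    simp only [Expr.eval, he]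
    exact Finset.sum_congr rfl fun i _ => he' (x, i)⟩

theorem Definable.const (n : ℕ) : Definable fun _ : X => n := by
  induction n with
  | zero => exact ⟨.sub .one .one, fun x => by simp [Expr.eval]⟩
  | succ n ih => exact ih.add ⟨.one, fun x => rfl⟩

theorem Definable.fst {f : X → ℕ} (hf : Definable f) : Definable fun y : X × ℕ => f y.1 := by
  obtain ⟨e, he⟩ := hf
  exact ⟨.rename (· + 1) e, fun x => he x.1⟩

theorem Definable.weaken {f : X → ℕ → ℕ} (hf : Definable fun y : X × ℕ => f y.1 y.2) :
    Definable fun z : (X × ℕ) × ℕ => f z.1.1 z.2 := by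
  obtain ⟨e, he⟩ := hf
  refine ⟨.rename (fun i => if i = 0 then 0 else i + 1) e, fun z => ?_⟩
  refine Eq.trans ?_ (he (z.1.1, z.2))
  simp only [Expr.eval]
  congr 1
  funext i
  cases i <;> rfl

theorem Definable.snd : Definable fun y : X × ℕ => y.2 := ⟨.var 0, fun _ => rfl⟩

theorem Definable.mul {f g : X → ℕ} (hf : Definable f) (hg : Definable g) :
    Definable fun x => f x * g x :=
  (hf.sum (f := fun x _ => g x) hg.fst).congr fun x => by simp

theorem DefinablePred.weaken {p : X → ℕ → Prop} (hp : DefinablePred fun y : X × ℕ => p y.1 y.2) :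
    DefinablePred fun z : (X × ℕ) × ℕ => p z.1.1 z.2 := by
  obtain ⟨f, hf, h⟩ := hp
  exact ⟨_, hf.weaken (f := fun x i => f (x, i)), fun z => h (z.1.1, z.2)⟩

theorem DefinablePred.lt {f g : X → ℕ} (hf : Definable f) (hg : Definable g) :
    DefinablePred fun x => f x < g x :=
  ⟨_, hg.sub hf, fun x => by lia⟩

theorem DefinablePred.not {p : X → Prop} (hp : DefinablePred p) : DefinablePred fun x => ¬p x := by
  obtain ⟨f, hf, h⟩ := hp
  exact ⟨_, (Definable.const 1).sub hf, fun x => by simp only [h]; lia⟩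

theorem DefinablePred.and {p q : X → Prop} (hp : DefinablePred p) (hq : DefinablePred q) :
    DefinablePred fun x => p x ∧ q x := by
  obtain ⟨f, hf, h⟩ := hp
  obtain ⟨g, hg, h'⟩ := hq
  exact ⟨_, hf.mul hg, fun x => by simp [h, h']⟩

theorem DefinablePred.or {p q : X → Prop} (hp : DefinablePred p) (hq : DefinablePred q) :
    DefinablePred fun x => p x ∨ q x := by
  obtain ⟨f, hf, h⟩ := hp
  obtain ⟨g, hg, h'⟩ := hq
  exact ⟨_, hf.add hg, fun x => by simp only [h, h']; lia⟩

theorem DefinablePred.le {f g : X → ℕ} (hf : Definable f) (hg : Definable g) :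
    DefinablePred fun x => f x ≤ g x :=
  (DefinablePred.lt hg hf).not.congr fun x => by lia

theorem DefinablePred.eq {f g : X → ℕ} (hf : Definable f) (hg : Definable g) :
    DefinablePred fun x => f x = g x :=
  ((DefinablePred.le hf hg).and (DefinablePred.le hg hf)).congr fun x => by lia

theorem DefinablePred.ne {f g : X → ℕ} (hf : Definable f) (hg : Definable g) :
    DefinablePred fun x => f x ≠ g x := (DefinablePred.eq hf hg).not

theorem DefinablePred.ex {b : X → ℕ} {p : X → ℕ → Prop} (hb : Definable b)
    (hp : DefinablePred fun y : X × ℕ => p y.1 y.2) :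
    DefinablePred fun x => ∃ i < b x, p x i := by
  obtain ⟨f, hf, h⟩ := hp
  refine ⟨_, hb.sum (f := fun x i => f (x, i)) hf, fun x => ?_⟩
  rw [Ne, Finset.sum_eq_zero_iff]
  push Not
  exact exists_congr fun i => and_congr (by simp) (h (x, i))

theorem Definable.ite {p : X → Prop} [DecidablePred p] {f g : X → ℕ} (hp : DefinablePred p)
    (hf : Definable f) (hg : Definable g) : Definable fun x => if p x then f x else g x := by
  obtain ⟨h, hh, e⟩ := hp
  refine ((((Definable.const 1).sub ((Definable.const 1).sub hh)).mul hf).add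
    (((Definable.const 1).sub hh).mul hg)).congr fun x => ?_
  split_ifs with hx
  · have := (e x).1 hx
    have h1 : 1 - h x = 0 := by lia
    simp [h1]
  · have : h x = 0 := by by_contra h; exact hx ((e x).2 h)
    simp [this]

theorem DefinableWord.nil : DefinableWord fun _ : X => ([] : List β) := ⟨.nil, fun _ => rfl⟩

theorem DefinableWord.append {f g : X → List β} (hf : DefinableWord f) (hg : DefinableWord g) :
    DefinableWord fun x => f x ++ g x := by
  obtain ⟨e, he⟩ := hf
  obtain ⟨e', he'⟩ := hg
  exact ⟨.append e e', fun x => by simp only [WordProgram.eval, he, he']⟩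

theorem DefinableWord.const (l : List β) : DefinableWord fun _ : X => l := by
  induction l with
  | nil => exact .nil
  | cons b l ih => exact DefinableWord.append (f := fun _ => [b]) ⟨.emit b, fun _ => rfl⟩ ih

theorem DefinableWord.flatMap {b : X → ℕ} {g : X → ℕ → List β} (hb : Definable b)
    (hg : DefinableWord fun y : X × ℕ => g y.1 y.2) : DefinableWord fun x =>
      (List.range (b x)).flatMap (g x) := by
  obtain ⟨e, he⟩ := hb
  obtain ⟨e', he'⟩ := hg
  refine ⟨.loop e e', fun x => ?_⟩
  simp only [WordProgram.eval, he]
  congr 1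
  funext i
  exact he' (x, i)

theorem DefinableWord.fst {g : X → List β} (hg : DefinableWord g) : DefinableWord fun y :
    X × ℕ => g y.1 := by
  obtain ⟨e, he⟩ := hg
  exact ⟨.rename (· + 1) e, fun y => he y.1⟩

theorem DefinableWord.ite {p : X → Prop} [DecidablePred p] {f g : X → List β} (hp : DefinablePred p)
    (hf : DefinableWord f)
    (hg : DefinableWord g) : DefinableWord fun x => if p x then f x else g x := by
  refine (DefinableWord.append (DefinableWord.flatMap (g := fun x _ => f x)
    (Definable.ite hp (Definable.const 1) (Definable.const 0)) hf.fst)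
    (DefinableWord.flatMap (g := fun x _ => g x)
      (Definable.ite hp (Definable.const 0) (Definable.const 1)) hg.fst)).congr
    fun x => ?_
  split_ifs <;> simp

theorem DefinableWord.map {γ : Type} (h : β → γ) {g : X → List β} (hg : DefinableWord g) :
    DefinableWord fun x => (g x).map h := by
  obtain ⟨e, he⟩ := hg
  suffices ∃ e' : WordProgram α γ, ∀ w ρ, e'.eval w ρ = (e.eval w ρ).map h by
    obtain ⟨e', he'⟩ := this
    exact ⟨e', fun x => by rw [he', he]⟩
  clear he
  induction e with
  | nil => exact ⟨.nil, fun _ _ => rfl⟩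
  | emit b => exact ⟨.emit (h b), fun _ _ => rfl⟩
  | append g g' ih ih' =>
    obtain ⟨a, ha⟩ := ih
    obtain ⟨b, hb⟩ := ih'
    exact ⟨.append a b, fun _ _ => by simp only [WordProgram.eval, ha, hb, List.map_append]⟩
  | loop e g ih =>
    obtain ⟨a, ha⟩ := ih
    exact ⟨.loop e a, fun _ _ => by simp only [WordProgram.eval, ha, List.map_flatMap]⟩
  | rename σ g ih =>
    obtain ⟨a, ha⟩ := ih
    exact ⟨.rename σ a, fun _ _ => by simp only [WordProgram.eval, ha]⟩

theorem DefinableWord.computable [Inhabited α] [Inhabited β] [Finite α] [Finite β]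
    {F : List α → List β}
    (hF : DefinableWord F) {X Y : Type} (ea : X → List α) (eb : Y → List β) (f : X → Y)
    (h : ∀ x, F (ea x) = eb (f x)) : Nonempty (TM2ComputableInPolyTime ea eb f) := by
  obtain ⟨g, hg⟩ := hF
  exact g.computable ea eb f fun x => (hg (ea x)).trans (h x)

/-! ### Definable lists -/

/-- A word that depends definably on the context: its length and its entries are definable. -/
def DefinableList (l : X → List α) : Prop :=
  Definable (fun x => (l x).length) ∧ ∀ a, DefinablePred fun y : X × ℕ => (l y.1)[y.2]? = some a

theorem DefinableList.length {l : X → List α} (hl : DefinableList l) : Definable fun x =>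
    (l x).length := hl.1

theorem DefinableList.get {l : X → List α} (hl : DefinableList l) {f : X → ℕ} (hf : Definable f)
    (a : α) :
    DefinablePred fun x => (l x)[f x]? = some a :=
  (DefinablePred.ex hl.1 (p := fun x i => i = f x ∧ (l x)[i]? = some a)
    ((DefinablePred.eq Definable.snd hf.fst).and (hl.2 a))).congr fun x => by
      constructor
      · intro h
        have := (List.getElem?_eq_some_iff.1 h).1
        exact ⟨_, this, rfl, h⟩
      · rintro ⟨i, _, rfl, h⟩
        exact h

theorem DefinableList.fst {l : X → List α} (hl : DefinableList l) :
    DefinableList fun y : X × ℕ => l y.1 :=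
  ⟨hl.1.fst, fun a => (hl.2 a).weaken (p := fun x i => (l x)[i]? = some a)⟩

theorem DefinableList.word : DefinableList fun x : X => Context.word x := by
  refine ⟨⟨.length, fun _ => rfl⟩, fun a => ⟨_, ⟨.symbolAt a (.var 0), fun _ => rfl⟩, fun y => ?_⟩⟩
  simp only [Expr.eval, Context.word, Context.vars, consEnv]
  split_ifs with h <;> simp [h]

end Definable

section Select

variable {α : Type}

/-- The subword of `l` that consists of the symbols at the positions that satisfy `p`. -/
def select (p : ℕ → Prop) [DecidablePred p] (l : List α) : List α :=
  (l.zipIdx.filter fun x => p x.2).map Prod.fst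

variable (p : ℕ → Prop) [DecidablePred p] (l : List α)

theorem select_concat (a : α) :
    select p (l ++ [a]) = select p l ++ if p l.length then [a] else [] := by
  by_cases h : p l.length <;> simp [select, List.zipIdx_append, h]

theorem length_select :
    (select p l).length = ∑ q ∈ Finset.range l.length, if p q then 1 else 0 := by
  induction l using List.reverseRecOn with
  | nil => rfl
  | append_singleton l a ih =>
    rw [select_concat, List.length_append, ih, List.length_append, List.length_singleton,
      Finset.sum_range_succ]
    split_ifs <;> rfl

theorem getElem?_select (t : ℕ) (a : α) : (select p l)[t]? = some a ↔ ∃ q < l.length,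
    (p q ∧ l[q]? = some a) ∧ (∑ j ∈ Finset.range q, if p j then 1 else 0) = t := by
  induction l using List.reverseRecOn with
  | nil => simp [select]
  | append_singleton l b ih =>
    have hlast : (∃ q < (l ++ [b]).length, (p q ∧ (l ++ [b])[q]? = some a) ∧
        (∑ j ∈ Finset.range q, if p j then 1 else 0) = t) ↔
        (select p l)[t]? = some a ∨ (p l.length ∧ b = a) ∧ (select p l).length = t := by
      rw [ih, length_select, List.length_append, List.length_singleton, Nat.exists_lt_succ_right]
      simp only [List.getElem?_concat_length, Option.some.injEq]
      refine or_congr_left (exists_congr fun q => and_congr_right fun hq => ?_)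
      rw [List.getElem?_append_left hq]
    rw [hlast, select_concat, List.getElem?_append]
    grind

theorem select_congr {p' : ℕ → Prop} [DecidablePred p'] (h : ∀ q < l.length, p q ↔ p' q) :
    select p l = select p' l := by
  refine congrArg _ (List.filter_congr fun x hx => ?_)
  simpa using h x.2 (by have := List.snd_lt_of_mem_zipIdx hx; lia)

end Select

section Blocks

variable {α X : Type} [DecidableEq α]

/-- Block number `i` of the word `l`, where the symbol `c` separates the blocks. It is empty if
there are not so many blocks. -/
def block (c : α) (l : List α) (i : ℕ) : List α := ((l.splitOn c)[i]?).getD []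

theorem block_cons_self (c : α) (l : List α) (i : ℕ) : block c (c :: l) (i + 1) = block c l i := by
  simp [block, List.splitOn_cons_eq_if_modifyHead]

theorem block_cons_zero (c a : α) (l : List α) :
    block c (a :: l) 0 = if a = c then [] else a :: block c l 0 := by
  obtain ⟨b, bs, h⟩ := List.exists_cons_of_ne_nil (List.splitOn_ne_nil c l)
  by_cases ha : a = c <;> simp [block, List.splitOn_cons_eq_if_modifyHead, ha, h]

theorem block_cons_succ_of_ne {c a : α} (h : a ≠ c) (l : List α) (i : ℕ) :
    block c (a :: l) (i + 1) = block c l (i + 1) := by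
  obtain ⟨b, bs, hl⟩ := List.exists_cons_of_ne_nil (List.splitOn_ne_nil c l)
  simp [block, List.splitOn_cons_eq_if_modifyHead, h, hl]

theorem block_concat (c a : α) (l : List α) (i : ℕ) :
    block c (l ++ [a]) i = block c l i ++ if a ≠ c ∧ l.count c = i then [a] else [] := by
  induction l generalizing i with
  | nil => rcases i with _ | i <;> by_cases h : a = c <;>
      simp [block, List.splitOn_cons_eq_if_modifyHead, h]
  | cons b l ih =>
    by_cases hb : b = c
    · subst hb
      rcases i with _ | i <;> simp [block_cons_self, block_cons_zero, ih]
    · rcases i with _ | i <;> simp [block_cons_succ_of_ne, block_cons_zero, hb, ih]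

theorem block_append_zero (c : α) {l : List α} (hl : c ∉ l) (l' : List α) :
    block c (l ++ c :: l') 0 = l := by
  simp [block, List.splitOn_append_cons_self_of_not_mem hl]

theorem block_append_succ (c : α) {l : List α} (hl : c ∉ l) (l' : List α) (i : ℕ) :
    block c (l ++ c :: l') (i + 1) = block c l' i := by
  simp [block, List.splitOn_append_cons_self_of_not_mem hl]

theorem block_flatMap {Y : Type} (c : α) (f : Y → List α) (hf : ∀ y, c ∉ f y) (l : List Y)
    (l' : List α) (i : ℕ) :
    block c (l.flatMap (fun y => f y ++ [c]) ++ l') i =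
      if h : i < l.length then f l[i] else block c l' (i - l.length) := by
  induction l generalizing i with
  | nil => simp
  | cons y l ih =>
    simp only [List.flatMap_cons, List.append_assoc, List.cons_append, List.nil_append]
    cases i with
    | zero => simpa using block_append_zero c (hf y) _
    | succ i =>
      rw [block_append_succ c (hf y), ih]
      simp

theorem block_eq_select (c : α) (l : List α) (i : ℕ) :
    block c l i = select (fun q => l[q]? ≠ some c ∧ (l.take q).count c = i) l := by
  induction l using List.reverseRecOn with
  | nil => rcases i with _ | i <;> rfl
  | append_singleton l a ih =>
    rw [block_concat, select_concat, ih]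
    congr 1
    · refine select_congr _ _ fun q hq => ?_
      rw [List.getElem?_append_left hq, List.take_append_of_le_length hq.le]
    · simp

theorem count_take (c : α) (l : List α) (q : ℕ) :
    (l.take q).count c = ∑ j ∈ Finset.range q, if l[j]? = some c then 1 else 0 := by
  induction q with
  | zero => simp
  | succ q ih =>
    rw [Finset.sum_range_succ, ← ih, List.take_add_one, List.count_append]
    cases l[q]? <;> simp [List.count_singleton]

variable [Context α X]

theorem Definable.count_take {l : X → List α} (hl : DefinableList l) (c : α) {q : X → ℕ}
    (hq : Definable q) : Definable fun x => ((l x).take (q x)).count c :=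
  (Definable.sum (f := fun x j => if (l x)[j]? = some c then 1 else 0) hq
    (.ite (hl.fst.get .snd c) (.const 1) (.const 0))).congr fun _ => GameSym.count_take ..

theorem Definable.count {l : X → List α} (hl : DefinableList l) (c : α) :
    Definable fun x => (l x).count c :=
  (Definable.count_take hl c hl.length).congr fun x => by rw [List.take_length]

theorem DefinableList.select {l : X → List α} (hl : DefinableList l) {p : X → ℕ → Prop}
    [∀ x, DecidablePred (p x)] (hp : DefinablePred fun y : X × ℕ => p y.1 y.2) :
    DefinableList fun x => select (p x) (l x) := by
  have hindicator : Definable fun y : X × ℕ => if p y.1 y.2 then 1 else 0 :=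
    .ite hp (.const 1) (.const 0)
  refine ⟨(Definable.sum hl.length hindicator).congr fun x => length_select _ _, fun a => ?_⟩
  refine (DefinablePred.ex hl.length.fst (p := fun y q => (p y.1 q ∧ (l y.1)[q]? = some a) ∧
    (∑ j ∈ Finset.range q, if p y.1 j then 1 else 0) = y.2) ?_).congr
      fun y => getElem?_select ..
  have hsum : Definable fun z : (X × ℕ) × ℕ =>
      ∑ j ∈ Finset.range z.2, if p z.1.1 j then 1 else 0 :=
    Definable.sum (f := fun (z : (X × ℕ) × ℕ) j => if p z.1.1 j then 1 else 0) .snd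
      (Definable.weaken (f := fun (y : X × ℕ) j => if p y.1 j then 1 else 0)
        (Definable.weaken (f := fun x j => if p x j then 1 else 0) hindicator))
  exact (hp.weaken.and (hl.fst.fst.get .snd a)).and (.eq hsum Definable.snd.fst)

theorem DefinableList.block {l : X → List α} (hl : DefinableList l) (c : α) {i : X → ℕ}
    (hi : Definable i) : DefinableList fun x => block c (l x) (i x) := by
  simp only [block_eq_select]
  exact hl.select (p := fun x q => (l x)[q]? ≠ some c ∧ ((l x).take q).count c = i x)
    ((hl.fst.get .snd c).not.and (.eq (.count_take hl.fst c .snd) hi.fst))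

theorem DefinableList.drop {l : X → List α} (hl : DefinableList l) {n : X → ℕ}
    (hn : Definable n) : DefinableList fun x => (l x).drop (n x) :=
  ⟨(hl.length.sub hn).congr fun x => List.length_drop, fun a =>
    (hl.fst.get (hn.fst.add .snd) a).congr fun y => by rw [List.getElem?_drop]⟩

end Blocks

/-! ### From graph isomorphism to zero-sum games -/

section MatrixGame

/-- The two-player zero-sum game with payoff matrix `v`: both players choose one of `M` actions, and
player `0` wins `v a b` from player `1`. -/
def matrixGame (M : ℕ) [NeZero M] (v : ℕ → ℕ → ℚ) : Game where
  N := 2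
  m _ := M
  m_pos _ := NeZero.pos M
  u i a := if i = 0 then v (a 0) (a 1) else -v (a 0) (a 1)

variable {M : ℕ} [NeZero M] {v : ℕ → ℕ → ℚ}

theorem matrixGame_isTwoPlayerZeroSum : (matrixGame M v).IsTwoPlayerZeroSum := by
  refine ⟨rfl, fun a => ?_⟩
  change ∑ i : Fin 2, _ = _
  rw [Fin.sum_univ_two]
  simp [matrixGame]

theorem perm_fin_two_eq_swap {π : Equiv.Perm (Fin 2)} (h : π ≠ 1) : π = Equiv.swap 0 1 := by
  revert π
  decide

theorem exists_perms_of_matrixGame_symmetry (S : (matrixGame M v).Symmetry)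
    (hS : ¬S.PlayerSeparable) :
    ∃ f g : Equiv.Perm (Fin M), ∀ a b : Fin M, v (g b) (f a) = -v a b := by
  obtain ⟨φ, π, hφ, hu⟩ := S
  change Equiv.Perm (Σ _ : Fin 2, Fin M) at φ
  obtain rfl : π = Equiv.swap (0 : Fin 2) 1 := perm_fin_two_eq_swap hS
  have hbij (i : Fin 2) :
      Function.Bijective fun a : Fin M => (φ ⟨i, a⟩).2 := by
    refine Finite.injective_iff_bijective.1 fun a b h => ?_
    have hab : φ ⟨i, a⟩ = φ ⟨i, b⟩ :=
      Sigma.ext ((hφ ⟨i, a⟩).trans (hφ ⟨i, b⟩).symm) (heq_of_eq h)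
    simpa using φ.injective hab
  refine ⟨.ofBijective _ (hbij 0), .ofBijective _ (hbij 1), fun a b => ?_⟩
  have h : v a b = -v (φ ⟨1, b⟩).2 (φ ⟨0, a⟩).2 := hu (0 : Fin 2) (![a, b] : Fin 2 → Fin M)
  exact (neg_eq_iff_eq_neg.2 h).symm

theorem exists_matrixGame_symmetry_of_perm {f : Equiv.Perm (Fin M)} (hf : Function.Involutive f)
    (h : ∀ a b : Fin M, v (f b) (f a) = -v a b) :
    ∃ S : (matrixGame M v).Symmetry, ¬S.PlayerSeparable := by
  let φ : Equiv.Perm (Σ _ : Fin 2, Fin M) := Function.Involutive.toPerm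
    (fun x => ⟨Equiv.swap 0 1 x.1, f x.2⟩) (fun x => by simp [hf x.2])
  refine ⟨⟨φ, Equiv.swap (0 : Fin 2) (1 : Fin 2), fun a => rfl, ?_⟩, fun hS => ?_⟩
  · intro i a
    change Fin 2 at i
    change Fin 2 → Fin M at a
    change (if i = 0 then v (a 0) (a 1) else -v (a 0) (a 1)) =
      if Equiv.swap (0 : Fin 2) 1 i = 0 then v (f (a 1)) (f (a 0)) else -v (f (a 1)) (f (a 0))
    fin_cases i <;> simp [h]
  · have : (1 : Fin 2) = 0 := congrArg (fun π : Equiv.Perm (Fin 2) => π 0) hS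
    exact absurd this (by decide)

end MatrixGame

section SwapGame

/-- The adjacency relation of a graph, on natural numbers. -/
def FinGraph.AdjNat (G : FinGraph) (i j : ℕ) : Prop :=
  ∃ (hi : i < G.n) (hj : j < G.n), G.graph.Adj ⟨i, hi⟩ ⟨j, hj⟩

@[simp]
theorem FinGraph.adjNat_val (G : FinGraph) (i j : Fin G.n) : G.AdjNat i j ↔ G.graph.Adj i j :=
  ⟨fun ⟨_, _, h⟩ => h, fun h => ⟨i.2, j.2, h⟩⟩

open Classical in
/-- A block diagonal payoff matrix: the first block describes one graph, and the second block
describes another graph, with the opposite sign. -/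
noncomputable def swapPayoff (n₁ n₂ : ℕ) (A₁ A₂ : ℕ → ℕ → Prop) (a b : ℕ) : ℚ :=
  if a < n₁ ∧ b < n₁ then
    if a = b then 3 else if A₁ a b then 2 else 1
  else if (n₁ ≤ a ∧ a < n₁ + n₂) ∧ n₁ ≤ b ∧ b < n₁ + n₂ then
    if a = b then -3 else if A₂ (a - n₁) (b - n₁) then -2 else -1
  else 0

section Values

variable {n₁ n₂ : ℕ} {A₁ A₂ : ℕ → ℕ → Prop} {a b : ℕ}

theorem swapPayoff_eq_three : swapPayoff n₁ n₂ A₁ A₂ a b = 3 ↔ a < n₁ ∧ b = a := by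
  unfold swapPayoff
  split_ifs <;> norm_num <;> lia

theorem swapPayoff_eq_neg_three :
    swapPayoff n₁ n₂ A₁ A₂ a b = -3 ↔ (n₁ ≤ a ∧ a < n₁ + n₂) ∧ b = a := by
  unfold swapPayoff
  split_ifs <;> norm_num <;> lia

theorem swapPayoff_eq_two :
    swapPayoff n₁ n₂ A₁ A₂ a b = 2 ↔ (a < n₁ ∧ b < n₁) ∧ a ≠ b ∧ A₁ a b := by
  unfold swapPayoff
  split_ifs <;> norm_num <;> tauto

theorem swapPayoff_eq_neg_two :
    swapPayoff n₁ n₂ A₁ A₂ a b = -2 ↔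
      ((n₁ ≤ a ∧ a < n₁ + n₂) ∧ n₁ ≤ b ∧ b < n₁ + n₂) ∧ a ≠ b ∧ A₂ (a - n₁) (b - n₁) := by
  unfold swapPayoff
  split_ifs <;> norm_num <;> first | tauto | lia

end Values

/-- The payoff matrix of the game of a pair of graphs. -/
noncomputable abbrev graphPayoff (G : FinGraph × FinGraph) : ℕ → ℕ → ℚ :=
  swapPayoff G.1.n G.2.n G.1.AdjNat G.2.AdjNat

/-- The zero-sum game associated with a pair of graphs. -/
noncomputable def swapGame (G : FinGraph × FinGraph) : Game :=
  matrixGame (G.1.n + G.2.n + 1) (graphPayoff G)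

variable {G : FinGraph × FinGraph}

theorem graphPayoff_left_eq_two (i j : Fin G.1.n) :
    graphPayoff G i j = 2 ↔ G.1.graph.Adj i j := by
  simp only [graphPayoff, swapPayoff_eq_two, FinGraph.adjNat_val]
  exact ⟨fun h => h.2.2, fun h => ⟨⟨i.2, j.2⟩, Fin.val_ne_of_ne h.ne, h⟩⟩

theorem graphPayoff_right_eq_neg_two (i j : Fin G.2.n) :
    graphPayoff G (G.1.n + i) (G.1.n + j) = -2 ↔ G.2.graph.Adj i j := by
  simp only [graphPayoff, swapPayoff_eq_neg_two, Nat.add_sub_cancel_left, FinGraph.adjNat_val]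
  refine ⟨fun h => h.2.2, fun h => ⟨by lia, ?_, h⟩⟩
  have := Fin.val_ne_of_ne h.ne
  lia

/-- The entries `±3` on the diagonals of the two blocks force the actions of the first block onto
those of the second block, by the same bijection for both players. -/
theorem iso_of_graphPayoff_neg {f g : Equiv.Perm (Fin (G.1.n + G.2.n + 1))}
    (h : ∀ a b : Fin (G.1.n + G.2.n + 1), graphPayoff G (g b) (f a) = -graphPayoff G a b) :
    Nonempty (G.1.graph ≃g G.2.graph) := by
  let left (i : Fin G.1.n) : Fin (G.1.n + G.2.n + 1) := ⟨i, by lia⟩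
  let right (j : Fin G.2.n) : Fin (G.1.n + G.2.n + 1) := ⟨G.1.n + j, by lia⟩
  have hright (i : Fin G.1.n) : ∃ j, f (left i) = right j ∧ g (left i) = right j := by
    have hdiag : graphPayoff G (g (left i)) (f (left i)) = -3 := by
      rw [h, neg_inj]
      exact swapPayoff_eq_three.2 ⟨i.2, rfl⟩
    obtain ⟨hg, hfg⟩ := swapPayoff_eq_neg_three.1 hdiag
    exact ⟨⟨g (left i) - G.1.n, by lia⟩, Fin.ext (by simp only [right]; lia),
      Fin.ext (by simp only [right]; lia)⟩
  have hleft (j : Fin G.2.n) : ∃ i, f (left i) = right j := by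
    have hdiag : graphPayoff G (f.symm (right j)) (g.symm (right j)) = 3 := by
      rw [← neg_inj, ← h, f.apply_symm_apply, g.apply_symm_apply]
      exact swapPayoff_eq_neg_three.2 ⟨by simp [right], rfl⟩
    obtain ⟨hlt, -⟩ := swapPayoff_eq_three.1 hdiag
    exact ⟨⟨f.symm (right j), hlt⟩, by simp [left]⟩
  choose F hfF hgF using hright
  have hF : Function.Bijective F := by
    constructor
    · intro i i' hii
      have := f.injective ((hfF i).trans (hii ▸ (hfF i').symm))
      exact Fin.ext (by simpa [left] using this)
    · intro j
      obtain ⟨i, hi⟩ := hleft j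
      exact ⟨i, Fin.ext (by simpa [right] using (hfF i).symm.trans hi)⟩
  refine ⟨⟨.ofBijective F hF, fun {i j} => ?_⟩⟩
  have hij := h (left j) (left i)
  rw [hfF, hgF] at hij
  change G.2.graph.Adj (F i) (F j) ↔ G.1.graph.Adj i j
  rw [G.1.graph.adj_comm, ← graphPayoff_right_eq_neg_two, ← graphPayoff_left_eq_two, hij, neg_inj]

section OfIso

variable {n₁ n₂ : ℕ} (e : Fin n₁ ≃ Fin n₂)

/-- The permutation of `n₁ + n₂ + 1` actions that exchanges the two blocks along `e`. -/
def blockSwap : Equiv.Perm (Fin (n₁ + n₂ + 1)) :=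
  finSumFinEquiv.permCongr <| Equiv.sumCongr (finSumFinEquiv.permCongr <|
    (Equiv.sumComm (Fin n₁) (Fin n₂)).trans (Equiv.sumCongr e.symm e)) (Equiv.refl (Fin 1))

theorem blockSwap_left (i : Fin n₁) :
    blockSwap e (Fin.castAdd 1 (Fin.castAdd n₂ i)) = Fin.castAdd 1 (Fin.natAdd n₁ (e i)) := by
  simp [blockSwap]

theorem blockSwap_right (j : Fin n₂) :
    blockSwap e (Fin.castAdd 1 (Fin.natAdd n₁ j)) = Fin.castAdd 1 (Fin.castAdd n₂ (e.symm j)) := by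
  simp [blockSwap]

theorem blockSwap_last (k : Fin 1) :
    blockSwap e (Fin.natAdd (n₁ + n₂) k) = Fin.natAdd (n₁ + n₂) k := by
  simp [blockSwap]

theorem blockSwap_involutive : Function.Involutive (blockSwap e) := fun a => by
  induction a using Fin.addCases with
  | left a =>
    induction a using Fin.addCases with
    | left i => rw [blockSwap_left, blockSwap_right, e.symm_apply_apply]
    | right j => rw [blockSwap_right, blockSwap_left, e.apply_symm_apply]
  | right k => rw [blockSwap_last, blockSwap_last]

end OfIso

theorem graphPayoff_left (i j : Fin G.1.n) [Decidable (G.1.graph.Adj i j)] :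
    graphPayoff G i j = if i = j then 3 else if G.1.graph.Adj i j then 2 else 1 := by
  simp [graphPayoff, swapPayoff, Fin.ext_iff]

theorem graphPayoff_right (i j : Fin G.2.n) [Decidable (G.2.graph.Adj i j)] :
    graphPayoff G (G.1.n + i) (G.1.n + j) =
      -if i = j then 3 else if G.2.graph.Adj i j then 2 else 1 := by
  simp only [graphPayoff, swapPayoff, Nat.add_sub_cancel_left, FinGraph.adjNat_val, Fin.ext_iff]
  split_ifs <;> lia

theorem graphPayoff_left_right (i : Fin G.1.n) (j : ℕ) : graphPayoff G i (G.1.n + j) = 0 := by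
  simp [graphPayoff, swapPayoff]

theorem graphPayoff_right_left (i : ℕ) (j : Fin G.1.n) : graphPayoff G (G.1.n + i) j = 0 := by
  simp [graphPayoff, swapPayoff]

theorem graphPayoff_blockSwap (e : G.1.graph ≃g G.2.graph) (a b : Fin (G.1.n + G.2.n + 1)) :
    graphPayoff G (blockSwap e.toEquiv b) (blockSwap e.toEquiv a) = -graphPayoff G a b := by
  classical
  have hblocks (i j : Fin G.1.n) :
      graphPayoff G (G.1.n + e j) (G.1.n + e i) = -graphPayoff G i j := by
    rw [graphPayoff_left, graphPayoff_right]
    simp [e.map_adj_iff, G.1.graph.adj_comm, eq_comm]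
  induction a using Fin.addCases with
  | left a =>
    induction a using Fin.addCases with
    | left i =>
      induction b using Fin.addCases with
      | left b =>
        induction b using Fin.addCases with
        | left j =>
          rw [blockSwap_left, blockSwap_left]
          exact hblocks i j
        | right j => simp [blockSwap_left, blockSwap_right, graphPayoff_left_right]
      | right k => simp [blockSwap_left, blockSwap_last, swapPayoff]
    | right i =>
      induction b using Fin.addCases with
      | left b =>
        induction b using Fin.addCases with
        | left j => simp [blockSwap_left, blockSwap_right, graphPayoff_right_left]
        | right j =>
          rw [blockSwap_right, blockSwap_right]
          have := hblocks (e.symm j) (e.symm i)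
          rw [e.apply_symm_apply, e.apply_symm_apply] at this
          exact (neg_eq_iff_eq_neg.2 this).symm
      | right k => simp [blockSwap_right, blockSwap_last, swapPayoff]
  | right k =>
    induction b using Fin.addCases with
    | left b =>
      induction b using Fin.addCases with
      | left j => simp [blockSwap_left, blockSwap_last, swapPayoff]
      | right j => simp [blockSwap_right, blockSwap_last, swapPayoff]
    | right l => simp [blockSwap_last, swapPayoff]

theorem swapGame_isTwoPlayerZeroSum (G : FinGraph × FinGraph) :
    (swapGame G).IsTwoPlayerZeroSum :=
  matrixGame_isTwoPlayerZeroSum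

theorem exists_swapGame_symmetry_iff :
    (∃ S : (swapGame G).Symmetry, ¬S.PlayerSeparable) ↔ Nonempty (G.1.graph ≃g G.2.graph) := by
  constructor
  · rintro ⟨S, hS⟩
    obtain ⟨f, g, h⟩ := exists_perms_of_matrixGame_symmetry S hS
    exact iso_of_graphPayoff_neg h
  · rintro ⟨e⟩
    exact exists_matrixGame_symmetry_of_perm (blockSwap_involutive e.toEquiv)
      (graphPayoff_blockSwap e)

end SwapGame

section GraphCode

theorem flatMap_finRange {β : Type} (n : ℕ) (f : ℕ → List β) :
    (List.finRange n).flatMap (fun i : Fin n => f i.val) = (List.range n).flatMap f := by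
  rw [← List.map_coe_finRange_eq_range, List.flatMap_map]

theorem FinGraph.length_encode (G : FinGraph) : G.encode.length = G.n * (G.n + 1) := by
  simp [FinGraph.encode, encodeBits]

theorem FinGraph.count_comma_encode (G : FinGraph) : G.encode.count Γ'.comma = G.n := by
  have hbits (l : List Bool) : (encodeBits l).count Γ'.comma = 1 := by
    simp [encodeBits, List.count_eq_zero]
  simp [FinGraph.encode, List.count_flatMap, Function.comp_def, hbits]

theorem FinGraph.getElem?_block_map_encode {δ : Type} [DecidableEq δ] (G : FinGraph) {h : Γ' → δ}
    (hh : Function.Injective h) (t : List δ) {i : ℕ} (hi : i < G.n) (j : ℕ) :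
    (block (h .comma) (G.encode.map h ++ t) i)[j]? = some (h (.bit true)) ↔ G.AdjNat i j := by
  classical
  have hcode : G.encode.map h = (List.finRange G.n).flatMap fun v =>
      ((List.finRange G.n).map fun w => h (.bit (decide (G.graph.Adj v w)))) ++ [h .comma] := by
    simp [FinGraph.encode, encodeBits, List.map_flatMap, Function.comp_def]
  rw [hcode, block_flatMap _ _ (by simp [hh.eq_iff]), dif_pos (by simpa using hi)]
  by_cases hj : j < G.n
  · simp [FinGraph.AdjNat, hi, hj, hh.eq_iff]
  · simp [FinGraph.AdjNat, hj]

-- It takes precedence over the derived Boolean equality of sums, which is not known to be lawful.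
instance : BEq (Γ' ⊕ Γ') := instBEqOfDecidableEq

/-- The code of a pair of graphs. -/
noncomputable def pairCode (G : FinGraph × FinGraph) : List (Γ' ⊕ Γ') :=
  G.1.encode.map .inl ++ G.2.encode.map .inr

variable (G : FinGraph × FinGraph)

theorem count_pairCode_left : (pairCode G).count (.inl .comma) = G.1.n := by
  rw [pairCode, List.count_append, List.count_map_of_injective _ _ Sum.inl_injective,
    G.1.count_comma_encode, List.count_eq_zero_of_not_mem (by simp), add_zero]

theorem count_pairCode_right : (pairCode G).count (.inr .comma) = G.2.n := by
  rw [pairCode, List.count_append, List.count_map_of_injective _ _ Sum.inr_injective,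
    G.2.count_comma_encode, List.count_eq_zero_of_not_mem (by simp), zero_add]

/-- The adjacency relation of the first graph, read off from the code of a pair. -/
def codeAdjLeft (w : List (Γ' ⊕ Γ')) (i j : ℕ) : Prop :=
  (block (.inl .comma) w i)[j]? = some (.inl (.bit true))

/-- The adjacency relation of the second graph, read off from the code of a pair. Its code is
preceded by the `n * (n + 1)` symbols of the code of the first graph. -/
def codeAdjRight (w : List (Γ' ⊕ Γ')) (i j : ℕ) : Prop :=
  (block (.inr .comma) (w.drop (w.count (.inl .comma) * (w.count (.inl .comma) + 1))) i)[j]? =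
    some (.inr (.bit true))

theorem codeAdjLeft_pairCode {i : ℕ} (hi : i < G.1.n) (j : ℕ) :
    codeAdjLeft (pairCode G) i j ↔ G.1.AdjNat i j :=
  G.1.getElem?_block_map_encode Sum.inl_injective _ hi j

theorem codeAdjRight_pairCode {i : ℕ} (hi : i < G.2.n) (j : ℕ) :
    codeAdjRight (pairCode G) i j ↔ G.2.AdjNat i j := by
  have := G.2.getElem?_block_map_encode (Sum.inr_injective (α := Γ')) [] hi j
  rw [List.append_nil] at this
  rw [codeAdjRight, count_pairCode_left, pairCode, ← G.1.length_encode,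
    ← List.length_map (f := Sum.inl), List.drop_left, this]

end GraphCode

section MatrixGameCode

/-- The code of a two-player zero-sum game in which both players have `M` actions. -/
def matrixGameCode (M : ℕ) (v : ℕ → ℕ → ℚ) : List Γ' :=
  encodeUnary M ++ (encodeUnary M ++ ([Γ'.ket] ++
    (List.range M).flatMap fun a => (List.range M).flatMap fun b =>
      encodeUnary a ++ (encodeUnary b ++ (encodeRat (v a b) ++ (encodeRat (-v a b) ++ [Γ'.ket])))))

theorem encode_matrixGame (M : ℕ) [NeZero M] (v : ℕ → ℕ → ℚ) :
    (matrixGame M v).encode = matrixGameCode M v := by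
  have hsizes : (List.ofFn (matrixGame M v).m).flatMap encodeUnary =
      encodeUnary M ++ encodeUnary M := by
    change (List.ofFn fun _ : Fin 2 => M).flatMap encodeUnary = _
    simp
  have hrow (a : Fin 2 → Fin M) : (matrixGame M v).encodeRow a =
      encodeUnary (a 0) ++ (encodeUnary (a 1) ++
        (encodeRat (v (a 0) (a 1)) ++ (encodeRat (-v (a 0) (a 1)) ++ [Γ'.ket]))) := by
    change (List.finRange 2).flatMap (fun i => encodeUnary (a i)) ++ ((List.finRange 2).flatMap
      (fun i => encodeRat (if i = 0 then v (a 0) (a 1) else -v (a 0) (a 1))) ++ [Γ'.ket]) = _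
    simp [List.finRange_succ]
  have htable (R : (Fin 2 → Fin M) → List Γ') : (profiles 2 fun _ => M).flatMap R =
      (List.finRange M).flatMap fun a => (List.finRange M).flatMap fun b => R ![a, b] := by
    simp only [profiles, List.flatMap_assoc, List.flatMap_map, List.map_cons, List.map_nil,
      List.flatMap_cons, List.flatMap_nil, List.append_nil]
    rfl
  rw [Game.encode, hsizes, matrixGameCode, List.append_assoc]
  refine congrArg (fun l => encodeUnary M ++ (encodeUnary M ++ ([Γ'.ket] ++ l)))
    ((htable _).trans ?_)
  rw [← flatMap_finRange]
  refine congrArg (fun f => (List.finRange M).flatMap f) (funext fun a => ?_)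
  rw [← flatMap_finRange]
  exact congrArg (fun f => (List.finRange M).flatMap f) (funext fun b => hrow _)

end MatrixGameCode

section MatrixGameDefinability

variable {α X : Type} [DecidableEq α] [Context α X]

theorem DefinableWord.encodeUnary {f : X → ℕ} (hf : Definable f) :
    DefinableWord fun x => encodeUnary (f x) :=
  ((DefinableWord.flatMap (g := fun _ _ => [Γ'.bit true]) hf (.const _)).append
    (.const [Γ'.comma])).congr fun x => by
      have hbits : (List.range (f x)).flatMap (fun _ => [Γ'.bit true]) =
          List.replicate (f x) (Γ'.bit true) := by
        rw [← List.map_eq_flatMap, List.map_const', List.length_range]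
      simp [GameSym.encodeUnary, encodeBits, hbits]

/-- The rational-valued functions for which the codes of the values and of their negatives are
definable. -/
def DefinableRat (f : X → ℚ) : Prop :=
  DefinableWord (fun x => encodeRat (f x)) ∧ DefinableWord (fun x => encodeRat (-f x))

theorem DefinableRat.const (q : ℚ) : DefinableRat fun _ : X => q := ⟨.const _, .const _⟩

theorem DefinableRat.ite {p : X → Prop} [DecidablePred p] {f g : X → ℚ} (hp : DefinablePred p)
    (hf : DefinableRat f) (hg : DefinableRat g) : DefinableRat fun x => if p x then f x else g x :=
  ⟨(DefinableWord.ite hp hf.1 hg.1).congr fun x => by dsimp only; split_ifs <;> rfl,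
    (DefinableWord.ite hp hf.2 hg.2).congr fun x => by dsimp only; split_ifs <;> rfl⟩

theorem DefinableWord.matrixGameCode {M : X → ℕ} (hM : Definable M) {v : X → ℕ → ℕ → ℚ}
    (hv : DefinableRat fun y : (X × ℕ) × ℕ => v y.1.1 y.1.2 y.2) :
    DefinableWord fun x => matrixGameCode (M x) (v x) :=
  .append (.encodeUnary hM) (.append (.encodeUnary hM) (.append (.const _)
    (.flatMap hM (.flatMap hM.fst (.append (.encodeUnary Definable.snd.fst)
      (.append (.encodeUnary .snd) (.append hv.1 (.append hv.2 (.const _)))))))))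

theorem DefinableRat.swapPayoff {n₁ n₂ a b : X → ℕ} (hn₁ : Definable n₁) (hn₂ : Definable n₂)
    (ha : Definable a) (hb : Definable b) {A₁ A₂ : X → ℕ → ℕ → Prop}
    (hA₁ : DefinablePred fun x => A₁ x (a x) (b x))
    (hA₂ : DefinablePred fun x => A₂ x (a x - n₁ x) (b x - n₁ x)) :
    DefinableRat fun x => swapPayoff (n₁ x) (n₂ x) (A₁ x) (A₂ x) (a x) (b x) := by
  classical
  have hfirst {c : X → ℕ} (hc : Definable c) : DefinablePred fun x => c x < n₁ x := .lt hc hn₁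
  have hsecond {c : X → ℕ} (hc : Definable c) :
      DefinablePred fun x => n₁ x ≤ c x ∧ c x < n₁ x + n₂ x :=
    .and (.le hn₁ hc) (.lt hc (hn₁.add hn₂))
  exact .ite ((hfirst ha).and (hfirst hb))
    (.ite (.eq ha hb) (.const _) (.ite hA₁ (.const _) (.const _)))
    (.ite ((hsecond ha).and (hsecond hb))
      (.ite (.eq ha hb) (.const _) (.ite hA₂ (.const _) (.const _))) (.const _))

end MatrixGameDefinability

section Hardness

theorem swapPayoff_congr {n₁ n₂ : ℕ} {A₁ A₂ B₁ B₂ : ℕ → ℕ → Prop}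
    (h₁ : ∀ i < n₁, ∀ j, A₁ i j ↔ B₁ i j) (h₂ : ∀ i < n₂, ∀ j, A₂ i j ↔ B₂ i j) :
    swapPayoff n₁ n₂ A₁ A₂ = swapPayoff n₁ n₂ B₁ B₂ := by
  funext a b
  unfold swapPayoff
  split_ifs <;> grind

/-- The translation of the code of a pair of graphs into the code of a game. -/
noncomputable def swapGameCode (w : List (Γ' ⊕ Γ')) : List Γ' :=
  matrixGameCode (w.count (.inl .comma) + w.count (.inr .comma) + 1)
    (swapPayoff (w.count (.inl .comma)) (w.count (.inr .comma)) (codeAdjLeft w) (codeAdjRight w))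

theorem swapGameCode_pairCode (G : FinGraph × FinGraph) :
    swapGameCode (pairCode G) = (swapGame G).encode := by
  rw [swapGame, encode_matrixGame, swapGameCode, count_pairCode_left, count_pairCode_right]
  exact congrArg _ (swapPayoff_congr (fun _ hi _ => codeAdjLeft_pairCode G hi _)
    fun _ hi _ => codeAdjRight_pairCode G hi _)

theorem DefinableWord.swapGameCode : DefinableWord swapGameCode := by
  have hw : DefinableList fun w : List (Γ' ⊕ Γ') => w := .word
  have hn₁ := Definable.count hw (.inl .comma)
  have hn₂ := Definable.count hw (.inr .comma)
  have hrow : Definable fun y : (List (Γ' ⊕ Γ') × ℕ) × ℕ => y.1.2 := Definable.snd.fst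
  have hoffset := (hn₁.mul (hn₁.add (.const 1))).fst.fst
  have hadjLeft : DefinablePred fun y : (List (Γ' ⊕ Γ') × ℕ) × ℕ =>
      codeAdjLeft y.1.1 y.1.2 y.2 :=
    (hw.fst.fst.block _ hrow).get .snd _
  have hadjRight : DefinablePred fun y : (List (Γ' ⊕ Γ') × ℕ) × ℕ =>
      codeAdjRight y.1.1 (y.1.2 - y.1.1.count (.inl .comma))
        (y.2 - y.1.1.count (.inl .comma)) :=
    ((hw.fst.fst.drop hoffset).block _ (hrow.sub hn₁.fst.fst)).get (.sub .snd hn₁.fst.fst) _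
  exact .matrixGameCode ((hn₁.add hn₂).add (.const 1))
    (.swapPayoff hn₁.fst.fst hn₂.fst.fst hrow .snd hadjLeft hadjRight)

theorem zeroSum_GIHard :
    (nonPlayerSeparableSymmetry.restrict Game.IsTwoPlayerZeroSum).GIHard :=
  ⟨fun G => ⟨swapGame G, swapGame_isTwoPlayerZeroSum G⟩,
    DefinableWord.swapGameCode.computable _ _ _ swapGameCode_pairCode,
    fun _ => exists_swapGame_symmetry_iff.symm⟩

theorem nonPlayerSeparableSymmetry_GIHard : nonPlayerSeparableSymmetry.GIHard :=
  ⟨swapGame, DefinableWord.swapGameCode.computable _ _ _ swapGameCode_pairCode,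
    fun _ => exists_swapGame_symmetry_iff.symm⟩

end Hardness

/-! ### From games to graphs -/

section HubGraph

variable {V : Type} {C D : ℕ}

/-- The vertices of the hub graph: the vertices of a labelled graph, one hub for each label, and
`(c + 1) * D` leaves at the hub of the label `c`. -/
abbrev HubVertex (V : Type) (C D : ℕ) : Type := V ⊕ Fin C ⊕ Σ c : Fin C, Fin ((c + 1) * D)

/-- The edges of the hub graph, in one direction. -/
def hubRel (G : SimpleGraph V) (L : V → ℕ → Prop) : HubVertex V C D → HubVertex V C D → Prop
  | .inl v, .inl w => G.Adj v w
  | .inl v, .inr (.inl c) => L v c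
  | .inr (.inl c), .inr (.inr l) => c = l.1
  | _, _ => False

/-- A graph that represents a labelled graph, where `L v c` says that `v` has the label `c`: a
vertex is adjacent to the hubs of its labels, and hubs are recognized by their degrees. -/
def hubGraph (C D : ℕ) (G : SimpleGraph V) (L : V → ℕ → Prop) : SimpleGraph (HubVertex V C D) :=
  SimpleGraph.fromRel (hubRel G L)

variable {G G' : SimpleGraph V} {L L' : V → ℕ → Prop}

theorem hubGraph_adj_base {v w : V} :
    (hubGraph C D G L).Adj (.inl v) (.inl w) ↔ G.Adj v w := by
  simp only [hubGraph, SimpleGraph.fromRel_adj, hubRel, G.adj_comm w v, or_self, ne_eq,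
    Sum.inl.injEq, and_iff_right_iff_imp]
  exact fun h => h.ne

theorem hubGraph_adj_hub {v : V} {c : Fin C} :
    (hubGraph C D G L).Adj (.inl v) (.inr (.inl c)) ↔ L v c := by
  simp [hubGraph, SimpleGraph.fromRel_adj, hubRel]

theorem hubGraph_adj_leaf {c : Fin C} {l : Σ c : Fin C, Fin ((c + 1) * D)} :
    (hubGraph C D G L).Adj (.inr (.inl c)) (.inr (.inr l)) ↔ c = l.1 := by
  simp [hubGraph, SimpleGraph.fromRel_adj, hubRel]

theorem card_le_of_subset_range {A Z : Type} [Finite Z] {s : Set A} (f : Z → A)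
    (h : s ⊆ Set.range f) : Nat.card s ≤ Nat.card Z :=
  (Nat.card_mono (Set.finite_range f) h).trans (Finite.card_range_le f)

theorem hubGraph_card_neighborSet_leaf_le (l : Σ c : Fin C, Fin ((c + 1) * D)) :
    Nat.card ((hubGraph C D G L).neighborSet (.inr (.inr l))) ≤ 1 := by
  refine (card_le_of_subset_range (fun _ : Unit => .inr (.inl l.1)) ?_).trans (by simp)
  rintro (v | c | l') h
  · simp [hubGraph, SimpleGraph.fromRel_adj, hubRel] at h
  · exact ⟨(), by rw [hubGraph_adj_leaf.1 h.symm]⟩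
  · simp [hubGraph, SimpleGraph.fromRel_adj, hubRel] at h

theorem card_neighborSet_hubGraph_iso (φ : hubGraph C D G L ≃g hubGraph C D G' L')
    (x : HubVertex V C D) :
    Nat.card ((hubGraph C D G' L').neighborSet (φ x)) =
      Nat.card ((hubGraph C D G L).neighborSet x) :=
  (Nat.card_congr (φ.mapNeighborSet x)).symm

theorem hubGraph_iso_of_labelled_iso (σ : G ≃g G') (hσ : ∀ v, ∀ c < C, L v c ↔ L' (σ v) c) :
    Nonempty (hubGraph C D G L ≃g hubGraph C D G' L') := by
  let e : HubVertex V C D ≃ HubVertex V C D := σ.toEquiv.sumCongr (.refl _)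
  have hrel (x y : HubVertex V C D) : hubRel G' L' (e x) (e y) ↔ hubRel G L x y := by
    obtain v | c | l := x <;> obtain w | c' | l' := y
    case inl.inl => exact σ.map_adj_iff
    case inl.inr.inl => exact (hσ v c' c'.is_lt).symm
    all_goals exact Iff.rfl
  refine ⟨⟨e, fun {x y} => ?_⟩⟩
  simp only [hubGraph, SimpleGraph.fromRel_adj, hrel, ne_eq, EmbeddingLike.apply_eq_iff_eq]

variable [Finite V]

theorem two_le_hubGraph_card_neighborSet_base (hC : 1 < C) (h0 : ∀ v, L v 0) (h1 : ∀ v, L v 1)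
    (v : V) : 2 ≤ Nat.card ((hubGraph C D G L).neighborSet (.inl v)) := by
  let hub (t : Fin 2) : (hubGraph C D G L).neighborSet (.inl v) :=
    ⟨.inr (.inl (Fin.castLE hC t)), hubGraph_adj_hub.2 (by fin_cases t <;> simp [h0, h1])⟩
  have hinj : Function.Injective hub := fun t t' h =>
    Fin.castLE_injective hC (by simpa [hub] using congrArg Subtype.val h)
  simpa using Nat.card_le_card_of_injective hub hinj

theorem hubGraph_card_neighborSet_base_lt (hD : Nat.card V + C < D) (v : V) :
    Nat.card ((hubGraph C D G L).neighborSet (.inl v)) < D := by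
  refine lt_of_le_of_lt ?_ hD
  refine (card_le_of_subset_range (Sum.map id .inl : V ⊕ Fin C → HubVertex V C D) ?_).trans
    (by simp [Nat.card_sum])
  rintro (w | c | l) h
  · exact ⟨.inl w, rfl⟩
  · exact ⟨.inr c, rfl⟩
  · simp [hubGraph, SimpleGraph.fromRel_adj, hubRel] at h

theorem le_hubGraph_card_neighborSet_hub (c : Fin C) :
    (c + 1) * D ≤ Nat.card ((hubGraph C D G L).neighborSet (.inr (.inl c))) := by
  rw [← Nat.card_fin ((c + 1) * D)]
  refine Nat.card_le_card_of_injective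
    (fun t => ⟨.inr (.inr ⟨c, t⟩), hubGraph_adj_leaf.2 rfl⟩) fun t t' h => ?_
  simpa using congrArg Subtype.val h

theorem hubGraph_card_neighborSet_hub_lt (hD : Nat.card V + C < D) (c : Fin C) :
    Nat.card ((hubGraph C D G L).neighborSet (.inr (.inl c))) < (c + 2) * D := by
  refine lt_of_le_of_lt (b := Nat.card V + (c + 1) * D) ?_ (by nlinarith)
  refine (card_le_of_subset_range (Sum.map id (fun t => .inr ⟨c, t⟩) :
    V ⊕ Fin ((c + 1) * D) → HubVertex V C D) ?_).trans (by simp [Nat.card_sum])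
  rintro (w | c' | ⟨c', t⟩) h
  · exact ⟨.inl w, rfl⟩
  · simp [hubGraph, SimpleGraph.fromRel_adj, hubRel] at h
  · obtain rfl : c = c' := hubGraph_adj_leaf.1 h
    exact ⟨.inr t, rfl⟩

theorem le_hubGraph_card_neighborSet_hub' (c : Fin C) :
    D ≤ Nat.card ((hubGraph C D G L).neighborSet (.inr (.inl c))) :=
  (Nat.le_mul_of_pos_left D c.val.succ_pos).trans (le_hubGraph_card_neighborSet_hub c)

theorem hubGraph_iso_apply_hub (φ : hubGraph C D G L ≃g hubGraph C D G' L') (hC : 1 < C)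
    (hD : Nat.card V + C < D) (c : Fin C) : φ (.inr (.inl c)) = .inr (.inl c) := by
  have hcard := card_neighborSet_hubGraph_iso φ (.inr (.inl c))
  have hle := le_hubGraph_card_neighborSet_hub (D := D) (G := G) (L := L) c
  have hlt := hubGraph_card_neighborSet_hub_lt (G := G) (L := L) hD c
  have hleD := le_hubGraph_card_neighborSet_hub' (D := D) (G := G) (L := L) c
  generalize φ (.inr (.inl c)) = y at hcard ⊢
  obtain v | c' | l := y
  · exact absurd (hubGraph_card_neighborSet_base_lt (G := G') (L := L') hD v) (by lia)
  · have hle' := le_hubGraph_card_neighborSet_hub (D := D) (G := G') (L := L') c'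
    have hlt' := hubGraph_card_neighborSet_hub_lt (G := G') (L := L') hD c'
    rw [hcard] at hle' hlt'
    have h₁ := Nat.lt_of_mul_lt_mul_right (hle.trans_lt hlt')
    have h₂ := Nat.lt_of_mul_lt_mul_right (hle'.trans_lt hlt)
    rw [show c' = c from Fin.ext (by lia)]
  · exact absurd (hubGraph_card_neighborSet_leaf_le (D := D) (G := G') (L := L') l) (by lia)

theorem hubGraph_iso_apply_base (φ : hubGraph C D G L ≃g hubGraph C D G' L') (hC : 1 < C)
    (hD : Nat.card V + C < D) (h0 : ∀ v, L v 0) (h1 : ∀ v, L v 1) (v : V) :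
    ∃ w, φ (.inl v) = .inl w := by
  have hcard := card_neighborSet_hubGraph_iso φ (.inl v)
  have hle := two_le_hubGraph_card_neighborSet_base (D := D) (G := G) hC h0 h1 v
  have hlt := hubGraph_card_neighborSet_base_lt (G := G) (L := L) hD v
  generalize φ (.inl v) = y at hcard ⊢
  obtain w | c | l := y
  · exact ⟨w, rfl⟩
  · exact absurd (le_hubGraph_card_neighborSet_hub' (D := D) (G := G') (L := L') c) (by lia)
  · exact absurd (hubGraph_card_neighborSet_leaf_le (D := D) (G := G') (L := L') l) (by lia)

theorem exists_labelled_iso_of_hubGraph_iso (φ : hubGraph C D G L ≃g hubGraph C D G' L')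
    (hC : 1 < C) (hD : Nat.card V + C < D) (h0 : ∀ v, L v 0) (h1 : ∀ v, L v 1) :
    ∃ σ : G ≃g G', ∀ v, ∀ c < C, L v c ↔ L' (σ v) c := by
  choose σ hσ using hubGraph_iso_apply_base φ hC hD h0 h1
  have hinj : Function.Injective σ := fun v w h =>
    Sum.inl_injective (φ.injective (by rw [hσ, hσ, h]))
  refine ⟨⟨.ofBijective σ (Finite.injective_iff_bijective.1 hinj), fun {v w} => ?_⟩,
    fun v c hc => ?_⟩
  · rw [← hubGraph_adj_base (C := C) (D := D) (G := G) (L := L), ← φ.map_adj_iff, hσ, hσ,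
      hubGraph_adj_base]
    rfl
  · rw [← hubGraph_adj_hub (C := C) (D := D) (G := G) (L := L) (c := ⟨c, hc⟩),
      ← φ.map_adj_iff, hσ, hubGraph_iso_apply_hub φ hC hD, hubGraph_adj_hub]
    rfl

theorem hubGraph_iso_iff (hC : 1 < C) (hD : Nat.card V + C < D) (h0 : ∀ v, L v 0)
    (h1 : ∀ v, L v 1) :
    Nonempty (hubGraph C D G L ≃g hubGraph C D G' L') ↔
      ∃ σ : G ≃g G', ∀ v, ∀ c < C, L v c ↔ L' (σ v) c :=
  ⟨fun ⟨φ⟩ => exists_labelled_iso_of_hubGraph_iso φ hC hD h0 h1,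
    fun ⟨σ, hσ⟩ => hubGraph_iso_of_labelled_iso σ hσ⟩

end HubGraph

section Ladder

variable {X : Type} {K M : ℕ}

/-- The vertices of the ladder: two nodes on each of `K + 1` levels, and for each pair of nodes on
consecutive levels a copy of `X`. -/
abbrev LadderVertex (K : ℕ) (X : Type) : Type := (Fin (K + 1) × Bool) ⊕ (Fin K × Bool × Bool × X)

/-- The edges of the ladder, in one direction: every copy of the base graph is joined to its two
nodes. -/
def ladderRel (B : SimpleGraph X) : LadderVertex K X → LadderVertex K X → Prop
  | .inl (k, s), .inr (l, s', t', _) => (k.val = l.val ∧ s = s') ∨ (k.val = l.val + 1 ∧ s = t')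
  | .inr (k, s, t, x), .inr (k', s', t', y) => k = k' ∧ s = s' ∧ t = t' ∧ B.Adj x y
  | _, _ => False

/-- The ladder over a base graph. -/
def ladderGraph (K : ℕ) (B : SimpleGraph X) : SimpleGraph (LadderVertex K X) :=
  SimpleGraph.fromRel (ladderRel B)

/-- The labels of the ladder over a base graph with labels `L`: `2` for the nodes, `3` for one node
of the first level, `4` for the node on the side `ε` of the last level, `6 + k` for the level `k`,
and `5` for the vertices marked by `mark k false` in the copies between nodes on the same side and
for those marked by `mark k true` in the copies between nodes on different sides. All vertices have
the labels `0` and `1`. -/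
def ladderLabel (K : ℕ) (mark : ℕ → Bool → X → Prop) (L : X → ℕ → Prop) (ε : Bool) :
    LadderVertex K X → ℕ → Prop
  | .inl (k, s), c => c = 0 ∨ c = 1 ∨ c = 2 ∨ (c = 3 ∧ k.val = 0 ∧ s = false) ∨
      (c = 4 ∧ k.val = K ∧ s = ε) ∨ c = 6 + k.val
  | .inr (k, s, t, x), c => c = 0 ∨ c = 1 ∨ (c = 5 ∧ mark k (s != t) x) ∨ c = 6 + k.val ∨
      ∃ d, c = 7 + K + d ∧ L x d

variable {B : SimpleGraph X} {mark : ℕ → Bool → X → Prop} {L : X → ℕ → Prop} {ε : Bool}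

theorem ladderGraph_adj_node {k : Fin (K + 1)} {s : Bool} {l : Fin K} {s' t' : Bool} {x : X} :
    (ladderGraph K B).Adj (.inl (k, s)) (.inr (l, s', t', x)) ↔
      (k.val = l.val ∧ s = s') ∨ (k.val = l.val + 1 ∧ s = t') := by
  simp [ladderGraph, SimpleGraph.fromRel_adj, ladderRel]

theorem ladderGraph_adj_copy {k : Fin K} {s t : Bool} {x y : X} :
    (ladderGraph K B).Adj (.inr (k, s, t, x)) (.inr (k, s, t, y)) ↔ B.Adj x y := by
  simp only [ladderGraph, SimpleGraph.fromRel_adj, ladderRel, B.adj_comm y x, or_self, ne_eq,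
    Sum.inr.injEq, Prod.mk.injEq, true_and, and_iff_right_iff_imp]
  exact fun h => h.ne

theorem ladderLabel_two {v : LadderVertex K X} :
    ladderLabel K mark L ε v 2 ↔ ∃ k s, v = .inl (k, s) := by
  obtain ⟨k, s⟩ | ⟨k, s, t, x⟩ := v
  · simp [ladderLabel]
  · simp only [ladderLabel, reduceCtorEq, exists_const, iff_false]
    rintro (h | h | h | h | ⟨d, h, -⟩) <;> lia

theorem ladderLabel_three {k : Fin (K + 1)} {s : Bool} :
    ladderLabel K mark L ε (.inl (k, s)) 3 ↔ k.val = 0 ∧ s = false := by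
  simp only [ladderLabel]
  lia

theorem ladderLabel_four {k : Fin (K + 1)} {s : Bool} :
    ladderLabel K mark L ε (.inl (k, s)) 4 ↔ k.val = K ∧ s = ε := by
  simp only [ladderLabel]
  lia

theorem ladderLabel_mark {k : Fin K} {s t : Bool} {x : X} :
    ladderLabel K mark L ε (.inr (k, s, t, x)) 5 ↔ mark k (s != t) x := by
  refine ⟨?_, fun h => .inr (.inr (.inl ⟨rfl, h⟩))⟩
  rintro (h | h | h | h | ⟨d, h, -⟩)
  exacts [by lia, by lia, h.2, by lia, by lia]

theorem ladderLabel_level_node {k : Fin (K + 1)} {s : Bool} {j : ℕ} :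
    ladderLabel K mark L ε (.inl (k, s)) (6 + j) ↔ j = k.val := by
  simp only [ladderLabel]
  lia

theorem ladderLabel_level_copy {k : Fin K} {s t : Bool} {x : X} {j : ℕ} (hj : j ≤ K) :
    ladderLabel K mark L ε (.inr (k, s, t, x)) (6 + j) ↔ j = k.val := by
  refine ⟨?_, fun h => .inr (.inr (.inr (.inl (by rw [h]))))⟩
  rintro (h | h | h | h | ⟨d, h, -⟩) <;> lia

theorem ladderLabel_base {k : Fin K} {s t : Bool} {x : X} {d : ℕ} :
    ladderLabel K mark L ε (.inr (k, s, t, x)) (7 + K + d) ↔ L x d := by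
  refine ⟨?_, fun h => .inr (.inr (.inr (.inr ⟨d, rfl, h⟩)))⟩
  rintro (h | h | h | h | ⟨d', h, hd'⟩)
  exacts [by lia, by lia, by lia, by lia, by rwa [show d = d' by lia]]

section OfIso

variable {σ : ladderGraph K B ≃g ladderGraph K B}

theorem ladder_iso_apply_node
    (hσ : ∀ v, ∀ c < 7 + K, ladderLabel K mark L false v c ↔ ladderLabel K mark L true (σ v) c)
    (k : Fin (K + 1)) (s : Bool) : ∃ s', σ (.inl (k, s)) = .inl (k, s') := by
  obtain ⟨k', s', h⟩ := ladderLabel_two.1 ((hσ (.inl (k, s)) 2 (by lia)).1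
    (ladderLabel_two.2 ⟨k, s, rfl⟩))
  have hlevel := (hσ (.inl (k, s)) (6 + k) (by lia)).1 (ladderLabel_level_node.2 rfl)
  rw [h, ladderLabel_level_node] at hlevel
  obtain rfl : k = k' := Fin.ext hlevel
  exact ⟨s', h⟩

theorem exists_castSucc_false_succ_true {g : Fin (K + 1) → Bool} (h0 : g 0 = false)
    (hK : g (Fin.last K) = true) : ∃ k : Fin K, g k.castSucc = false ∧ g k.succ = true := by
  by_contra! hg
  have hfalse (k : Fin (K + 1)) : g k = false := by
    induction k using Fin.induction with
    | zero => exact h0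
    | succ i ih => simpa using hg i ih
  simp [hfalse] at hK

-- The labels `3` and `4` force the automorphism to fix a node of the first level and to move one of
-- the last level to the other side, so that it changes sides somewhere in between.
theorem exists_switch_of_ladder_iso
    (hσ : ∀ v, ∀ c < 7 + K, ladderLabel K mark L false v c ↔ ladderLabel K mark L true (σ v) c) :
    ∃ k : Fin K, σ (.inl (k.castSucc, false)) = .inl (k.castSucc, false) ∧
      σ (.inl (k.succ, false)) = .inl (k.succ, true) := by
  choose g hg using ladder_iso_apply_node hσ
  have h0 : g 0 false = false := by
    have h := (hσ (.inl (0, false)) 3 (by lia)).1 (ladderLabel_three.2 ⟨rfl, rfl⟩)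
    rw [hg] at h
    exact (ladderLabel_three.1 h).2
  have hK : g (Fin.last K) false = true := by
    have h := (hσ (.inl (Fin.last K, false)) 4 (by lia)).1 (ladderLabel_four.2 ⟨rfl, rfl⟩)
    rw [hg] at h
    exact (ladderLabel_four.1 h).2
  obtain ⟨k, hk, hk'⟩ := exists_castSucc_false_succ_true (g := (g · false)) h0 hK
  exact ⟨k, by rw [hg, hk], by rw [hg, hk']⟩

theorem ladder_iso_apply_copy
    (hσ : ∀ v, ∀ c < 7 + K, ladderLabel K mark L false v c ↔ ladderLabel K mark L true (σ v) c)
    {k : Fin K} (hk : σ (.inl (k.castSucc, false)) = .inl (k.castSucc, false))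
    (hk' : σ (.inl (k.succ, false)) = .inl (k.succ, true)) (x : X) :
    ∃ y, σ (.inr (k, false, false, x)) = .inr (k, false, true, y) := by
  have hcopy := (hσ (.inr (k, false, false, x)) 2 (by lia)).not.1
    (by rw [ladderLabel_two]; simp)
  have hlevel := (hσ (.inr (k, false, false, x)) (6 + k) (by lia)).1
    ((ladderLabel_level_copy (by lia)).2 rfl)
  have hlower := (σ.map_adj_iff (v := .inl (k.castSucc, false))
    (w := .inr (k, false, false, x))).2 (ladderGraph_adj_node.2 (.inl ⟨rfl, rfl⟩))
  have hupper := (σ.map_adj_iff (v := .inl (k.succ, false))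
    (w := .inr (k, false, false, x))).2 (ladderGraph_adj_node.2 (.inr ⟨rfl, rfl⟩))
  rw [hk] at hlower
  rw [hk'] at hupper
  generalize σ (.inr (k, false, false, x)) = z at hcopy hlevel hlower hupper ⊢
  obtain ⟨k', s'⟩ | ⟨k', s', t', y⟩ := z
  · exact absurd (ladderLabel_two.2 ⟨_, _, rfl⟩) hcopy
  · obtain rfl : k = k' := Fin.ext ((ladderLabel_level_copy (by lia)).1 hlevel)
    obtain rfl : false = s' := by simpa using ladderGraph_adj_node.1 hlower
    obtain rfl : true = t' := by simpa using ladderGraph_adj_node.1 hupper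
    exact ⟨y, rfl⟩

theorem exists_marked_iso_of_ladder_iso [Finite X]
    (hσ : ∀ v, ∀ c < 7 + K + M,
      ladderLabel K mark L false v c ↔ ladderLabel K mark L true (σ v) c) :
    ∃ k < K, ∃ τ : B ≃g B, (∀ x, ∀ d < M, L x d ↔ L (τ x) d) ∧
      ∀ x, mark k false x ↔ mark k true (τ x) := by
  have hσ' v c (hc : c < 7 + K) := hσ v c (by lia)
  obtain ⟨k, hk, hk'⟩ := exists_switch_of_ladder_iso hσ'
  choose τ hτ using ladder_iso_apply_copy hσ' hk hk'
  have hinj : Function.Injective τ := fun x y h => by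
    have h' : σ (.inr (k, false, false, x)) = σ (.inr (k, false, false, y)) := by rw [hτ, hτ, h]
    simpa using h'
  refine ⟨k, k.2, ⟨.ofBijective τ (Finite.injective_iff_bijective.1 hinj), fun {x y} => ?_⟩,
    fun x d hd => ?_, fun x => ?_⟩
  · have h := σ.map_adj_iff (v := .inr (k, false, false, x)) (w := .inr (k, false, false, y))
    rwa [hτ, hτ, ladderGraph_adj_copy, ladderGraph_adj_copy] at h
  · have h := hσ (.inr (k, false, false, x)) (7 + K + d) (by lia)
    rwa [hτ, ladderLabel_base, ladderLabel_base] at h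
  · have h := hσ (.inr (k, false, false, x)) 5 (by lia)
    rwa [hτ, ladderLabel_mark, ladderLabel_mark] at h

end OfIso

/-- The map `τ` or its inverse on a copy of level `k`, the identity on the other copies. -/
def copyFlip (k : ℕ) (τ : X ≃ X) (j : ℕ) (s t : Bool) (x : X) : X :=
  if j = k then (if s = t then τ x else τ.symm x) else x

/-- The vertex map of the ladder that exchanges the two sides above level `k`. -/
def ladderFlip (k : ℕ) (τ : X ≃ X) : LadderVertex K X → LadderVertex K X
  | .inl (j, s) => .inl (j, s ^^ decide (k < j.val))
  | .inr (j, s, t, x) =>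
      .inr (j, s ^^ decide (k < j.val), t ^^ decide (k < j.val + 1), copyFlip k τ j s t x)

theorem ladderFlip_ladderFlip (k : ℕ) (τ : X ≃ X) (v : LadderVertex K X) :
    ladderFlip k τ (ladderFlip k τ v) = v := by
  obtain ⟨j, s⟩ | ⟨j, s, t, x⟩ := v
  · simp [ladderFlip]
  · by_cases h : j.val = k
    · subst h
      cases s <;> cases t <;> simp [ladderFlip, copyFlip]
    · simp [ladderFlip, copyFlip, h]

theorem ladderRel_ladderFlip (k : ℕ) (τ : B ≃g B) {v w : LadderVertex K X}
    (h : ladderRel B v w) : ladderRel B (ladderFlip k τ.toEquiv v) (ladderFlip k τ.toEquiv w) := by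
  obtain ⟨j, s⟩ | ⟨j, s, t, x⟩ := v <;> obtain ⟨j', s'⟩ | ⟨j', s', t', y⟩ := w
  · exact h
  · obtain ⟨h, rfl⟩ | ⟨h, rfl⟩ := h
    · exact .inl ⟨h, by rw [h]⟩
    · exact .inr ⟨h, by rw [h]⟩
  · exact h
  · obtain ⟨rfl, rfl, rfl, h⟩ := h
    refine ⟨rfl, rfl, rfl, ?_⟩
    unfold copyFlip
    split_ifs
    exacts [τ.map_adj_iff.2 h, τ.symm.map_adj_iff.2 h, h]

/-- The automorphism of the ladder that exchanges the two sides above level `k`. -/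
def ladderFlipIso (K k : ℕ) (τ : B ≃g B) : ladderGraph K B ≃g ladderGraph K B where
  toFun := ladderFlip k τ.toEquiv
  invFun := ladderFlip k τ.toEquiv
  left_inv := ladderFlip_ladderFlip k τ.toEquiv
  right_inv := ladderFlip_ladderFlip k τ.toEquiv
  map_rel_iff' := fun {v w} => by
    have hrel (v w : LadderVertex K X) :
        ladderRel B (ladderFlip k τ.toEquiv v) (ladderFlip k τ.toEquiv w) ↔ ladderRel B v w :=
      ⟨fun h => by simpa only [ladderFlip_ladderFlip] using ladderRel_ladderFlip k τ h,
        ladderRel_ladderFlip k τ⟩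
    simp only [ladderGraph, SimpleGraph.fromRel_adj, Equiv.coe_fn_mk, hrel, ne_eq,
      (Function.LeftInverse.injective (ladderFlip_ladderFlip k τ.toEquiv)).eq_iff]

section Flip

variable {k : ℕ} {τ : X ≃ X}

theorem ladderLabel_ladderFlip_node (hk : k < K) (j : Fin (K + 1)) (s : Bool) (c : ℕ) :
    ladderLabel K mark L false (.inl (j, s)) c ↔
      ladderLabel K mark L true (ladderFlip k τ (.inl (j, s))) c := by
  have hfirst : (j.val = 0 ∧ s = false) ↔ (j.val = 0 ∧ (s ^^ decide (k < j.val)) = false) :=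
    and_congr_right fun h => by simp [h]
  have hlast : (j.val = K ∧ s = false) ↔ (j.val = K ∧ (s ^^ decide (k < j.val)) = true) :=
    and_congr_right fun h => by simp [h, hk]
  simp only [ladderLabel, ladderFlip, hfirst, hlast]

theorem mark_copyFlip (hτ : ∀ x, mark k false x ↔ mark k true (τ x)) (j : ℕ) (s t : Bool) (x : X) :
    mark j (s != t) x ↔
      mark j ((s ^^ decide (k < j)) != (t ^^ decide (k < j + 1))) (copyFlip k τ j s t x) := by
  by_cases h : j = k
  · have hτ' : mark k true x ↔ mark k false (τ.symm x) := by
      rw [hτ (τ.symm x), τ.apply_symm_apply]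
    rw [h]
    cases s <;> cases t <;> first | simpa [copyFlip] using hτ x | simpa [copyFlip] using hτ'
  · have hlt : k < j + 1 ↔ k < j := by lia
    cases s <;> cases t <;> cases hkj : decide (k < j) <;> simp [copyFlip, h, hlt, hkj]

theorem label_copyFlip (hτ : ∀ x, ∀ d < M, L x d ↔ L (τ x) d) (j : ℕ) (s t : Bool) (x : X) {d : ℕ}
    (hd : d < M) : L x d ↔ L (copyFlip k τ j s t x) d := by
  unfold copyFlip
  split_ifs
  exacts [hτ x d hd, by rw [hτ (τ.symm x) d hd, τ.apply_symm_apply], Iff.rfl]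

theorem ladderLabel_ladderFlip_copy (hL : ∀ x, ∀ d < M, L x d ↔ L (τ x) d)
    (hmark : ∀ x, mark k false x ↔ mark k true (τ x)) (j : Fin K) (s t : Bool) (x : X) {c : ℕ}
    (hc : c < 7 + K + M) :
    ladderLabel K mark L false (.inr (j, s, t, x)) c ↔
      ladderLabel K mark L true (ladderFlip k τ (.inr (j, s, t, x))) c := by
  have hbase : (∃ d, c = 7 + K + d ∧ L x d) ↔ ∃ d, c = 7 + K + d ∧ L (copyFlip k τ j s t x) d :=
    exists_congr fun d => and_congr_right fun h => label_copyFlip hL j s t x (by lia)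
  simp only [ladderLabel, ladderFlip, mark_copyFlip hmark j s t x, hbase]

end Flip

theorem exists_ladder_iso {k : ℕ} (hk : k < K) (τ : B ≃g B)
    (hL : ∀ x, ∀ d < M, L x d ↔ L (τ x) d) (hmark : ∀ x, mark k false x ↔ mark k true (τ x)) :
    ∃ σ : ladderGraph K B ≃g ladderGraph K B, ∀ v, ∀ c < 7 + K + M,
      ladderLabel K mark L false v c ↔ ladderLabel K mark L true (σ v) c := by
  refine ⟨ladderFlipIso K k τ, ?_⟩
  rintro (⟨j, s⟩ | ⟨j, s, t, x⟩) c hc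
  · exact ladderLabel_ladderFlip_node (τ := τ.toEquiv) hk j s c
  · exact ladderLabel_ladderFlip_copy hL hmark j s t x hc

end Ladder

section GameGraph

variable {Γ : Game}

/-- The vertices of the graph of a game: the actions, and one entry for each player in each row of
the payoff table. -/
abbrev Game.Vertex (Γ : Game) : Type := Γ.Action ⊕ (Γ.Profile × Fin Γ.N)

/-- The adjacency relation of the graph of a game. -/
def Game.Adj (Γ : Game) : Γ.Vertex → Γ.Vertex → Prop
  | .inl a, .inl b => a.1 = b.1 ∧ a ≠ b
  | .inl a, .inr e => a = ⟨e.2, e.1 e.2⟩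
  | .inr e, .inl a => a = ⟨e.2, e.1 e.2⟩
  | .inr e, .inr e' => e.1 = e'.1 ∧ e.2 ≠ e'.2

/-- The graph of a game: the actions of a player form a clique, the entries of a row form a clique,
and every entry is adjacent to the action that its player takes in its row. -/
def Game.graph (Γ : Game) : SimpleGraph Γ.Vertex where
  Adj := Γ.Adj
  symm := ⟨by
    rintro (a | e) (b | e') h
    exacts [⟨h.1.symm, h.2.symm⟩, h, h, ⟨h.1.symm, h.2.symm⟩]⟩
  loopless := ⟨by rintro (a | e) h <;> exact h.2 rfl⟩

/-- The labels of the graph of a game: actions have the label `0`, and an entry `e` has the labels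
`q + 1` for `Q e q`. -/
def Game.label (Q : Γ.Profile × Fin Γ.N → ℕ → Prop) : Γ.Vertex → ℕ → Prop
  | .inl _, d => d = 0
  | .inr e, d => ∃ q, d = q + 1 ∧ Q e q

/-- The predicates `Q e q` for `q < M` tell exactly which entries have the same payoff. -/
def Game.SeparatesPayoffs (Γ : Game) (M : ℕ) (Q : Γ.Profile × Fin Γ.N → ℕ → Prop) : Prop :=
  ∀ e e', (∀ q < M, Q e q ↔ Q e' q) ↔ Γ.u e.2 e.1 = Γ.u e'.2 e'.1

/-- For `k = i * N + j`, the actions of player `i`, or the actions of player `j` if `j ≠ i`. -/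
def Game.mark (k : ℕ) : Bool → Γ.Vertex → Prop
  | false, .inl a => ∃ j < Γ.N, k = a.1 * Γ.N + j
  | true, .inl a => ∃ i < Γ.N, k = i * Γ.N + a.1 ∧ i ≠ a.1
  | _, .inr _ => False

theorem mul_add_inj {N i j i' j' : ℕ} (hj : j < N) (hj' : j' < N)
    (h : i * N + j = i' * N + j') : i = i' ∧ j = j' := by
  have hdiv (a b : ℕ) (hb : b < N) : (a * N + b) / N = a := by
    rw [Nat.mul_comm, Nat.mul_add_div (by lia), Nat.div_eq_of_lt hb, add_zero]
  obtain rfl : i = i' := by rw [← hdiv i j hj, h, hdiv i' j' hj']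
  exact ⟨rfl, by lia⟩

theorem Game.mark_false_iff {i j : Fin Γ.N} {a : Γ.Action} :
    Game.mark (i * Γ.N + j) false (.inl a) ↔ a.1 = i :=
  ⟨fun ⟨_, hl, h⟩ => (Fin.ext (mul_add_inj j.2 hl h).1).symm, fun h => ⟨j, j.2, by rw [h]⟩⟩

theorem Game.mark_true_iff {i j : Fin Γ.N} {a : Γ.Action} :
    Game.mark (i * Γ.N + j) true (.inl a) ↔ a.1 = j ∧ i ≠ j := by
  constructor
  · rintro ⟨l, -, h, hne⟩
    obtain ⟨rfl, hja⟩ := mul_add_inj j.2 a.1.2 h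
    exact ⟨(Fin.ext hja).symm, fun hij => hne (by rw [hij, hja])⟩
  · rintro ⟨rfl, hne⟩
    exact ⟨i, i.2, rfl, fun h => hne (Fin.ext h)⟩

instance : Finite Γ.Vertex := by unfold Game.Vertex Game.Action Game.Profile; infer_instance

theorem Game.Action.eq_mk {x : Γ.Action} {j : Fin Γ.N} (h : x.1 = j) :
    x = ⟨j, Fin.cast (congrArg Γ.m h) x.2⟩ := by
  subst h
  rfl

theorem Game.Action.cast_snd_eq {x : Γ.Action} {j : Fin Γ.N} {y : Fin (Γ.m j)} (h : x = ⟨j, y⟩)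
    (hm : Γ.m x.1 = Γ.m j) : Fin.cast hm x.2 = y := by
  subst h
  rfl

section OfSymmetry

variable (S : Γ.Symmetry)

/-- The profile that a symmetry assigns to a profile. -/
def Game.Symmetry.mapProfile (a : Γ.Profile) : Γ.Profile := fun j =>
  Fin.cast (congrArg Γ.m ((S.map_player _).trans (S.π.apply_symm_apply j)))
    (S.φ ⟨S.π.symm j, a (S.π.symm j)⟩).2

theorem Game.Symmetry.apply_profile (a : Γ.Profile) (i : Fin Γ.N) :
    S.φ ⟨i, a i⟩ = ⟨S.π i, S.mapProfile a (S.π i)⟩ := by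
  obtain ⟨j, rfl⟩ := S.π.symm.surjective i
  rw [S.π.apply_symm_apply]
  exact Game.Action.eq_mk ((S.map_player _).trans (S.π.apply_symm_apply j))

theorem Game.Symmetry.mapProfile_injective : Function.Injective S.mapProfile := fun a b h => by
  funext i
  have hi := S.apply_profile a i
  rw [h, ← S.apply_profile b i] at hi
  simpa using hi

/-- The graph automorphism of a symmetry. -/
noncomputable def Game.Symmetry.graphIso : Γ.graph ≃g Γ.graph where
  toEquiv := S.φ.sumCongr
    ((Equiv.ofBijective _ (Finite.injective_iff_bijective.1 S.mapProfile_injective)).prodCongr S.π)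
  map_rel_iff' := by
    have hentry (a : Γ.Action) (e : Γ.Profile × Fin Γ.N) :
        S.φ a = ⟨S.π e.2, S.mapProfile e.1 (S.π e.2)⟩ ↔ a = ⟨e.2, e.1 e.2⟩ := by
      rw [← S.apply_profile, S.φ.apply_eq_iff_eq]
    rintro (a | e) (b | e')
    · change (S.φ a).1 = (S.φ b).1 ∧ S.φ a ≠ S.φ b ↔ a.1 = b.1 ∧ a ≠ b
      rw [S.map_player, S.map_player, S.π.apply_eq_iff_eq, S.φ.injective.ne_iff]
    · exact hentry a e'
    · exact hentry b e
    · change S.mapProfile e.1 = S.mapProfile e'.1 ∧ S.π e.2 ≠ S.π e'.2 ↔ e.1 = e'.1 ∧ e.2 ≠ e'.2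
      rw [S.mapProfile_injective.eq_iff, S.π.injective.ne_iff]

theorem Game.Symmetry.exists_graph_iso {Q : Γ.Profile × Fin Γ.N → ℕ → Prop} {M : ℕ}
    (hQ : Γ.SeparatesPayoffs M Q) (hS : ¬S.PlayerSeparable) :
    ∃ k < Γ.N * Γ.N, ∃ τ : Γ.graph ≃g Γ.graph,
      (∀ x, ∀ d < M + 1, Game.label Q x d ↔ Game.label Q (τ x) d) ∧
        ∀ x, Game.mark k false x ↔ Game.mark k true (τ x) := by
  obtain ⟨i, hi⟩ : ∃ i, S.π i ≠ i := by
    by_contra! h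
    exact hS (Equiv.ext h)
  refine ⟨i * Γ.N + S.π i, by nlinarith [i.2, (S.π i).2], S.graphIso, ?_, ?_⟩
  · rintro (a | e) d hd
    · rfl
    · exact exists_congr fun q => and_congr_right fun h =>
        (hQ e (S.mapProfile e.1, S.π e.2)).2 (S.map_payoff e.2 e.1) q (by lia)
  · rintro (a | e)
    · change _ ↔ Game.mark _ true (.inl (S.φ a))
      rw [Game.mark_false_iff, Game.mark_true_iff, S.map_player, S.π.apply_eq_iff_eq]
      exact (and_iff_left hi.symm).symm
    · rfl

end OfSymmetry

section OfGraphIso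

variable {τ : Γ.graph ≃g Γ.graph} {φ : Equiv.Perm Γ.Action} {π : Equiv.Perm (Fin Γ.N)}
  {ψ : Γ.Profile × Fin Γ.N → Γ.Profile × Fin Γ.N}

theorem Game.label_zero_iff {Q : Γ.Profile × Fin Γ.N → ℕ → Prop} {x : Γ.Vertex} :
    Game.label Q x 0 ↔ x.isLeft := by
  obtain a | e := x <;> simp [Game.label]

theorem exists_action_perm (hτ : ∀ x, (τ x).isLeft = x.isLeft) :
    ∃ φ : Equiv.Perm Γ.Action, ∀ a, τ (.inl a) = .inl (φ a) := by
  choose φ hφ using fun a => Sum.isLeft_iff.1 (hτ (.inl a))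
  have hinj : Function.Injective φ := fun a b h =>
    Sum.inl_injective (τ.injective (by rw [hφ, hφ, h]))
  have : Finite Γ.Action := by unfold Game.Action; infer_instance
  exact ⟨.ofBijective φ (Finite.injective_iff_bijective.1 hinj), hφ⟩

theorem exists_entry_map (hτ : ∀ x, (τ x).isLeft = x.isLeft) :
    ∃ ψ : Γ.Profile × Fin Γ.N → Γ.Profile × Fin Γ.N, ∀ e, τ (.inr e) = .inr (ψ e) := by
  choose ψ hψ using fun e => Sum.isRight_iff.1 (Sum.isLeft_eq_false.1 (hτ (.inr e)))
  exact ⟨ψ, hψ⟩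

-- The players are the cliques formed by the actions.
theorem exists_player_perm (hφ : ∀ a, τ (.inl a) = .inl (φ a)) :
    ∃ π : Equiv.Perm (Fin Γ.N), ∀ a, (φ a).1 = π a.1 := by
  have hclique (a b : Γ.Action) : (φ a).1 = (φ b).1 ↔ a.1 = b.1 := by
    by_cases hab : a = b
    · simp [hab]
    · have h := τ.map_adj_iff (v := .inl a) (w := .inl b)
      rw [hφ, hφ] at h
      change ((φ a).1 = (φ b).1 ∧ φ a ≠ φ b) ↔ (a.1 = b.1 ∧ a ≠ b) at h
      simpa [hab] using h
  let π (i : Fin Γ.N) : Fin Γ.N := (φ ⟨i, ⟨0, Γ.m_pos i⟩⟩).1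
  have hinj : Function.Injective π := fun i j h => (hclique _ _).1 h
  exact ⟨.ofBijective π (Finite.injective_iff_bijective.1 hinj), fun a => (hclique _ _).2 rfl⟩

-- The rows of the payoff table are the cliques formed by the entries.
theorem exists_profile_map (hφ : ∀ a, τ (.inl a) = .inl (φ a)) (hψ : ∀ e, τ (.inr e) = .inr (ψ e))
    (hπ : ∀ a, (φ a).1 = π a.1) :
    ∃ ρ : Γ.Profile → Γ.Profile, ∀ a i,
      ψ (a, i) = (ρ a, π i) ∧ φ ⟨i, a i⟩ = ⟨π i, ρ a (π i)⟩ := by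
  have haction (e) : φ ⟨e.2, e.1 e.2⟩ = ⟨(ψ e).2, (ψ e).1 (ψ e).2⟩ := by
    have h := τ.map_adj_iff (v := .inl ⟨e.2, e.1 e.2⟩) (w := .inr e)
    rw [hφ, hψ] at h
    exact h.2 rfl
  have hplayer (e) : (ψ e).2 = π e.2 := by
    rw [← hπ ⟨e.2, e.1 e.2⟩, haction]
  have hrow (a i j) : (ψ (a, i)).1 = (ψ (a, j)).1 := by
    by_cases hij : i = j
    · rw [hij]
    · have h := τ.map_adj_iff (v := .inr (a, i)) (w := .inr (a, j))
      rw [hψ, hψ] at h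
      exact (h.2 ⟨rfl, hij⟩).1
  have hprofile (a) : ∃ b, ∀ i, ψ (a, i) = (b, π i) := by
    obtain _ | ⟨⟨i⟩⟩ := isEmpty_or_nonempty (Fin Γ.N)
    · exact ⟨a, isEmptyElim⟩
    · exact ⟨(ψ (a, i)).1, fun j => Prod.ext (hrow a j i) (hplayer (a, j))⟩
  choose ρ hρ using hprofile
  exact ⟨ρ, fun a i => ⟨hρ a i, (haction (a, i)).trans (by rw [hρ])⟩⟩

/-- The symmetry that maps the profile `a` to the profile `ρ a`. -/
def Game.Symmetry.ofProfileMap (φ : Equiv.Perm Γ.Action) (π : Equiv.Perm (Fin Γ.N))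
    (hπ : ∀ a, (φ a).1 = π a.1) (ρ : Γ.Profile → Γ.Profile)
    (hρ : ∀ a i, φ ⟨i, a i⟩ = ⟨π i, ρ a (π i)⟩)
    (hu : ∀ i a, Γ.u i a = Γ.u (π i) (ρ a)) : Γ.Symmetry where
  φ := φ
  π := π
  map_player := hπ
  map_payoff i a := by
    rw [hu]
    congr 1
    funext j
    refine (Game.Action.cast_snd_eq ?_ _).symm
    rw [hρ, π.apply_symm_apply]

theorem exists_symmetry_of_graph_iso {Q : Γ.Profile × Fin Γ.N → ℕ → Prop} {M : ℕ}
    (hQ : Γ.SeparatesPayoffs M Q) {k : ℕ} (hk : k < Γ.N * Γ.N)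
    (hlabel : ∀ x, ∀ d < M + 1, Game.label Q x d ↔ Game.label Q (τ x) d)
    (hmark : ∀ x, Game.mark k false x ↔ Game.mark k true (τ x)) :
    ∃ S : Γ.Symmetry, ¬S.PlayerSeparable := by
  have hτ (x) : (τ x).isLeft = x.isLeft := by
    have h := hlabel x 0 M.succ_pos
    rw [Game.label_zero_iff, Game.label_zero_iff] at h
    exact (Bool.eq_iff_iff.2 h).symm
  obtain ⟨φ, hφ⟩ := exists_action_perm hτ
  obtain ⟨ψ, hψ⟩ := exists_entry_map hτ
  obtain ⟨π, hπ⟩ := exists_player_perm hφ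
  obtain ⟨ρ, hρ⟩ := exists_profile_map hφ hψ hπ
  have hu (i a) : Γ.u i a = Γ.u (π i) (ρ a) := by
    refine (hQ (a, i) (ρ a, π i)).1 fun q hq => ?_
    have h := hlabel (.inr (a, i)) (q + 1) (by lia)
    rw [hψ, (hρ a i).1] at h
    simpa [Game.label] using h
  refine ⟨.ofProfileMap φ π hπ ρ (fun a i => (hρ a i).2) hu, fun hsep => ?_⟩
  have hN : 0 < Γ.N := Nat.pos_of_mul_pos_right (Nat.zero_lt_of_lt hk)
  let i : Fin Γ.N := ⟨k / Γ.N, Nat.div_lt_of_lt_mul hk⟩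
  let j : Fin Γ.N := ⟨k % Γ.N, Nat.mod_lt _ hN⟩
  have h := hmark (.inl ⟨i, ⟨0, Γ.m_pos i⟩⟩)
  rw [hφ, show k = i * Γ.N + j from (Nat.div_add_mod' k Γ.N).symm, Game.mark_false_iff,
    Game.mark_true_iff, hπ, show π = 1 from hsep] at h
  obtain ⟨hij, hne⟩ := h.1 rfl
  exact hne hij

end OfGraphIso

end GameGraph

/-! ### Graphs described by words -/

section RationalWords

/-- The sign and the binary digits of the numerator of a rational number. -/
def numeratorWord (q : ℚ) : List Γ' :=
  Γ'.bit (decide (q.num < 0)) :: (encodeNat q.num.natAbs).map Γ'.bit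

/-- The binary digits of the denominator of a rational number. -/
def denominatorWord (q : ℚ) : List Γ' := (encodeNat q.den).map Γ'.bit

theorem encodeRat_eq (q : ℚ) :
    encodeRat q = numeratorWord q ++ [Γ'.comma] ++ (denominatorWord q ++ [Γ'.comma]) := by
  simp [encodeRat, numeratorWord, denominatorWord, encodeBits]

theorem comma_notMem_numeratorWord (q : ℚ) : Γ'.comma ∉ numeratorWord q := by simp [numeratorWord]

theorem comma_notMem_denominatorWord (q : ℚ) : Γ'.comma ∉ denominatorWord q := by
  simp [denominatorWord]

/-- Labels for a pair of words over the bits: `4 * t + b` and `4 * t + 2 + b` stand for the `t`-th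
letter of the first and of the second word, with `b = 0` for the bit `true`. -/
def digitLabel (T : ℕ) (n d : List Γ') (c : ℕ) : Prop :=
  ∃ t < T, (c = 4 * t ∧ n[t]? = some (Γ'.bit true)) ∨
    (c = 4 * t + 1 ∧ n[t]? = some (Γ'.bit false)) ∨
    (c = 4 * t + 2 ∧ d[t]? = some (Γ'.bit true)) ∨ (c = 4 * t + 3 ∧ d[t]? = some (Γ'.bit false))

theorem digitLabel_fst {T t : ℕ} (ht : t < T) (n d : List Γ') (b : Bool) :
    digitLabel T n d (4 * t + (!b).toNat) ↔ n[t]? = some (Γ'.bit b) := by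
  unfold digitLabel
  cases b
  · exact ⟨by grind, fun h => ⟨t, ht, .inr (.inl ⟨rfl, h⟩)⟩⟩
  · exact ⟨by grind, fun h => ⟨t, ht, .inl ⟨rfl, h⟩⟩⟩

theorem digitLabel_snd {T t : ℕ} (ht : t < T) (n d : List Γ') (b : Bool) :
    digitLabel T n d (4 * t + 2 + (!b).toNat) ↔ d[t]? = some (Γ'.bit b) := by
  unfold digitLabel
  cases b
  · exact ⟨by grind, fun h => ⟨t, ht, .inr (.inr (.inr ⟨rfl, h⟩))⟩⟩
  · exact ⟨by grind, fun h => ⟨t, ht, .inr (.inr (.inl ⟨rfl, h⟩))⟩⟩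

theorem eq_of_getElem?_map_bit {T : ℕ} {l l' : List Bool} (hl : l.length ≤ T) (hl' : l'.length ≤ T)
    (h : ∀ t < T, ∀ b, (l.map Γ'.bit)[t]? = some (Γ'.bit b) ↔
      (l'.map Γ'.bit)[t]? = some (Γ'.bit b)) : l = l' := by
  refine List.ext_getElem? fun t => ?_
  by_cases ht : t < T
  · refine Option.ext fun b => ?_
    simpa using h t ht b
  · rw [List.getElem?_eq_none (by lia), List.getElem?_eq_none (by lia)]

theorem digitLabel_rat_iff {T : ℕ} {q q' : ℚ} (hn : (numeratorWord q).length ≤ T)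
    (hd : (denominatorWord q).length ≤ T) (hn' : (numeratorWord q').length ≤ T)
    (hd' : (denominatorWord q').length ≤ T) :
    (∀ c < 4 * T, digitLabel T (numeratorWord q) (denominatorWord q) c ↔
      digitLabel T (numeratorWord q') (denominatorWord q') c) ↔ q = q' := by
  refine ⟨fun h => encodeRat_prefix.injective ?_, fun h _ _ => by rw [h]⟩
  have hlt (b : Bool) : (!b).toNat < 2 := Bool.toNat_lt _
  have hdenominator : encodeNat q.den = encodeNat q'.den :=
    eq_of_getElem?_map_bit (by simpa [denominatorWord] using hd)
      (by simpa [denominatorWord] using hd') fun t ht b =>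
        (digitLabel_snd ht _ _ b).symm.trans ((h _ (by grind)).trans (digitLabel_snd ht _ _ b))
  have hnumerator : decide (q.num < 0) :: encodeNat q.num.natAbs =
      decide (q'.num < 0) :: encodeNat q'.num.natAbs :=
    eq_of_getElem?_map_bit (by simpa [numeratorWord] using hn)
      (by simpa [numeratorWord] using hn') fun t ht b =>
        (digitLabel_fst ht (numeratorWord q) (denominatorWord q) b).symm.trans
          ((h _ (by grind)).trans (digitLabel_fst ht _ _ b))
  rw [encodeRat_eq, encodeRat_eq,
    show numeratorWord q = numeratorWord q' from congrArg (List.map Γ'.bit) hnumerator,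
    show denominatorWord q = denominatorWord q' from congrArg (List.map Γ'.bit) hdenominator]

end RationalWords

section GameWords

theorem ket_notMem_encodeRat (q : ℚ) : Γ'.ket ∉ encodeRat q := by simp [encodeRat, encodeBits]

theorem ket_notMem_encodeUnary (n : ℕ) : Γ'.ket ∉ encodeUnary n := by
  simp [encodeUnary, encodeBits]

theorem count_comma_encodeUnary (n : ℕ) : (encodeUnary n).count Γ'.comma = 1 := by
  simp [encodeUnary, encodeBits, List.count_eq_zero]

theorem block_flatMap_encodeUnary {Y : Type} (f : Y → ℕ) (l : List Y) (t : List Γ') (i : ℕ) :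
    block Γ'.comma (l.flatMap (fun y => encodeUnary (f y)) ++ t) i =
      if h : i < l.length then List.replicate (f l[i]) (Γ'.bit true)
      else block Γ'.comma t (i - l.length) := by
  have h := block_flatMap Γ'.comma (fun y => List.replicate (f y) (Γ'.bit true)) (by simp) l t i
  simpa [encodeUnary, encodeBits] using h

theorem block_flatMap_two {Y β : Type} [DecidableEq β] (c : β) {f g : Y → List β}
    (hf : ∀ y, c ∉ f y) (hg : ∀ y, c ∉ g y) {l : List Y} {i : ℕ} (hi : i < l.length) :
    block c (l.flatMap fun y => f y ++ [c] ++ (g y ++ [c])) (2 * i) = f l[i] ∧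
      block c (l.flatMap fun y => f y ++ [c] ++ (g y ++ [c])) (2 * i + 1) = g l[i] := by
  induction l generalizing i with
  | nil => simp at hi
  | cons y l ih =>
    simp only [List.flatMap_cons, List.append_assoc, List.cons_append, List.nil_append] at ih ⊢
    cases i with
    | zero =>
      exact ⟨block_append_zero c (hf y) _, by
        rw [block_append_succ c (hf y), block_append_zero c (hg y)]; rfl⟩
    | succ i =>
      rw [show 2 * (i + 1) = 2 * i + 1 + 1 by ring, block_append_succ c (hf y),
        block_append_succ c (hg y), block_append_succ c (hf y), block_append_succ c (hg y)]
      exact ih (by simpa using hi)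

/-- The row of the payoff table for a profile, without the end marker. -/
def Game.rowWord (Γ : Game) (a : Γ.Profile) : List Γ' :=
  (List.finRange Γ.N).flatMap (fun i => encodeUnary (a i)) ++
    (List.finRange Γ.N).flatMap (fun i => encodeRat (Γ.u i a))

theorem Game.encode_eq (Γ : Game) : Γ.encode = (List.ofFn Γ.m).flatMap encodeUnary ++
    Γ'.ket :: ((profiles Γ.N Γ.m).flatMap fun a => Γ.rowWord a ++ [Γ'.ket]) := by
  simp only [Game.encode, Game.rowWord, List.append_assoc]
  rfl

theorem ket_notMem_flatMap_encodeUnary (l : List ℕ) : Γ'.ket ∉ l.flatMap encodeUnary := by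
  simp [ket_notMem_encodeUnary]

theorem Game.ket_notMem_rowWord (Γ : Game) (a : Γ.Profile) : Γ'.ket ∉ Γ.rowWord a := by
  simp [Game.rowWord, ket_notMem_encodeUnary, ket_notMem_encodeRat]

theorem nodup_profiles : ∀ (N : ℕ) (m : Fin N → ℕ), (profiles N m).Nodup
  | 0, _ => by simp [profiles]
  | N + 1, m => by
    rw [profiles, List.nodup_flatMap]
    refine ⟨fun a _ => (nodup_profiles N _).map fun b b' h => (Fin.cons_injective2 h).2,
      (List.nodup_finRange _).imp fun {a b} hab => ?_⟩
    simp only [Function.onFun, List.disjoint_left, List.mem_map, not_exists, not_and]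
    rintro _ ⟨c, -, rfl⟩ d - h
    exact hab (Fin.cons_injective2 h).1.symm

variable (w : List Γ')

/-- The number of players, read off the code of a game. -/
def codeNumPlayers : ℕ := (block Γ'.ket w 0).count Γ'.comma

/-- The number of action profiles, read off the code of a game. -/
def codeNumRows : ℕ := w.count Γ'.ket - 1

/-- The number of actions of a player, read off the code of a game. -/
def codeNumActions (i : ℕ) : ℕ := (block Γ'.comma (block Γ'.ket w 0) i).length

/-- The action of player `i` in row `r`, read off the code of a game. -/
def codeAction (r i : ℕ) : ℕ := (block Γ'.comma (block Γ'.ket w (r + 1)) i).length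

/-- The numerator of the payoff of player `i` in row `r`, read off the code of a game. -/
def codeNumerator (r i : ℕ) : List Γ' :=
  block Γ'.comma (block Γ'.ket w (r + 1)) (codeNumPlayers w + 2 * i)

/-- The denominator of the payoff of player `i` in row `r`, read off the code of a game. -/
def codeDenominator (r i : ℕ) : List Γ' :=
  block Γ'.comma (block Γ'.ket w (r + 1)) (codeNumPlayers w + (2 * i + 1))

theorem block_length_le {β : Type} [DecidableEq β] (c : β) (l : List β) (i : ℕ) :
    (block c l i).length ≤ l.length := by
  induction l using List.reverseRecOn with
  | nil => simp [block]
  | append_singleton l y ih =>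
    rw [block_concat]
    split_ifs <;> grind

theorem codeNumPlayers_le : codeNumPlayers w ≤ w.length :=
  List.count_le_length.trans (block_length_le _ _ _)

theorem codeNumRows_le : codeNumRows w ≤ w.length :=
  (Nat.sub_le _ _).trans List.count_le_length

theorem codeNumActions_le (i : ℕ) : codeNumActions w i ≤ w.length :=
  (block_length_le _ _ _).trans (block_length_le _ _ _)

variable (Γ : Game)

theorem block_encode_zero : block Γ'.ket Γ.encode 0 = (List.ofFn Γ.m).flatMap encodeUnary := by
  rw [Game.encode_eq, block_append_zero _ (ket_notMem_flatMap_encodeUnary _)]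

theorem block_encode_succ {r : ℕ} (hr : r < (profiles Γ.N Γ.m).length) :
    block Γ'.ket Γ.encode (r + 1) = Γ.rowWord (profiles Γ.N Γ.m)[r] := by
  have h := block_flatMap Γ'.ket Γ.rowWord Γ.ket_notMem_rowWord (profiles Γ.N Γ.m) [] r
  rwa [List.append_nil, dif_pos hr, ← block_append_succ _ (ket_notMem_flatMap_encodeUnary _),
    ← Game.encode_eq] at h

theorem codeNumPlayers_encode : codeNumPlayers Γ.encode = Γ.N := by
  rw [codeNumPlayers, block_encode_zero, List.count_flatMap]
  simp [Function.comp_def, count_comma_encodeUnary]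

theorem codeNumRows_encode : codeNumRows Γ.encode = (profiles Γ.N Γ.m).length := by
  have hrow (a) : (Γ.rowWord a).count Γ'.ket = 0 :=
    List.count_eq_zero_of_not_mem (Γ.ket_notMem_rowWord a)
  rw [codeNumRows, Game.encode_eq, List.count_append,
    List.count_eq_zero_of_not_mem (ket_notMem_flatMap_encodeUnary _), List.count_cons,
    List.count_flatMap]
  simp [Function.comp_def, hrow]

theorem codeNumActions_encode (i : Fin Γ.N) : codeNumActions Γ.encode i = Γ.m i := by
  have h := block_flatMap_encodeUnary id (List.ofFn Γ.m) [] i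
  rw [dif_pos (by simp), List.append_nil] at h
  rw [codeNumActions, block_encode_zero]
  exact (congrArg List.length h).trans (by simp)

theorem block_rowWord_of_lt (a : Γ.Profile) (i : Fin Γ.N) :
    block Γ'.comma (Γ.rowWord a) i = List.replicate (a i) (Γ'.bit true) := by
  rw [Game.rowWord, block_flatMap_encodeUnary, dif_pos (by simp)]
  exact congrArg (fun j => List.replicate (a j) (Γ'.bit true)) (by simp)

theorem block_rowWord_add (a : Γ.Profile) (k : ℕ) : block Γ'.comma (Γ.rowWord a) (Γ.N + k) =
    block Γ'.comma ((List.finRange Γ.N).flatMap fun i => encodeRat (Γ.u i a)) k := by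
  rw [Game.rowWord, block_flatMap_encodeUnary, dif_neg (by simp), List.length_finRange,
    Nat.add_sub_cancel_left]

theorem block_payoffs (a : Γ.Profile) (i : Fin Γ.N) :
    block Γ'.comma ((List.finRange Γ.N).flatMap fun i => encodeRat (Γ.u i a)) (2 * i) =
      numeratorWord (Γ.u i a) ∧
    block Γ'.comma ((List.finRange Γ.N).flatMap fun i => encodeRat (Γ.u i a)) (2 * i + 1) =
      denominatorWord (Γ.u i a) := by
  simp only [encodeRat_eq]
  have h := block_flatMap_two Γ'.comma (fun i : Fin Γ.N => comma_notMem_numeratorWord (Γ.u i a))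
    (fun i => comma_notMem_denominatorWord (Γ.u i a)) (l := List.finRange Γ.N) (i := i) (by simp)
  simpa using h

theorem codeAction_encode {r : ℕ} (hr : r < (profiles Γ.N Γ.m).length) (i : Fin Γ.N) :
    codeAction Γ.encode r i = (profiles Γ.N Γ.m)[r] i := by
  rw [codeAction, block_encode_succ Γ hr, block_rowWord_of_lt, List.length_replicate]

theorem codeNumerator_encode {r : ℕ} (hr : r < (profiles Γ.N Γ.m).length) (i : Fin Γ.N) :
    codeNumerator Γ.encode r i = numeratorWord (Γ.u i (profiles Γ.N Γ.m)[r]) := by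
  rw [codeNumerator, block_encode_succ Γ hr, codeNumPlayers_encode, block_rowWord_add,
    (block_payoffs Γ _ i).1]

theorem codeDenominator_encode {r : ℕ} (hr : r < (profiles Γ.N Γ.m).length) (i : Fin Γ.N) :
    codeDenominator Γ.encode r i = denominatorWord (Γ.u i (profiles Γ.N Γ.m)[r]) := by
  rw [codeDenominator, block_encode_succ Γ hr, codeNumPlayers_encode, block_rowWord_add,
    (block_payoffs Γ _ i).2]

end GameWords

section Codes

/-! The vertices of the two graphs of a game are coded by six numbers: the first one tells the kind
of the vertex, and unused entries are zero. A node of the ladder is `0, level, side`; an action in a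
copy is `1, level, side, side, player, action`; a payoff entry in a copy is
`2, level, side, side, row, player`; a hub is `3, label`; a leaf is `4, label, number`. -/

variable (w : List Γ') (v v' : Fin 6 → ℕ) (ε c : ℕ)

/-- The adjacency relation of the graph of a game, on codes. -/
def CodeGameAdj : Prop :=
  ((v 0 = 1 ∧ v' 0 = 1) ∧ v 4 = v' 4 ∧ v 5 ≠ v' 5) ∨
  ((v 0 = 2 ∧ v' 0 = 2) ∧ v 4 = v' 4 ∧ v 5 ≠ v' 5) ∨
  ((v 0 = 1 ∧ v' 0 = 2) ∧ v 4 = v' 5 ∧ v 5 = codeAction w (v' 4) (v' 5)) ∨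
  ((v 0 = 2 ∧ v' 0 = 1) ∧ v' 4 = v 5 ∧ v' 5 = codeAction w (v 4) (v 5))

/-- The relation `ladderRel`, on codes. -/
def CodeLadderRel : Prop :=
  ((v 0 = 0 ∧ (v' 0 = 1 ∨ v' 0 = 2)) ∧
    ((v 1 = v' 1 ∧ v 2 = v' 2) ∨ (v 1 = v' 1 + 1 ∧ v 2 = v' 3))) ∨
  ((v 1 = v' 1 ∧ v 2 = v' 2 ∧ v 3 = v' 3) ∧ CodeGameAdj w v v')

/-- The marks `Game.mark` in the copies of the graph of a game, on codes. -/
def CodeMark : Prop :=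
  v 0 = 1 ∧ ((v 2 = v 3 ∧ ∃ j < codeNumPlayers w, v 1 = v 4 * codeNumPlayers w + j) ∨
    (v 2 ≠ v 3 ∧ ∃ i < codeNumPlayers w, v 1 = i * codeNumPlayers w + v 4 ∧ i ≠ v 4))

/-- The labels that stand for the payoffs, on codes. -/
def CodePayoffLabel : Prop :=
  ∃ q < 4 * w.length, c = 7 + codeNumPlayers w * codeNumPlayers w + (q + 1) ∧
    digitLabel w.length (codeNumerator w (v 4) (v 5)) (codeDenominator w (v 4) (v 5)) q

/-- The labels `ladderLabel`, on codes. -/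
def CodeLabel : Prop :=
  (v 0 = 0 ∧ (c = 0 ∨ c = 1 ∨ c = 2 ∨ (c = 3 ∧ v 1 = 0 ∧ v 2 = 0) ∨
    (c = 4 ∧ v 1 = codeNumPlayers w * codeNumPlayers w ∧ v 2 = ε) ∨ c = 6 + v 1)) ∨
  ((v 0 = 1 ∨ v 0 = 2) ∧ (c = 0 ∨ c = 1 ∨ (c = 5 ∧ CodeMark w v) ∨ c = 6 + v 1 ∨
    (v 0 = 1 ∧ c = 7 + codeNumPlayers w * codeNumPlayers w) ∨ (v 0 = 2 ∧ CodePayoffLabel w v c)))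

/-- The relation `hubRel`, on codes. -/
def CodeHubRel : Prop :=
  ((v 0 < 3 ∧ v' 0 < 3) ∧ v ≠ v' ∧ (CodeLadderRel w v v' ∨ CodeLadderRel w v' v)) ∨
  ((v 0 < 3 ∧ v' 0 = 3) ∧ CodeLabel w v ε (v' 1)) ∨
  ((v 0 = 3 ∧ v' 0 = 4) ∧ v 1 = v' 1)

/-- The adjacency relation of the hub graph, on codes. -/
def CodeHubAdj : Prop := v ≠ v' ∧ (CodeHubRel w v v' ε ∨ CodeHubRel w v' v ε)

/-- The codes of the vertices of the ladder. -/
def IsLadderCode : Prop :=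
  ((v 0 = 0 ∧ v 3 = 0 ∧ v 4 = 0 ∧ v 5 = 0) ∧
    v 1 < codeNumPlayers w * codeNumPlayers w + 1 ∧ v 2 < 2) ∨
  (v 0 = 1 ∧ (v 1 < codeNumPlayers w * codeNumPlayers w ∧ v 2 < 2 ∧ v 3 < 2) ∧
    v 4 < codeNumPlayers w ∧ v 5 < codeNumActions w (v 4)) ∨
  (v 0 = 2 ∧ (v 1 < codeNumPlayers w * codeNumPlayers w ∧ v 2 < 2 ∧ v 3 < 2) ∧
    v 4 < codeNumRows w ∧ v 5 < codeNumPlayers w)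

/-- The codes of the vertices of the hub graph. -/
def IsHubCode (C D : ℕ) : Prop :=
  IsLadderCode w v ∨
  ((v 0 = 3 ∧ v 2 = 0 ∧ v 3 = 0 ∧ v 4 = 0 ∧ v 5 = 0) ∧ v 1 < C) ∨
  ((v 0 = 4 ∧ v 3 = 0 ∧ v 4 = 0 ∧ v 5 = 0) ∧ v 1 < C ∧ v 2 < (v 1 + 1) * D)

end Codes

section Rows

variable {Γ : Game}

/-- The row of the payoff table for a profile. -/
def Game.rowIndex (Γ : Game) (a : Γ.Profile) : ℕ := (profiles Γ.N Γ.m).idxOf a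

theorem Game.rowIndex_lt (a : Γ.Profile) : Γ.rowIndex a < (profiles Γ.N Γ.m).length :=
  List.idxOf_lt_length_iff.2 (mem_profiles _ _ a)

theorem Game.getElem_rowIndex (a : Γ.Profile) :
    (profiles Γ.N Γ.m)[Γ.rowIndex a]'(Game.rowIndex_lt a) = a :=
  List.getElem_idxOf _

theorem Game.rowIndex_getElem {r : ℕ} (hr : r < (profiles Γ.N Γ.m).length) :
    Γ.rowIndex (profiles Γ.N Γ.m)[r] = r :=
  (nodup_profiles _ _).idxOf_getElem _ _

theorem Game.rowIndex_inj {a b : Γ.Profile} : Γ.rowIndex a = Γ.rowIndex b ↔ a = b :=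
  List.idxOf_inj (mem_profiles _ _ a)

theorem codeAction_rowIndex (a : Γ.Profile) (i : Fin Γ.N) :
    codeAction Γ.encode (Γ.rowIndex a) i = a i := by
  rw [codeAction_encode Γ (Game.rowIndex_lt a), Game.getElem_rowIndex]

theorem codeNumerator_rowIndex (a : Γ.Profile) (i : Fin Γ.N) :
    codeNumerator Γ.encode (Γ.rowIndex a) i = numeratorWord (Γ.u i a) := by
  rw [codeNumerator_encode Γ (Game.rowIndex_lt a), Game.getElem_rowIndex]

theorem codeDenominator_rowIndex (a : Γ.Profile) (i : Fin Γ.N) :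
    codeDenominator Γ.encode (Γ.rowIndex a) i = denominatorWord (Γ.u i a) := by
  rw [codeDenominator_encode Γ (Game.rowIndex_lt a), Game.getElem_rowIndex]

end Rows

section VertexCodes

variable {Γ : Game} {C D : ℕ}

/-- The code of a vertex of the ladder. -/
def ladderCode : LadderVertex (Γ.N * Γ.N) Γ.Vertex → Fin 6 → ℕ
  | .inl (k, s) => ![0, k, s.toNat, 0, 0, 0]
  | .inr (k, s, t, .inl a) => ![1, k, s.toNat, t.toNat, a.1, a.2]
  | .inr (k, s, t, .inr (r, i)) => ![2, k, s.toNat, t.toNat, Γ.rowIndex r, i]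

/-- The code of a vertex of the hub graph. -/
def hubCode : HubVertex (LadderVertex (Γ.N * Γ.N) Γ.Vertex) C D → Fin 6 → ℕ
  | .inl v => ladderCode v
  | .inr (.inl c) => ![3, c, 0, 0, 0, 0]
  | .inr (.inr ⟨c, t⟩) => ![4, c, t, 0, 0, 0]

theorem forall_fin_six {p : Fin 6 → Prop} :
    (∀ i, p i) ↔ p 0 ∧ p 1 ∧ p 2 ∧ p 3 ∧ p 4 ∧ p 5 := by
  simp [Fin.forall_fin_succ]

theorem code_eq_iff {v v' : Fin 6 → ℕ} : v = v' ↔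
    v 0 = v' 0 ∧ v 1 = v' 1 ∧ v 2 = v' 2 ∧ v 3 = v' 3 ∧ v 4 = v' 4 ∧ v 5 = v' 5 :=
  funext_iff.trans forall_fin_six

theorem toNat_inj {s t : Bool} : s.toNat = t.toNat ↔ s = t := by cases s <;> cases t <;> simp

theorem sigma_fin_eq_iff {N : ℕ} {m : Fin N → ℕ} {x y : Σ i, Fin (m i)} :
    x = y ↔ x.1.val = y.1.val ∧ x.2.val = y.2.val := by
  refine ⟨fun h => by rw [h]; exact ⟨rfl, rfl⟩, ?_⟩
  obtain ⟨i, a⟩ := x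
  obtain ⟨j, b⟩ := y
  rintro ⟨h, h'⟩
  obtain rfl := Fin.ext h
  obtain rfl := Fin.ext h'
  rfl

theorem ladderCode_inj {u v : LadderVertex (Γ.N * Γ.N) Γ.Vertex} :
    ladderCode u = ladderCode v ↔ u = v := by
  obtain ⟨_, _⟩ | ⟨_, _, _, _ | ⟨_, _⟩⟩ := u <;> obtain ⟨_, _⟩ | ⟨_, _, _, _ | ⟨_, _⟩⟩ := v <;>
    simp [ladderCode, toNat_inj, Game.rowIndex_inj, Fin.val_inj, sigma_fin_eq_iff]

theorem ladderCode_lt (v : LadderVertex (Γ.N * Γ.N) Γ.Vertex) : ladderCode v 0 < 3 := by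
  obtain _ | ⟨_, _, _, _ | _⟩ := v <;> simp [ladderCode]

theorem hubCode_injective : Function.Injective (hubCode (Γ := Γ) (C := C) (D := D)) := by
  rintro (v | c | ⟨c, t⟩) (v' | c' | ⟨c', t'⟩) h
  · rw [ladderCode_inj.1 h]
  · exact absurd (congrFun h 0) (ladderCode_lt v).ne
  · exact absurd (congrFun h 0) ((ladderCode_lt v).trans (Nat.lt_succ_self 3)).ne
  · exact absurd (congrFun h 0) (ladderCode_lt v').ne'
  · rw [Fin.ext (congrFun h 1)]
  · exact absurd (congrFun h 0) (by simp [hubCode])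
  · exact absurd (congrFun h 0) ((ladderCode_lt v').trans (Nat.lt_succ_self 3)).ne'
  · exact absurd (congrFun h 0) (by simp [hubCode])
  · obtain rfl : c = c' := Fin.ext (congrFun h 1)
    rw [Fin.ext (congrFun h 2)]

theorem codeGameAdj_ladderCode {k k' : Fin (Γ.N * Γ.N)} {s t s' t' : Bool} {x x' : Γ.Vertex} :
    CodeGameAdj Γ.encode (ladderCode (.inr (k, s, t, x))) (ladderCode (.inr (k', s', t', x'))) ↔
      Γ.graph.Adj x x' := by
  obtain a | ⟨r, i⟩ := x <;> obtain a' | ⟨r', i'⟩ := x'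
  · change _ ↔ a.1 = a'.1 ∧ a ≠ a'
    simp +contextual [CodeGameAdj, ladderCode, sigma_fin_eq_iff, Fin.val_inj]
  · change _ ↔ a = ⟨i', r' i'⟩
    simp [CodeGameAdj, ladderCode, sigma_fin_eq_iff, codeAction_rowIndex]
  · change _ ↔ a' = ⟨i, r i⟩
    simp [CodeGameAdj, ladderCode, sigma_fin_eq_iff, codeAction_rowIndex]
  · change _ ↔ r = r' ∧ i ≠ i'
    simp [CodeGameAdj, ladderCode, Fin.val_inj, Game.rowIndex_inj]

theorem ladderCode_inr {k : Fin (Γ.N * Γ.N)} {s t : Bool} {x : Γ.Vertex} :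
    (ladderCode (.inr (k, s, t, x)) 0 = 1 ∨ ladderCode (.inr (k, s, t, x)) 0 = 2) ∧
      ladderCode (.inr (k, s, t, x)) 1 = k ∧ ladderCode (.inr (k, s, t, x)) 2 = s.toNat ∧
      ladderCode (.inr (k, s, t, x)) 3 = t.toNat := by
  obtain a | ⟨r, i⟩ := x <;> simp [ladderCode]

theorem ladderCode_inr_ne_zero {k : Fin (Γ.N * Γ.N)} {s t : Bool} {x : Γ.Vertex} :
    ladderCode (.inr (k, s, t, x)) 0 ≠ 0 := by
  obtain h | h := (ladderCode_inr (k := k) (s := s) (t := t) (x := x)).1 <;> simp [h]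

theorem ladderCode_inl {k : Fin (Γ.N * Γ.N + 1)} {s : Bool} :
    ladderCode (Γ := Γ) (.inl (k, s)) 0 = 0 ∧ ladderCode (Γ := Γ) (.inl (k, s)) 1 = k ∧
      ladderCode (Γ := Γ) (.inl (k, s)) 2 = s.toNat := by
  simp [ladderCode]

theorem codeLadderRel_ladderCode (u v : LadderVertex (Γ.N * Γ.N) Γ.Vertex) :
    CodeLadderRel Γ.encode (ladderCode u) (ladderCode v) ↔ ladderRel Γ.graph u v := by
  obtain ⟨k, s⟩ | ⟨k, s, t, x⟩ := u <;> obtain ⟨k', s'⟩ | ⟨k', s', t', x'⟩ := v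
  · simp [CodeLadderRel, CodeGameAdj, ladderRel, ladderCode]
  · simp [CodeLadderRel, CodeGameAdj, ladderRel, ladderCode_inr, ladderCode_inl,
      toNat_inj]
  · simp [CodeLadderRel, CodeGameAdj, ladderRel, ladderCode_inl, ladderCode_inr_ne_zero]
  · simp only [CodeLadderRel, ladderRel, codeGameAdj_ladderCode, ladderCode_inr_ne_zero,
      ladderCode_inr, toNat_inj, Fin.val_inj, false_and, false_or, and_assoc]

/-- The predicates that tell the payoffs of a game apart: the letters of their binary codes. -/
def Game.payoffLabel (Γ : Game) (e : Γ.Profile × Fin Γ.N) (q : ℕ) : Prop :=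
  q < 4 * Γ.encode.length ∧ digitLabel Γ.encode.length (numeratorWord (Γ.u e.2 e.1))
    (denominatorWord (Γ.u e.2 e.1)) q

theorem Game.separatesPayoffs_payoffLabel :
    Γ.SeparatesPayoffs (4 * Γ.encode.length) Γ.payoffLabel := by
  have hnumerator (a) (i : Fin Γ.N) : (numeratorWord (Γ.u i a)).length ≤ Γ.encode.length := by
    rw [← codeNumerator_rowIndex]
    exact (block_length_le _ _ _).trans (block_length_le _ _ _)
  have hdenominator (a) (i : Fin Γ.N) : (denominatorWord (Γ.u i a)).length ≤ Γ.encode.length := by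
    rw [← codeDenominator_rowIndex]
    exact (block_length_le _ _ _).trans (block_length_le _ _ _)
  intro e e'
  rw [← digitLabel_rat_iff (hnumerator _ _) (hdenominator _ _) (hnumerator _ _) (hdenominator _ _)]
  exact forall₂_congr fun q hq => by simp only [payoffLabel, hq, true_and]

theorem codeMark_ladderCode {k : Fin (Γ.N * Γ.N)} {s t : Bool} {x : Γ.Vertex} :
    CodeMark Γ.encode (ladderCode (.inr (k, s, t, x))) ↔ Game.mark k (s != t) x := by
  obtain a | ⟨r, i⟩ := x <;> simp only [CodeMark, codeNumPlayers_encode, ladderCode] <;>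
    cases s <;> cases t <;> simp [Game.mark]

theorem codeLabel_ladderCode (ε : Bool) (v : LadderVertex (Γ.N * Γ.N) Γ.Vertex) (c : ℕ) :
    CodeLabel Γ.encode (ladderCode v) ε.toNat c ↔
      ladderLabel (Γ.N * Γ.N) Game.mark (Game.label Γ.payoffLabel) ε v c := by
  obtain ⟨k, s⟩ | ⟨k, s, t, x⟩ := v
  · have hs : s.toNat = 0 ↔ s = false := toNat_inj (t := false)
    simp [CodeLabel, ladderCode_inl, ladderLabel, codeNumPlayers_encode, toNat_inj, hs]
  · simp only [CodeLabel, codeMark_ladderCode, ladderCode_inr_ne_zero, ladderCode_inr, ladderLabel,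
      codeNumPlayers_encode, false_and, false_or, true_and]
    refine or_congr_right (or_congr_right (or_congr_right (or_congr_right ?_)))
    obtain a | ⟨r, i⟩ := x
    · simp [ladderCode, Game.label]
    · simp only [ladderCode, Game.label, Game.payoffLabel, CodePayoffLabel, codeNumPlayers_encode]
      simp [codeNumerator_rowIndex, codeDenominator_rowIndex]
      grind

/-- The graph that represents a game; `ε` is the side of the last node of the ladder. -/
def Game.hubGraph (Γ : Game) (C D : ℕ) (ε : Bool) :
    SimpleGraph (HubVertex (LadderVertex (Γ.N * Γ.N) Γ.Vertex) C D) :=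
  GameSym.hubGraph C D (ladderGraph (Γ.N * Γ.N) Γ.graph)
    (ladderLabel (Γ.N * Γ.N) Game.mark (Game.label Γ.payoffLabel) ε)

theorem codeHubRel_hubCode (ε : Bool) (x y : HubVertex (LadderVertex (Γ.N * Γ.N) Γ.Vertex) C D) :
    CodeHubRel Γ.encode (hubCode x) (hubCode y) ε.toNat ↔
      hubRel (ladderGraph (Γ.N * Γ.N) Γ.graph)
        (ladderLabel (Γ.N * Γ.N) Game.mark (Game.label Γ.payoffLabel) ε) x y := by
  have hladder (u : LadderVertex (Γ.N * Γ.N) Γ.Vertex) : ladderCode u 0 ≠ 3 ∧ ladderCode u 0 ≠ 4 ∧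
      ¬3 < ladderCode u 0 := by
    have := ladderCode_lt u
    lia
  obtain v | c | ⟨c, t⟩ := x <;> obtain v' | c' | ⟨c', t'⟩ := y
  · simp [CodeHubRel, hubCode, ladderCode_lt, hladder, codeLadderRel_ladderCode, hubRel,
      ladderGraph, SimpleGraph.fromRel_adj, ne_eq, ladderCode_inj]
  · simp [CodeHubRel, hubCode, ladderCode_lt, hladder, hubRel, codeLabel_ladderCode]
  · simp [CodeHubRel, hubCode, hladder, hubRel]
  · simp [CodeHubRel, hubCode, hladder, hubRel]
  all_goals simp [CodeHubRel, hubCode, hubRel, Fin.val_inj]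

theorem codeHubAdj_hubCode (ε : Bool) (x y : HubVertex (LadderVertex (Γ.N * Γ.N) Γ.Vertex) C D) :
    CodeHubAdj Γ.encode (hubCode x) (hubCode y) ε.toNat ↔ (Γ.hubGraph C D ε).Adj x y := by
  simp only [CodeHubAdj, codeHubRel_hubCode, Game.hubGraph, hubGraph, SimpleGraph.fromRel_adj,
    hubCode_injective.ne_iff]

theorem isLadderCode_ladderCode (x : LadderVertex (Γ.N * Γ.N) Γ.Vertex) :
    IsLadderCode Γ.encode (ladderCode x) := by
  obtain ⟨k, s⟩ | ⟨k, s, t, a | ⟨r, i⟩⟩ := x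
  · have := k.2
    simp [IsLadderCode, ladderCode, codeNumPlayers_encode, Bool.toNat_le, *]
  · simp [IsLadderCode, ladderCode, codeNumPlayers_encode, codeNumActions_encode, Bool.toNat_le]
  · simp [IsLadderCode, ladderCode, codeNumPlayers_encode, codeNumRows_encode, Bool.toNat_le,
      Game.rowIndex_lt]

theorem exists_toNat_eq {n : ℕ} (hn : n < 2) : ∃ s : Bool, s.toNat = n :=
  ⟨decide (n = 1), by interval_cases n <;> rfl⟩

theorem exists_ladderCode_eq {v : Fin 6 → ℕ} (h : IsLadderCode Γ.encode v) :
    ∃ x : LadderVertex (Γ.N * Γ.N) Γ.Vertex, ladderCode x = v := by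
  rw [IsLadderCode, codeNumPlayers_encode, codeNumRows_encode] at h
  obtain ⟨⟨h0, h3, h4, h5⟩, h1, h2⟩ | ⟨h0, ⟨h1, h2, h3⟩, h4, h5⟩ | ⟨h0, ⟨h1, h2, h3⟩, h4, h5⟩ := h
  · obtain ⟨s, hs⟩ := exists_toNat_eq h2
    exact ⟨.inl (⟨v 1, h1⟩, s), code_eq_iff.2 (by simp [ladderCode, h0, h3, h4, h5, hs])⟩
  · obtain ⟨s, hs⟩ := exists_toNat_eq h2
    obtain ⟨t, ht⟩ := exists_toNat_eq h3
    exact ⟨.inr (⟨v 1, h1⟩, s, t,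
        .inl ⟨⟨v 4, h4⟩, ⟨v 5, h5.trans_eq (codeNumActions_encode Γ ⟨v 4, h4⟩)⟩⟩),
      code_eq_iff.2 (by simp [ladderCode, h0, hs, ht])⟩
  · obtain ⟨s, hs⟩ := exists_toNat_eq h2
    obtain ⟨t, ht⟩ := exists_toNat_eq h3
    exact ⟨.inr (⟨v 1, h1⟩, s, t, .inr ((profiles Γ.N Γ.m)[v 4], ⟨v 5, h5⟩)),
      code_eq_iff.2 (by simp [ladderCode, h0, hs, ht, Game.rowIndex_getElem])⟩

theorem isHubCode_iff (v : Fin 6 → ℕ) : IsHubCode Γ.encode v C D ↔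
    ∃ x : HubVertex (LadderVertex (Γ.N * Γ.N) Γ.Vertex) C D, hubCode x = v := by
  constructor
  · rintro (h | ⟨⟨h0, h2, h3, h4, h5⟩, h1⟩ | ⟨⟨h0, h3, h4, h5⟩, h1, h2⟩)
    · obtain ⟨x, hx⟩ := exists_ladderCode_eq h
      exact ⟨.inl x, hx⟩
    · exact ⟨.inr (.inl ⟨v 1, h1⟩), code_eq_iff.2 (by simp [hubCode, h0, h2, h3, h4, h5])⟩
    · exact ⟨.inr (.inr ⟨⟨v 1, h1⟩, ⟨v 2, h2⟩⟩),
        code_eq_iff.2 (by simp [hubCode, h0, h3, h4, h5])⟩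
  · rintro ⟨x | c | ⟨c, t⟩, rfl⟩
    · exact .inl (isLadderCode_ladderCode x)
    · exact .inr (.inl (by simp [hubCode]))
    · exact .inr (.inr (by simp [hubCode]))

end VertexCodes

section Sizes

variable (w : List Γ')

/-- A bound for the entries of the codes of the vertices of the ladder. -/
def ladderBound : ℕ := codeNumPlayers w * codeNumPlayers w + w.length + 6

/-- The number of labels. -/
def labelCount : ℕ := 7 + codeNumPlayers w * codeNumPlayers w + (4 * w.length + 1)

/-- The unit for the numbers of leaves at the hubs, larger than the degrees of all other
vertices. -/
def hubUnit : ℕ := ladderBound w ^ 6 + labelCount w + 1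

/-- A bound for the entries of the codes of the vertices of the hub graph. -/
def hubBound : ℕ := labelCount w * hubUnit w + ladderBound w

variable {w} {v : Fin 6 → ℕ}

theorem IsLadderCode.lt (h : IsLadderCode w v) (i : Fin 6) : v i < ladderBound w := by
  have hN := codeNumPlayers_le w
  have hR := codeNumRows_le w
  have hM := codeNumActions_le w (v 4)
  revert i
  unfold ladderBound
  unfold IsLadderCode at h
  generalize codeNumPlayers w * codeNumPlayers w = K at *
  refine forall_fin_six.2 ⟨?_, ?_, ?_, ?_, ?_, ?_⟩ <;> lia

theorem IsHubCode.lt (h : IsHubCode w v (labelCount w) (hubUnit w)) (i : Fin 6) :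
    v i < hubBound w := by
  have hbound : 6 ≤ ladderBound w := Nat.le_add_left _ _
  have hlabels : labelCount w ≤ labelCount w * hubUnit w :=
    Nat.le_mul_of_pos_right _ (Nat.succ_pos _)
  revert i
  obtain h | ⟨⟨h0, h2, h3, h4, h5⟩, h1⟩ | ⟨⟨h0, h3, h4, h5⟩, h1, h2⟩ := h
  · exact fun i => (h.lt i).trans_le (Nat.le_add_left _ _)
  · refine forall_fin_six.2 ⟨?_, ?_, ?_, ?_, ?_, ?_⟩ <;> unfold hubBound <;> lia
  · have hleaves : (v 1 + 1) * hubUnit w ≤ labelCount w * hubUnit w := Nat.mul_le_mul_right _ h1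
    refine forall_fin_six.2 ⟨?_, ?_, ?_, ?_, ?_, ?_⟩ <;> unfold hubBound <;> lia

variable (Γ : Game)

theorem card_ladderVertex_lt :
    Nat.card (LadderVertex (Γ.N * Γ.N) Γ.Vertex) + labelCount Γ.encode < hubUnit Γ.encode := by
  have h : Nat.card (LadderVertex (Γ.N * Γ.N) Γ.Vertex) ≤
      Nat.card (Fin 6 → Fin (ladderBound Γ.encode)) :=
    Nat.card_le_card_of_injective
      (fun x i => ⟨ladderCode x i, (isLadderCode_ladderCode x).lt i⟩) fun x y hxy =>
        ladderCode_inj.1 (funext fun i => congrArg Fin.val (congrFun hxy i))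
  rw [Nat.card_fun, Nat.card_fin, Nat.card_fin] at h
  unfold hubUnit
  lia

theorem hubGraph_iso_iff_exists_symmetry :
    Nonempty (Γ.hubGraph (labelCount Γ.encode) (hubUnit Γ.encode) false ≃g
      Γ.hubGraph (labelCount Γ.encode) (hubUnit Γ.encode) true) ↔
      ∃ S : Γ.Symmetry, ¬S.PlayerSeparable := by
  have hlabels : labelCount Γ.encode = 7 + Γ.N * Γ.N + (4 * Γ.encode.length + 1) := by
    rw [labelCount, codeNumPlayers_encode]
  have h0 (ε) (v : LadderVertex (Γ.N * Γ.N) Γ.Vertex) :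
      ladderLabel (Γ.N * Γ.N) Game.mark (Game.label Γ.payoffLabel) ε v 0 := by
    obtain v | v := v <;> exact .inl rfl
  have h1 (ε) (v : LadderVertex (Γ.N * Γ.N) Γ.Vertex) :
      ladderLabel (Γ.N * Γ.N) Game.mark (Game.label Γ.payoffLabel) ε v 1 := by
    obtain v | v := v <;> exact .inr (.inl rfl)
  rw [Game.hubGraph, Game.hubGraph,
    hubGraph_iso_iff (by lia) (card_ladderVertex_lt Γ) (h0 _) (h1 _), hlabels]
  constructor
  · rintro ⟨σ, hσ⟩
    obtain ⟨k, hk, τ, hlabel, hmark⟩ := exists_marked_iso_of_ladder_iso hσ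
    exact exists_symmetry_of_graph_iso Game.separatesPayoffs_payoffLabel hk hlabel hmark
  · rintro ⟨S, hS⟩
    obtain ⟨k, hk, τ, hlabel, hmark⟩ :=
      S.exists_graph_iso Game.separatesPayoffs_payoffLabel hS
    exact exists_ladder_iso hk τ hlabel hmark

end Sizes

section GraphWords

/-- All tuples of length `n` with entries less than `B`. -/
def tuples (n B : ℕ) : List (Fin n → ℕ) := (profiles n fun _ => B).map fun v i => (v i).val

theorem tuples_zero (B : ℕ) : tuples 0 B = [![]] :=
  congrArg (fun v => [v]) (Subsingleton.elim _ _)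

theorem tuples_succ (n B : ℕ) : tuples (n + 1) B =
    (List.range B).flatMap fun a => (tuples n B).map (Matrix.vecCons a) := by
  simp only [← flatMap_finRange, tuples, profiles, List.map_flatMap, List.map_map]
  refine congrArg (fun f => (List.finRange B).flatMap f) (funext fun a =>
    List.map_congr_left fun v _ => funext fun i => ?_)
  refine Fin.cases rfl (fun i => ?_) i
  simp

theorem mem_tuples {n B : ℕ} {v : Fin n → ℕ} : v ∈ tuples n B ↔ ∀ i, v i < B := by
  rw [tuples, List.mem_map]
  constructor
  · rintro ⟨a, -, rfl⟩ i
    exact (a i).2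
  · exact fun h => ⟨fun i => ⟨v i, h i⟩, mem_profiles _ _ _, rfl⟩

theorem nodup_tuples (n B : ℕ) : (tuples n B).Nodup :=
  (nodup_profiles _ _).map fun _ _ h => funext fun i => Fin.ext (congrFun h i)

variable {A B : Type}

open Classical in
/-- The adjacency matrix of a relation on a list. -/
noncomputable def relationWord (L : List A) (r : A → A → Prop) : List Γ' :=
  L.flatMap fun v => encodeBits (L.map fun v' => decide (r v v'))

theorem relationWord_map (L : List B) (f : B → A) (r : A → A → Prop) :
    relationWord (L.map f) r = relationWord L fun a b => r (f a) (f b) := by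
  simp only [relationWord, List.flatMap_map, List.map_map, Function.comp_def]

theorem exists_finGraph_of_list {W : Type} (H : SimpleGraph W) {c : W → A}
    (hc : Function.Injective c) {L : List A} (hL : L.Nodup) (hmem : ∀ v, v ∈ L ↔ ∃ x, c x = v)
    {r : A → A → Prop} (hr : ∀ x y, r (c x) (c y) ↔ H.Adj x y) :
    ∃ G : FinGraph, Nonempty (G.graph ≃g H) ∧ G.encode = relationWord L r := by
  choose x hx using fun i => (hmem _).1 (L.get_mem i)
  have hbij : Function.Bijective x := by
    refine ⟨fun i j h => hL.injective_get (by rw [← hx, ← hx, h]), fun y => ?_⟩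
    obtain ⟨i, hi⟩ := List.mem_iff_get.1 ((hmem (c y)).2 ⟨y, rfl⟩)
    exact ⟨i, hc (by rw [hx, hi])⟩
  refine ⟨⟨L.length, H.comap x⟩, ⟨⟨Equiv.ofBijective x hbij, Iff.rfl⟩⟩, ?_⟩
  have hget : relationWord L r = relationWord (List.finRange L.length) (H.comap x).Adj := by
    conv_lhs => rw [← List.map_get_finRange L, relationWord_map]
    simp only [← hx, hr]
    rfl
  exact hget.symm

open Classical in
/-- The list of the codes of the vertices of the graphs of a game. -/
noncomputable def vertexList (w : List Γ') : List (Fin 6 → ℕ) :=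
  (tuples 6 (hubBound w)).filter fun v => IsHubCode w v (labelCount w) (hubUnit w)

theorem mem_vertexList {w : List Γ'} {v : Fin 6 → ℕ} :
    v ∈ vertexList w ↔ IsHubCode w v (labelCount w) (hubUnit w) := by
  simp only [vertexList, List.mem_filter, mem_tuples, decide_eq_true_eq]
  exact ⟨And.right, fun h => ⟨h.lt, h⟩⟩

/-- The code of a graph of a game, obtained from the code of the game. -/
noncomputable def graphWord (ε : ℕ) (w : List Γ') : List Γ' :=
  relationWord (vertexList w) fun v v' => CodeHubAdj w v v' ε

theorem exists_finGraph_encode_eq_graphWord (Γ : Game) (ε : Bool) :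
    ∃ G : FinGraph, Nonempty (G.graph ≃g
        Γ.hubGraph (labelCount Γ.encode) (hubUnit Γ.encode) ε) ∧
      G.encode = graphWord ε.toNat Γ.encode :=
  exists_finGraph_of_list _ hubCode_injective ((nodup_tuples _ _).filter _)
    (fun v => mem_vertexList.trans (isHubCode_iff v)) (codeHubAdj_hubCode ε)

end GraphWords

section Definability

open Context (word)

variable {X : Type} [Context Γ' X]

theorem definable_length : Definable fun x : X => (word x).length := DefinableList.word.length

theorem definable_codeNumPlayers : Definable fun x : X => codeNumPlayers (word x) :=
  .count (DefinableList.word.block _ (.const 0)) _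

theorem definable_codeNumPlayers_sq :
    Definable fun x : X => codeNumPlayers (word x) * codeNumPlayers (word x) :=
  definable_codeNumPlayers.mul definable_codeNumPlayers

theorem definable_codeNumRows : Definable fun x : X => codeNumRows (word x) :=
  (Definable.count .word _).sub (.const 1)

theorem definable_codeNumActions {i : X → ℕ} (hi : Definable i) :
    Definable fun x => codeNumActions (word x) (i x) :=
  ((DefinableList.word.block _ (.const 0)).block _ hi).length

theorem definableList_row {r : X → ℕ} (hr : Definable r) :
    DefinableList fun x => block Γ'.ket (word x) (r x + 1) :=
  DefinableList.word.block _ (hr.add (.const 1))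

theorem definable_codeAction {r i : X → ℕ} (hr : Definable r) (hi : Definable i) :
    Definable fun x => codeAction (word x) (r x) (i x) :=
  ((definableList_row hr).block _ hi).length

theorem definableList_codeNumerator {r i : X → ℕ} (hr : Definable r) (hi : Definable i) :
    DefinableList fun x => codeNumerator (word x) (r x) (i x) :=
  (definableList_row hr).block _ (definable_codeNumPlayers.add (.mul (.const 2) hi))

theorem definableList_codeDenominator {r i : X → ℕ} (hr : Definable r) (hi : Definable i) :
    DefinableList fun x => codeDenominator (word x) (r x) (i x) :=
  (definableList_row hr).block _
    (definable_codeNumPlayers.add (.add (.mul (.const 2) hi) (.const 1)))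

theorem definable_ladderBound : Definable fun x : X => ladderBound (word x) :=
  (definable_codeNumPlayers_sq.add definable_length).add (.const 6)

theorem definable_labelCount : Definable fun x : X => labelCount (word x) :=
  .add (.add (.const 7) definable_codeNumPlayers_sq) (.add (.mul (.const 4) definable_length)
    (.const 1))

theorem definable_hubUnit : Definable fun x : X => hubUnit (word x) := by
  have hsq := definable_ladderBound.mul (definable_ladderBound (X := X))
  exact ((((hsq.mul hsq).mul hsq).add definable_labelCount).add (.const 1)).congr fun x => by
    rw [hubUnit]
    ring

theorem definable_hubBound : Definable fun x : X => hubBound (word x) :=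
  (definable_labelCount.mul definable_hubUnit).add definable_ladderBound

theorem definablePred_digitLabel {T c : X → ℕ} {n d : X → List Γ'} (hT : Definable T)
    (hn : DefinableList n) (hd : DefinableList d) (hc : Definable c) :
    DefinablePred fun x => digitLabel (T x) (n x) (d x) (c x) := by
  have hletter (k : ℕ) : DefinablePred fun y : X × ℕ => c y.1 = 4 * y.2 + k :=
    .eq hc.fst (.add (.mul (.const 4) .snd) (.const k))
  exact .ex hT (((hletter 0).and (hn.fst.get .snd _)).or (((hletter 1).and (hn.fst.get .snd _)).or
    (((hletter 2).and (hd.fst.get .snd _)).or ((hletter 3).and (hd.fst.get .snd _)))))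

/-- Functions whose values are codes of vertices, with definable entries. -/
abbrev DefinableCode (v : X → Fin 6 → ℕ) : Prop := ∀ i, Definable fun x => v x i

variable {v v' : X → Fin 6 → ℕ} {c : X → ℕ}

theorem definablePred_entry_eq (hv : DefinableCode v) (i : Fin 6) (n : ℕ) :
    DefinablePred fun x => v x i = n :=
  .eq (hv i) (.const n)

theorem definablePred_codeMark (hv : DefinableCode v) :
    DefinablePred fun x => CodeMark (word x) (v x) := by
  have hN := (definable_codeNumPlayers (X := X)).fst
  exact (definablePred_entry_eq hv 0 1).and (.or
    (.and (.eq (hv 2) (hv 3)) (.ex definable_codeNumPlayers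
      (.eq (hv 1).fst (.add (.mul (hv 4).fst hN) .snd))))
    (.and (.ne (hv 2) (hv 3)) (.ex definable_codeNumPlayers
      (.and (.eq (hv 1).fst (.add (.mul .snd hN) (hv 4).fst)) (.ne .snd (hv 4).fst)))))

theorem definablePred_codePayoffLabel (hv : DefinableCode v) (hc : Definable c) :
    DefinablePred fun x => CodePayoffLabel (word x) (v x) (c x) :=
  .ex (.mul (.const 4) definable_length) (.and
    (.eq hc.fst (.add (.add (.const 7) definable_codeNumPlayers_sq.fst) (.add .snd (.const 1))))
    (definablePred_digitLabel definable_length.fst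
      (definableList_codeNumerator (hv 4) (hv 5)).fst
      (definableList_codeDenominator (hv 4) (hv 5)).fst .snd))

theorem definablePred_codeLabel (hv : DefinableCode v) (ε : ℕ) (hc : Definable c) :
    DefinablePred fun x => CodeLabel (word x) (v x) ε (c x) := by
  have hentry := definablePred_entry_eq hv
  have hlabel (n : ℕ) : DefinablePred fun x => c x = n := .eq hc (.const n)
  have hlevel : DefinablePred fun x => c x = 6 + v x 1 := .eq hc (.add (.const 6) (hv 1))
  have hlast := DefinablePred.eq (hv 1) definable_codeNumPlayers_sq
  have haction := DefinablePred.eq hc (.add (.const 7) definable_codeNumPlayers_sq)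
  exact ((hentry 0 0).and ((hlabel 0).or ((hlabel 1).or ((hlabel 2).or
      (((hlabel 3).and ((hentry 1 0).and (hentry 2 0))).or
      (((hlabel 4).and (hlast.and (hentry 2 ε))).or hlevel)))))).or
    (((hentry 0 1).or (hentry 0 2)).and ((hlabel 0).or ((hlabel 1).or
      (((hlabel 5).and (definablePred_codeMark hv)).or (hlevel.or
      (((hentry 0 1).and haction).or
      ((hentry 0 2).and (definablePred_codePayoffLabel hv hc))))))))

theorem definablePred_isLadderCode (hv : DefinableCode v) :
    DefinablePred fun x => IsLadderCode (word x) (v x) := by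
  have hentry := definablePred_entry_eq hv
  have hside (i : Fin 6) : DefinablePred fun x => v x i < 2 := .lt (hv i) (.const 2)
  have hplayer (i : Fin 6) := DefinablePred.lt (hv i) definable_codeNumPlayers
  have hcopy := (DefinablePred.lt (hv 1) definable_codeNumPlayers_sq).and
    ((hside 2).and (hside 3))
  exact (((hentry 0 0).and ((hentry 3 0).and ((hentry 4 0).and (hentry 5 0)))).and
      (.and (.lt (hv 1) (definable_codeNumPlayers_sq.add (.const 1))) (hside 2))).or
    (((hentry 0 1).and (hcopy.and ((hplayer 4).and
      (.lt (hv 5) (definable_codeNumActions (hv 4)))))).or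
    ((hentry 0 2).and (hcopy.and (.and (.lt (hv 4) definable_codeNumRows) (hplayer 5)))))

theorem definablePred_isHubCode (hv : DefinableCode v) :
    DefinablePred fun x => IsHubCode (word x) (v x) (labelCount (word x)) (hubUnit (word x)) := by
  have hentry := definablePred_entry_eq hv
  have hlabel := DefinablePred.lt (hv 1) definable_labelCount
  have hunused := (hentry 3 0).and ((hentry 4 0).and (hentry 5 0))
  exact (definablePred_isLadderCode hv).or
    ((((hentry 0 3).and ((hentry 2 0).and hunused)).and hlabel).or
    (((hentry 0 4).and hunused).and (hlabel.and
      (.lt (hv 2) (.mul ((hv 1).add (.const 1)) definable_hubUnit)))))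

theorem definablePred_ne_code (hv : DefinableCode v) (hv' : DefinableCode v') :
    DefinablePred fun x => v x ≠ v' x := by
  have heq (i : Fin 6) := DefinablePred.eq (hv i) (hv' i)
  exact ((heq 0).and ((heq 1).and ((heq 2).and ((heq 3).and ((heq 4).and (heq 5)))))).not.congr
    fun x => code_eq_iff.not

theorem definablePred_codeGameAdj (hv : DefinableCode v) (hv' : DefinableCode v') :
    DefinablePred fun x => CodeGameAdj (word x) (v x) (v' x) := by
  have hentry := definablePred_entry_eq hv
  have hentry' := definablePred_entry_eq hv'
  have hclique := (DefinablePred.eq (hv 4) (hv' 4)).and (.ne (hv 5) (hv' 5))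
  exact (((hentry 0 1).and (hentry' 0 1)).and hclique).or
    ((((hentry 0 2).and (hentry' 0 2)).and hclique).or
    ((((hentry 0 1).and (hentry' 0 2)).and (.and (.eq (hv 4) (hv' 5))
      (.eq (hv 5) (definable_codeAction (hv' 4) (hv' 5))))).or
    (((hentry 0 2).and (hentry' 0 1)).and (.and (.eq (hv' 4) (hv 5))
      (.eq (hv' 5) (definable_codeAction (hv 4) (hv 5)))))))

theorem definablePred_codeLadderRel (hv : DefinableCode v) (hv' : DefinableCode v') :
    DefinablePred fun x => CodeLadderRel (word x) (v x) (v' x) := by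
  have hentry := definablePred_entry_eq hv
  have hentry' := definablePred_entry_eq hv'
  have heq (i : Fin 6) := DefinablePred.eq (hv i) (hv' i)
  exact (((hentry 0 0).and ((hentry' 0 1).or (hentry' 0 2))).and (((heq 1).and (heq 2)).or
      (.and (.eq (hv 1) ((hv' 1).add (.const 1))) (.eq (hv 2) (hv' 3))))).or
    (((heq 1).and ((heq 2).and (heq 3))).and (definablePred_codeGameAdj hv hv'))

theorem definablePred_codeHubRel (hv : DefinableCode v) (hv' : DefinableCode v') (ε : ℕ) :
    DefinablePred fun x => CodeHubRel (word x) (v x) (v' x) ε := by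
  have hladder : DefinablePred fun x => v x 0 < 3 := .lt (hv 0) (.const 3)
  have hladder' : DefinablePred fun x => v' x 0 < 3 := .lt (hv' 0) (.const 3)
  exact ((hladder.and hladder').and ((definablePred_ne_code hv hv').and
      ((definablePred_codeLadderRel hv hv').or (definablePred_codeLadderRel hv' hv)))).or
    (((hladder.and (definablePred_entry_eq hv' 0 3)).and
      (definablePred_codeLabel hv ε (hv' 1))).or
    (((definablePred_entry_eq hv 0 3).and (definablePred_entry_eq hv' 0 4)).and
      (.eq (hv 1) (hv' 1))))

theorem definablePred_codeHubAdj (hv : DefinableCode v) (hv' : DefinableCode v') (ε : ℕ) :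
    DefinablePred fun x => CodeHubAdj (word x) (v x) (v' x) ε :=
  (definablePred_ne_code hv hv').and
    ((definablePred_codeHubRel hv hv' ε).or (definablePred_codeHubRel hv' hv ε))

end Definability

section GraphReduction

open Context (word)

variable {X β : Type}

/-- A context with six more variables, which hold the code of a vertex. -/
abbrev CodeContext (X : Type) : Type := (((((X × ℕ) × ℕ) × ℕ) × ℕ) × ℕ) × ℕ

/-- The context without the six variables. -/
def CodeContext.base (y : CodeContext X) : X := y.1.1.1.1.1.1

/-- The values of the six variables. -/
def CodeContext.code (y : CodeContext X) : Fin 6 → ℕ :=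
  ![y.1.1.1.1.1.2, y.1.1.1.1.2, y.1.1.1.2, y.1.1.2, y.1.2, y.2]

variable [Context Γ' X]

theorem CodeContext.definable_code : DefinableCode fun y : CodeContext X => y.code := by
  have hlast {Z : Type} [Context Γ' Z] : Definable fun y : Z × ℕ => y.2 := .snd
  exact forall_fin_six.2 ⟨hlast.fst.fst.fst.fst.fst, hlast.fst.fst.fst.fst, hlast.fst.fst.fst,
    hlast.fst.fst, hlast.fst, hlast⟩

theorem flatMap_filter {A : Type} (l : List A) (p : A → Prop) [DecidablePred p] (g : A → List β) :
    (l.filter fun v => p v).flatMap g = l.flatMap fun v => if p v then g v else [] := by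
  induction l with
  | nil => rfl
  | cons v l ih => by_cases h : p v <;> simp [h, ih]

theorem definableWord_flatMap_tuples {b : X → ℕ} (hb : Definable b) {g : X → (Fin 6 → ℕ) → List β}
    (hg : DefinableWord fun y : CodeContext X => g y.base y.code) :
    DefinableWord fun x => (tuples 6 (b x)).flatMap (g x) := by
  simp only [tuples_succ, tuples_zero, List.flatMap_assoc, List.flatMap_map, List.flatMap_cons,
    List.flatMap_nil, List.append_nil]
  exact .flatMap hb <| .flatMap hb.fst <| .flatMap hb.fst.fst <| .flatMap hb.fst.fst.fst <|
    .flatMap hb.fst.fst.fst.fst <| .flatMap hb.fst.fst.fst.fst.fst hg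

theorem definableWord_flatMap_vertexList {g : X → (Fin 6 → ℕ) → List β}
    (hg : DefinableWord fun y : CodeContext X => g y.base y.code) :
    DefinableWord fun x => (vertexList (word x)).flatMap (g x) := by
  classical
  simp only [vertexList, flatMap_filter]
  exact definableWord_flatMap_tuples definable_hubBound
    (.ite (definablePred_isHubCode CodeContext.definable_code) hg .nil)

theorem definableWord_bit_decide {p : X → Prop} [DecidablePred p] (hp : DefinablePred p) :
    DefinableWord fun x => [Γ'.bit (decide (p x))] :=
  (DefinableWord.ite hp (.const [Γ'.bit true]) (.const [Γ'.bit false])).congr fun x => by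
    by_cases h : p x <;> simp [h]

open Classical in
theorem graphWord_eq_flatMap (ε : ℕ) (w : List Γ') : graphWord ε w = (vertexList w).flatMap fun v =>
    ((vertexList w).flatMap fun v' => [Γ'.bit (decide (CodeHubAdj w v v' ε))]) ++ [Γ'.comma] := by
  simp only [graphWord, relationWord, encodeBits, List.map_map, ← List.map_eq_flatMap,
    Function.comp_def]

theorem definableWord_graphWord (ε : ℕ) : DefinableWord (graphWord ε) := by
  classical
  have hletter : DefinableWord fun y : CodeContext (CodeContext (List Γ')) =>
      [Γ'.bit (decide (CodeHubAdj (word y.base) y.base.code y.code ε))] :=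
    definableWord_bit_decide (definablePred_codeHubAdj
      (fun i => (CodeContext.definable_code i).fst.fst.fst.fst.fst.fst)
      CodeContext.definable_code ε)
  have hrow : DefinableWord fun y : CodeContext (List Γ') =>
      ((vertexList (word y)).flatMap fun v' =>
        [Γ'.bit (decide (CodeHubAdj (word y) y.code v' ε))]) ++ [Γ'.comma] :=
    (definableWord_flatMap_vertexList (X := CodeContext (List Γ')) (g := fun y v' =>
      [Γ'.bit (decide (CodeHubAdj (word y) y.code v' ε))]) hletter).append (.const _)
  exact (definableWord_flatMap_vertexList (X := List Γ') (g := fun w v =>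
    ((vertexList w).flatMap fun v' => [Γ'.bit (decide (CodeHubAdj w v v' ε))]) ++ [Γ'.comma])
    hrow).congr (graphWord_eq_flatMap ε)

theorem nonPlayerSeparableSymmetry_inGI : nonPlayerSeparableSymmetry.InGI := by
  choose G hG hcode using exists_finGraph_encode_eq_graphWord
  refine ⟨fun Γ => (G Γ false, G Γ true), ?_, fun Γ => ?_⟩
  · refine (((definableWord_graphWord 0).map Sum.inl).append
      ((definableWord_graphWord 1).map Sum.inr)).computable _ _ _ fun Γ => ?_
    exact (congrArg₂ (fun a b => a.map Sum.inl ++ b.map Sum.inr) (hcode Γ false)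
      (hcode Γ true)).symm
  · refine (hubGraph_iso_iff_exists_symmetry Γ).symm.trans ?_
    obtain ⟨e⟩ := hG Γ false
    obtain ⟨e'⟩ := hG Γ true
    exact ⟨fun ⟨f⟩ => ⟨(e.trans f).trans e'.symm⟩, fun ⟨f⟩ => ⟨(e.symm.trans f).trans e'⟩⟩

end GraphReduction

end GameSym

/-- Deciding whether a game has a symmetry that is not player-separable is GI-complete, and
GI-hardness holds already for two-player zero-sum games. -/
theorem mainTheorem4 :
    GameSym.nonPlayerSeparableSymmetry.GIComplete ∧
      (GameSym.nonPlayerSeparableSymmetry.restrict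
        GameSym.Game.IsTwoPlayerZeroSum).GIHard :=
  ⟨⟨GameSym.nonPlayerSeparableSymmetry_inGI, GameSym.nonPlayerSeparableSymmetry_GIHard⟩,
    GameSym.zeroSum_GIHard⟩
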